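/- Let $n,m\ge 1$ and let $\mathcal G=(\{1,\dots,n\},\mathcal E)$ be a strongly connected directed graph with $(i,i)\in\mathcal E$ for all $i$. Let $W_r$ be a row-stochastic and $W_c$ a column-stochastic $n\times n$ matrix, whose entries $[W_r]_{ij}$, $[W_c]_{ij}$ are positive if $(j,i)\in\mathcal E$ and zero otherwise. Let $f_1,\dots,f_n:\mathbb R^m\to\mathbb R$ satisfy $|f_i(x)-f_i(y)|\le\hat D\|x-y\|$ for all $x,y$, where $\hat D>0$, and let $f=\sum_{i=1}^n f_i$ be convex (the $f_i$ need not be). For $\mu>0$ let $$f_{i,\mu}(x)=\frac1\kappa\int_{\mathbb R^m}f_i(x+\mu\zeta)\,e^{-\|\zeta\|^2/2}\,d\zeta,\qquad \kappa=\int_{\mathbb R^m}e^{-\|\zeta\|^2/2}\,d\zeta,\qquad f_\mu=\sum_{i=1}^n f_{i,\mu}.$$ Assume that the set of minimizers of $f$ and the set $\mathcal X_\mu^\star$ of minimizers of $f_\mu$ are non-empty, and let $f^\star=\min f$. Let $\zeta^i_k$ ($1\le i\le n$, $k\ge0$) be standard Gaussian random vectors in $\mathbb R^m$ such that each $\zeta^i_k$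 is independent of the $\sigma$-algebra $\mathcal F_k$ generated by all $\zeta^j_r$ with $1\le j\le n$ and $r<k$. From arbitrary deterministic $x^i_0,y^i_0\in\mathbb R^m$ define, for $k\ge0$, $$x^i_{k+1}=\sum_{j=1}^n[W_r]_{ij}x^j_k+\epsilon y^i_k-\alpha_k\,\frac{f_i(x^i_k+\mu\zeta^i_k)-f_i(x^i_k)}{\mu}\,\zeta^i_k,$$ $$y^i_{k+1}=x^i_k-\sum_{j=1}^n[W_r]_{ij}x^j_k+\sum_{j=1}^n[W_c]_{ij}y^j_k-\epsilon y^i_k,$$ where $\alpha_k\ge0$, $\sum_k\alpha_k=\infty$, $\sum_k\alpha_k^2<\infty$, and $$0<\epsilon\le\bar\epsilon=\frac{(1-|\lambda_3|)^n}{(20+8n)^n}.$$ Here $\lambda_3$ is the third largest eigenvalue in modulus, counted with algebraic multiplicity, of $\begin{bmatrix}W_r&0\\ I-W_r&W_c\end{bmatrix}$ (with $\lambda_3=0$ if $n=1$). Then: 1. there is a random vector $x^\star_\mu$, the same for all agents, with $x^\star_\mu\in\mathcal X^\star_\mu$ almost surely, such that for every $i$, $x^i_k\to x^\star_\mu$ almost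 surely and $\mathbf E\|x^i_k-x^\star_\mu\|\to0$ as $k\to\infty$; 2. for every $i$, $\lim_{k\to\infty}\mathbf E[f(x^i_k)]$ exists and $$\lim_{k\to\infty}\mathbf E[f(x^i_k)]-f^\star\le 2n\sqrt m\,\mu\hat D.$$ -/

import Mathlib

open MeasureTheory ProbabilityTheory Filter Topology

/-- A digraph is strongly connected if every vertex reaches every vertex along directed edges. -/
def Digraph.IsStronglyConnected {V : Type*} (G : Digraph V) : Prop :=
  ∀ i j : V, Relation.ReflTransGen G.Adj i j

/-- A square matrix `A` is a weight matrix for the digraph `G` if `A i j` is positive when agent `i`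
can receive information from agent `j` (that is, when `(j, i)` is an edge) and zero otherwise. -/
def Digraph.IsWeightMatrix {V : Type*} (G : Digraph V) (A : Matrix V V ℝ) : Prop :=
  ∀ i j : V, (G.Adj j i → 0 < A i j) ∧ (¬ G.Adj j i → A i j = 0)

/-- The surplus-based weight matrix `W = [[Wr, ε I], [I - Wr, Wc - ε I]]`. -/
def surplusMatrix {n : ℕ} (Wr Wc : Matrix (Fin n) (Fin n) ℝ) (ε : ℝ) :
    Matrix (Fin n ⊕ Fin n) (Fin n ⊕ Fin n) ℝ :=
  Matrix.fromBlocks Wr (ε • (1 : Matrix (Fin n) (Fin n) ℝ)) (1 - Wr) (Wc - ε • 1)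

/-- The moduli of the complex eigenvalues of a real square matrix, counted with algebraic
multiplicity, in decreasing order. -/
noncomputable def eigenvalueModuli {ι : Type*} [Fintype ι] [DecidableEq ι] (A : Matrix ι ι ℝ) :
    List ℝ :=
  ((A.map (algebraMap ℝ ℂ)).charpoly.roots.map (fun z : ℂ => ‖z‖)).sort (fun a b => b ≤ a)

/-- The modulus `|λ₃|` of the third largest eigenvalue of the surplus-based weight matrix with
`ε = 0`. If `n = 1` this matrix has only two eigenvalues, and the value is `0`. -/
noncomputable def thirdModulus {n : ℕ} (Wr Wc : Matrix (Fin n) (Fin n) ℝ) : ℝ :=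
  (eigenvalueModuli (surplusMatrix Wr Wc 0)).getD 2 0

/-- The upper limit `(1 - |λ₃|) ^ n / (20 + 8 n) ^ n` on the parameter `ε`. -/
noncomputable def epsBar {n : ℕ} (Wr Wc : Matrix (Fin n) (Fin n) ℝ) : ℝ :=
  1 / (20 + 8 * (n : ℝ)) ^ n * (1 - thirdModulus Wr Wc) ^ n

/-- The Gaussian smoothing `(1 / κ) ∫ g (x + μ ζ) exp (-‖ζ‖² / 2) dζ`, where
`κ = ∫ exp (-‖ζ‖² / 2) dζ`. -/
noncomputable def gaussianSmoothing {m : ℕ} (μ : ℝ) (g : EuclideanSpace ℝ (Fin m) → ℝ)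
    (x : EuclideanSpace ℝ (Fin m)) : ℝ :=
  1 / (∫ ζ : EuclideanSpace ℝ (Fin m), Real.exp (-(1 / 2) * ‖ζ‖ ^ 2)) *
    ∫ ζ : EuclideanSpace ℝ (Fin m), g (x + μ • ζ) * Real.exp (-(1 / 2) * ‖ζ‖ ^ 2)

/-- The set of global minimizers of a real function. -/
def argminSet {X : Type*} (g : X → ℝ) : Set X :=
  {x | ∀ y, g x ≤ g y}

/-- The randomized gradient-free oracle of `g` at `x` with random direction `ζ`. -/
noncomputable def gradFreeOracle {m : ℕ} (μ : ℝ) (g : EuclideanSpace ℝ (Fin m) → ℝ)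
    (x ζ : EuclideanSpace ℝ (Fin m)) : EuclideanSpace ℝ (Fin m) :=
  ((g (x + μ • ζ) - g x) / μ) • ζ

/-- The pair `(x_k, y_k)` of the states of all agents at time `k`, produced by the surplus-based
gradient-free method from the initial states `x0`, `y0` and the directions `ζ i k`. -/
noncomputable def surplusState {n m : ℕ} (Wr Wc : Matrix (Fin n) (Fin n) ℝ) (ε μ : ℝ)
    (α : ℕ → ℝ) (f : Fin n → EuclideanSpace ℝ (Fin m) → ℝ)
    (x0 y0 : Fin n → EuclideanSpace ℝ (Fin m)) (ζ : Fin n → ℕ → EuclideanSpace ℝ (Fin m)) :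
    ℕ → (Fin n → EuclideanSpace ℝ (Fin m)) × (Fin n → EuclideanSpace ℝ (Fin m))
  | 0 => (x0, y0)
  | k + 1 =>
    let x := (surplusState Wr Wc ε μ α f x0 y0 ζ k).1
    let y := (surplusState Wr Wc ε μ α f x0 y0 ζ k).2
    (fun i => ∑ j, Wr i j • x j + ε • y i - α k • gradFreeOracle μ (f i) (x i) (ζ i k),
      fun i => x i - ∑ j, Wr i j • x j + ∑ j, Wc i j • y j - ε • y i)

/-- The decision `x_k^i` of agent `i` at time `k`, as a random vector. -/
noncomputable def agentIterate {Ω : Type*} {n m : ℕ} (Wr Wc : Matrix (Fin n) (Fin n) ℝ)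
    (ε μ : ℝ) (α : ℕ → ℝ) (f : Fin n → EuclideanSpace ℝ (Fin m) → ℝ)
    (x0 y0 : Fin n → EuclideanSpace ℝ (Fin m)) (ζ : Fin n → ℕ → Ω → EuclideanSpace ℝ (Fin m))
    (i : Fin n) (k : ℕ) (ω : Ω) : EuclideanSpace ℝ (Fin m) :=
  (surplusState Wr Wc ε μ α f x0 y0 (fun j r => ζ j r ω) k).1 i

/-- The σ-algebra `F_k` generated by the random directions of all agents before time `k`. -/
@[reducible]
def pastSigma {Ω : Type*} {n m : ℕ} (ζ : Fin n → ℕ → Ω → EuclideanSpace ℝ (Fin m)) (k : ℕ) :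
    MeasurableSpace Ω :=
  ⨆ (j : Fin n) (r : ℕ) (_ : r < k), MeasurableSpace.comap (ζ j r) inferInstance

/-! The weights of a directed graph need not be doubly stochastic, so the average of the states alone is
not preserved by the communication. The average of all states and surpluses is, because `Wc` is
column-stochastic (`surplusMean_succ`). The agents contract towards this average, and the average
performs a stochastic subgradient descent.

**Consensus.** Let `W` be the surplus-based weight matrix and `P` the averaging projection, so that
`P * W = P`. The powers of `W - P` decay geometrically as soon as `W` has no eigenvalue
`l ≠ 1` with `1 ≤ ‖l‖` (`surplusMatrix_eigenvector_eq_zero`). For such an `l` put `z = l - 1`, let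
`v` be the surplus part of an eigenvector and put `w = (l - Wc) v`, so that `(l - Wr) w = -ε z v`. Off
the eigenvalue `1`, the eigenvalues of `Wr` and `Wc` lie in the disc of radius `|λ₃| = 1 - δ`
(`norm_le_thirdModulus`). Since `Wr` is a contraction for the supremum norm and `Wc` is one for the
`ℓ¹` norm, a resolvent bound of order `3 ^ (n - 1) / δ` holds for both on the complement of the
eigenvalue `1`. It comes from dividing out the eigenvalues by Blaschke factors, each
of which costs a factor `3` only (`exists_blaschke_step`, `norm_le_resolvent`). The bounds determine
`v` and `w` up to small errors by their components along the stationary vectors `ρ`, `π` of `Wc`,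
`Wr`, and leave the scalar relation `z ≈ -ε n ⟨π, ρ⟩`; for `ε ≤ epsBar Wr Wc` this puts `1 + z` inside
the unit disc. Consequently the disagreement of the agents is dominated by a scalar contraction driven
by `α k` times the squared norms of the directions (`norm_sub_surplusMean_le`), and its second moments
are summable (`exists_consensus_bound`).

**Convergence of the average.** The oracle of a `D`-Lipschitz function is bounded by `D ‖ζ‖ ^ 2`, and
its Gaussian mean `meanOracle` is Lipschitz. For a convex function the mean is a subgradient of the
Gaussian smoothing (`inner_meanOracle_le`): differentiating the smoothing in a direction moves the
derivative onto the Gaussian density. Convexity is used for the sum of the costs only. Thus the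
average performs a stochastic subgradient descent for the smoothed cost, with a perturbation caused by
the disagreement (`isStochasticDescent_surplusMean`). For such a recursion the squared distance to a
minimizer, suitably compensated, is an `L¹`-bounded martingale. So almost surely the distance to each
minimizer of a countable dense family converges and the values have the minimum as a cluster value,
which forces convergence to one minimizer; the `L²` bound turns this into convergence in mean
(`IsStochasticDescent.exists_tendsto`).

**Optimality gap.** A `D`-Lipschitz function differs from its smoothing by at most `D μ √m`. Passing
from the cost to the smoothed cost and back costs `2 n √m μ D`
(`sum_le_of_mem_argminSet_smoothing`). -/

/-! ### Resolvents of contractions -/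

/-- One Blaschke factor `b(T) = (T - a)(1 - ā T)⁻¹` of a contraction `T`, applied to `x`. The vector
`x'` is `b(T) x`; it is annihilated by whatever is left of an annihilating polynomial of `x` once the
factor `X - a` is removed, and passing from `x` to `x'` changes the size of the residual
`l • x - T x` by the factor `3` only, whereas the naive step `x ↦ (T - a) x` loses a factor
`‖l - a‖⁻¹` each time. -/
theorem exists_blaschke_step {E : Type*} [NormedAddCommGroup E] [NormedSpace ℂ E]
    [FiniteDimensional ℂ E] (T : Module.End ℂ E) (hT : ∀ x, ‖T x‖ ≤ ‖x‖) {δ : ℝ} (hδ : 0 < δ)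
    (a : ℂ) (ha : ‖a‖ ≤ 1 - δ) (q : Polynomial ℂ) (x : E)
    (hx : Polynomial.aeval T ((Polynomial.X - Polynomial.C a) * q) x = 0)
    (l : ℂ) (hl : 1 ≤ ‖l‖) :
    ∃ x' : E, Polynomial.aeval T q x' = 0 ∧ ‖l • x' - T x'‖ ≤ 3 * ‖l • x - T x‖ ∧
      ‖x‖ ≤ ‖x'‖ + 2 / (‖l‖ - 1 + δ) * ‖l • x - T x‖ := by
  set c : ℂ := (starRingEnd ℂ) a with hc
  have hca : ‖c‖ = ‖a‖ := by simp [hc]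
  have ha0 : 0 ≤ ‖a‖ := norm_nonneg a
  -- `1 - ā T` is bounded below, hence invertible
  have hlow : ∀ u : E, (1 - ‖a‖) * ‖u‖ ≤ ‖u - c • T u‖ := by
    intro u
    have h1 : ‖u‖ - ‖c • T u‖ ≤ ‖u - c • T u‖ := norm_sub_norm_le _ _
    have h2 : ‖c • T u‖ ≤ ‖a‖ * ‖u‖ := by
      rw [norm_smul, hca]; exact mul_le_mul_of_nonneg_left (hT u) ha0
    linarith
  have hzero : ∀ u : E, u - c • T u = 0 → u = 0 := by
    intro u hu
    have := hlow u
    rw [hu, norm_zero] at this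
    have h3 : ‖u‖ ≤ 0 := by
      by_contra hcon
      push Not at hcon
      have : 0 < (1 - ‖a‖) * ‖u‖ := mul_pos (by linarith) hcon
      linarith
    simpa using h3
  let S : E →ₗ[ℂ] E := LinearMap.id - c • T
  have hSapp : ∀ u, S u = u - c • T u := fun u => rfl
  have hinj : Function.Injective S := by
    rw [← LinearMap.ker_eq_bot, LinearMap.ker_eq_bot']
    intro u hu
    exact hzero u (by rw [← hSapp]; exact hu)
  obtain ⟨z, hz⟩ := (LinearMap.injective_iff_surjective.mp hinj) x
  rw [hSapp] at hz
  set y := l • x - T x with hy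
  set w := l • z - T z with hw
  have hwy : w - c • T w = y := by
    rw [hy, ← hz, hw]
    simp only [map_sub, map_smul, smul_sub]
    rw [smul_comm l c]; abel
  have hac : c * a = ((‖a‖ ^ 2 : ℝ) : ℂ) := by
    rw [hc, mul_comm, Complex.mul_conj, Complex.normSq_eq_norm_sq]
  refine ⟨T z - a • z, ?_, ?_, ?_⟩
  · set x' := T z - a • z with hx'
    have h1 : Polynomial.aeval T ((Polynomial.X - Polynomial.C a) * q *
        (1 - Polynomial.C c * Polynomial.X)) z = 0 := by
      rw [map_mul, Module.End.mul_apply]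
      have : Polynomial.aeval T (1 - Polynomial.C c * Polynomial.X) z = x := by
        rw [← hz]
        simp [Module.algebraMap_end_apply]
      rw [this, hx]
    have h2 : Polynomial.aeval T ((1 - Polynomial.C c * Polynomial.X) * (q *
        (Polynomial.X - Polynomial.C a))) z = 0 := by
      rw [← h1]; congr 2; ring
    rw [map_mul, Module.End.mul_apply, map_mul, Module.End.mul_apply] at h2
    have h3 : Polynomial.aeval T (Polynomial.X - Polynomial.C a) z = x' := by
      simp [Module.algebraMap_end_apply, hx']
    rw [h3] at h2
    apply hzero
    simpa [Module.algebraMap_end_apply] using h2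
  · have e1 : l • (T z - a • z) - T (T z - a • z) = T w - a • w := by
      rw [hw]; simp only [map_sub, map_smul, smul_sub]
      rw [smul_comm l a]; abel
    have e2 : T w - a • w = - (a • y) + ((1 - ‖a‖ ^ 2 : ℝ) : ℂ) • T w := by
      have : ((1 - ‖a‖ ^ 2 : ℝ) : ℂ) = 1 - c * a := by rw [hac]; push_cast; ring
      rw [this, ← hwy]
      clear_value w
      module
    rw [e1, e2]
    have b1 := hlow w
    rw [hwy] at b1
    have b2 : ‖((1 - ‖a‖ ^ 2 : ℝ) : ℂ) • T w‖ ≤ (1 + ‖a‖) * ‖y‖ := by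
      rw [norm_smul, Complex.norm_real, Real.norm_of_nonneg (by nlinarith)]
      calc (1 - ‖a‖ ^ 2) * ‖T w‖ ≤ (1 - ‖a‖ ^ 2) * ‖w‖ :=
            mul_le_mul_of_nonneg_left (hT w) (by nlinarith)
        _ = (1 + ‖a‖) * ((1 - ‖a‖) * ‖w‖) := by ring
        _ ≤ _ := mul_le_mul_of_nonneg_left b1 (by linarith)
    calc _ ≤ ‖-(a • y)‖ + ‖((1 - ‖a‖ ^ 2 : ℝ) : ℂ) • T w‖ := norm_add_le _ _
      _ ≤ ‖a‖ * ‖y‖ + (1 + ‖a‖) * ‖y‖ := by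
          rw [norm_neg, norm_smul]; linarith
      _ ≤ 3 * ‖y‖ := by nlinarith [norm_nonneg y]
  · set x' := T z - a • z with hx'
    have e : (l - a) • x = (1 - c * l) • x' + ((1 - ‖a‖ ^ 2 : ℝ) : ℂ) • w := by
      have : ((1 - ‖a‖ ^ 2 : ℝ) : ℂ) = 1 - c * a := by rw [hac]; push_cast; ring
      rw [this, hx', hw, ← hz]
      module
    have b1 := hlow w
    rw [hwy] at b1
    have b2 : ‖((1 - ‖a‖ ^ 2 : ℝ) : ℂ) • w‖ ≤ 2 * ‖y‖ := by
      rw [norm_smul, Complex.norm_real, Real.norm_of_nonneg (by nlinarith)]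
      calc (1 - ‖a‖ ^ 2) * ‖w‖ = (1 + ‖a‖) * ((1 - ‖a‖) * ‖w‖) := by ring
        _ ≤ (1 + ‖a‖) * ‖y‖ := mul_le_mul_of_nonneg_left b1 (by linarith)
        _ ≤ _ := by nlinarith [norm_nonneg y]
    have b3 : ‖1 - c * l‖ ≤ ‖l - a‖ := by
      apply abs_le_of_sq_le_sq' _ (norm_nonneg _) |>.2
      have h1 : ‖1 - c * l‖ ^ 2 = 1 - 2 * (c * l).re + ‖a‖ ^ 2 * ‖l‖ ^ 2 := by
        rw [← Complex.normSq_eq_norm_sq, ← Complex.normSq_eq_norm_sq, ← Complex.normSq_eq_norm_sq]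
        simp only [Complex.normSq_apply, hc, Complex.sub_re, Complex.sub_im, Complex.mul_re,
          Complex.mul_im, Complex.conj_re, Complex.conj_im, Complex.one_re, Complex.one_im]
        ring
      have h2 : ‖l - a‖ ^ 2 = ‖l‖ ^ 2 - 2 * (c * l).re + ‖a‖ ^ 2 := by
        rw [← Complex.normSq_eq_norm_sq, ← Complex.normSq_eq_norm_sq, ← Complex.normSq_eq_norm_sq]
        simp only [Complex.normSq_apply, hc, Complex.sub_re, Complex.sub_im, Complex.mul_re,
          Complex.conj_re, Complex.conj_im]
        ring
      rw [h1, h2]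
      nlinarith [mul_nonneg (sub_nonneg.2 (one_le_pow₀ hl : 1 ≤ ‖l‖ ^ 2))
        (by nlinarith : 0 ≤ 1 - ‖a‖ ^ 2)]
    have b4 : ‖l‖ - 1 + δ ≤ ‖l - a‖ := by
      have := norm_sub_norm_le l a
      linarith
    have hM : 0 < ‖l‖ - 1 + δ := by linarith
    have b5 : ‖l - a‖ * ‖x‖ ≤ ‖l - a‖ * ‖x'‖ + 2 * ‖y‖ := by
      calc ‖l - a‖ * ‖x‖ = ‖(l - a) • x‖ := (norm_smul _ _).symm
        _ ≤ ‖(1 - c * l) • x'‖ + ‖((1 - ‖a‖ ^ 2 : ℝ) : ℂ) • w‖ := by rw [e]; exact norm_add_le _ _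
        _ ≤ _ := by
          rw [norm_smul]
          have := mul_le_mul_of_nonneg_right b3 (norm_nonneg x')
          linarith
    have hpos : 0 < ‖l - a‖ := lt_of_lt_of_le hM b4
    have b6 : ‖x‖ ≤ ‖x'‖ + 2 / ‖l - a‖ * ‖y‖ := by
      have : ‖l - a‖ * ‖x‖ ≤ ‖l - a‖ * (‖x'‖ + 2 / ‖l - a‖ * ‖y‖) := by
        have : ‖l - a‖ * (‖x'‖ + 2 / ‖l - a‖ * ‖y‖) = ‖l - a‖ * ‖x'‖ + 2 * ‖y‖ := by
          field_simp
        rw [this]; exact b5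
      exact le_of_mul_le_mul_left this hpos
    refine b6.trans ?_
    gcongr

/-- Resolvent bound for a contraction `T` outside the open unit disc, on the vectors annihilated by
`∏ (T - a)`, where the `d` numbers `a` lie in the disc of radius `1 - δ`. The point is that the bound
is linear in `1 / δ`; only the constant depends on `d`. -/
theorem norm_le_resolvent {E : Type*} [NormedAddCommGroup E] [NormedSpace ℂ E]
    [FiniteDimensional ℂ E] (T : Module.End ℂ E) (hT : ∀ x, ‖T x‖ ≤ ‖x‖) {δ : ℝ} (hδ : 0 < δ)
    (l : ℂ) (hl : 1 ≤ ‖l‖) (s : Multiset ℂ) (hs : ∀ a ∈ s, ‖a‖ ≤ 1 - δ) (x : E)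
    (hx : Polynomial.aeval T (s.map fun a => Polynomial.X - Polynomial.C a).prod x = 0) :
    ‖x‖ ≤ (3 ^ s.card - 1) / (‖l‖ - 1 + δ) * ‖l • x - T x‖ := by
  induction s using Multiset.induction_on generalizing x with
  | empty => simpa using hx
  | cons a s ih =>
    rw [Multiset.map_cons, Multiset.prod_cons] at hx
    obtain ⟨x', h1, h2, h3⟩ := exists_blaschke_step T hT hδ a (hs a (by simp)) _ x hx l hl
    have h4 := ih (fun b hb => hs b (by simp [hb])) x' h1
    have hM : 0 < ‖l‖ - 1 + δ := by linarith
    have hp : (1 : ℝ) ≤ 3 ^ s.card := one_le_pow₀ (by norm_num)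
    have h5 : (3 ^ s.card - 1) / (‖l‖ - 1 + δ) * ‖l • x' - T x'‖ ≤
        (3 ^ s.card - 1) / (‖l‖ - 1 + δ) * (3 * ‖l • x - T x‖) :=
      mul_le_mul_of_nonneg_left h2 (div_nonneg (by linarith) hM.le)
    calc ‖x‖ ≤ _ := h3
      _ ≤ (3 ^ s.card - 1) / (‖l‖ - 1 + δ) * (3 * ‖l • x - T x‖) +
          2 / (‖l‖ - 1 + δ) * ‖l • x - T x‖ := by linarith
      _ = _ := by
        rw [Multiset.card_cons, pow_succ]; field_simp; ring

/-! ### Irreducible stochastic matrices -/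

/-- A real square matrix is called irreducible here if every index reaches every index along
positive entries. -/
def Matrix.PosConnected {ι : Type*} (W : Matrix ι ι ℝ) : Prop :=
  ∀ i j, Relation.ReflTransGen (fun a b => 0 < W a b) i j

section Stochastic

variable {ι : Type*} [Fintype ι] [DecidableEq ι] {W : Matrix ι ι ℝ}

/-- Maximum principle: a right fixed vector of an irreducible row-stochastic matrix is constant. -/
theorem eq_of_mulVec_eq_self (hW : W ∈ Matrix.rowStochastic ℝ ι) (hc : W.PosConnected)
    (v : ι → ℝ) (hv : W.mulVec v = v) (i j : ι) : v i = v j := by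
  obtain ⟨m, -, hm⟩ := Finset.exists_min_image Finset.univ v ⟨i, Finset.mem_univ i⟩
  have key : ∀ b, v b = v m := by
    intro b
    induction hc m b with
    | refl => rfl
    | @tail b c _ hbc ih =>
      have h1 : ∑ d, W b d * (v d - v m) = 0 := by
        have := congrFun hv b
        simp only [Matrix.mulVec, dotProduct] at this
        simp only [mul_sub, Finset.sum_sub_distrib, this, ← Finset.sum_mul,
          Matrix.sum_row_of_mem_rowStochastic hW b, ih]
        ring
      have h2 := (Finset.sum_eq_zero_iff_of_nonneg (fun d _ =>
        mul_nonneg (Matrix.nonneg_of_mem_rowStochastic hW)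
          (sub_nonneg.2 (hm d (Finset.mem_univ d))))).1 h1 c (Finset.mem_univ c)
      rcases mul_eq_zero.1 h2 with h | h
      · exact absurd h hbc.ne'
      · linarith
  rw [key i, key j]

theorem eq_of_mulVec_eq_self_complex (hW : W ∈ Matrix.rowStochastic ℝ ι) (hc : W.PosConnected)
    (v : ι → ℂ) (hv : (W.map (algebraMap ℝ ℂ)).mulVec v = v) (i j : ι) : v i = v j := by
  apply Complex.ext
  · refine eq_of_mulVec_eq_self hW hc (fun i => (v i).re) ?_ i j
    ext k
    have := congrArg Complex.re (congrFun hv k)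
    simpa [Matrix.mulVec, dotProduct] using this
  · refine eq_of_mulVec_eq_self hW hc (fun i => (v i).im) ?_ i j
    ext k
    have := congrArg Complex.im (congrFun hv k)
    simpa [Matrix.mulVec, dotProduct] using this

/-- A nonnegative left fixed vector is positive as soon as one entry is. -/
theorem pos_of_vecMul_eq_self (hW : W ∈ Matrix.rowStochastic ℝ ι) (hc : W.PosConnected)
    (v : ι → ℝ) (hv : Matrix.vecMul v W = v) (h0 : ∀ i, 0 ≤ v i) (i : ι) (hi : 0 < v i) (j : ι) :
    0 < v j := by
  induction hc i j with
  | refl => exact hi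
  | @tail b c _ hbc ih =>
    have := congrFun hv c
    simp only [Matrix.vecMul, dotProduct] at this
    rw [← this]
    exact lt_of_lt_of_le (mul_pos ih hbc) (Finset.single_le_sum
      (f := fun d => v d * W d c)
      (fun d _ => mul_nonneg (h0 d) (Matrix.nonneg_of_mem_rowStochastic hW)) (Finset.mem_univ b))

/-- The entrywise absolute value of a left fixed vector is a left fixed vector: it is subinvariant,
and multiplication by `W` preserves the sum of the entries. -/
theorem abs_vecMul_eq_self (hW : W ∈ Matrix.rowStochastic ℝ ι)
    (v : ι → ℝ) (hv : Matrix.vecMul v W = v) :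
    Matrix.vecMul (fun i => |v i|) W = fun i => |v i| := by
  have hle : ∀ j, |v j| ≤ Matrix.vecMul (fun i => |v i|) W j := by
    intro j
    have := congrFun hv j
    rw [← this]
    simp only [Matrix.vecMul, dotProduct]
    refine (Finset.abs_sum_le_sum_abs _ _).trans (le_of_eq ?_)
    refine Finset.sum_congr rfl fun i _ => ?_
    rw [abs_mul, abs_of_nonneg (Matrix.nonneg_of_mem_rowStochastic hW)]
  have hsum : ∑ j, Matrix.vecMul (fun i => |v i|) W j = ∑ j, |v j| := by
    simp only [Matrix.vecMul, dotProduct]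
    rw [Finset.sum_comm]
    simp only [← Finset.mul_sum, Matrix.sum_row_of_mem_rowStochastic hW, mul_one]
  ext j
  exact ((Finset.sum_eq_sum_iff_of_le (fun j _ => hle j)).1 hsum.symm j (Finset.mem_univ j)).symm

theorem eq_zero_of_vecMul_eq_self (hW : W ∈ Matrix.rowStochastic ℝ ι) (hc : W.PosConnected)
    (v : ι → ℝ) (hv : Matrix.vecMul v W = v) (hs : ∑ i, v i = 0) : v = 0 := by
  have habs := abs_vecMul_eq_self hW v hv
  set u : ι → ℝ := fun i => |v i| + v i with hu
  have hufix : Matrix.vecMul u W = u := by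
    have : u = (fun i => |v i|) + v := rfl
    rw [this, Matrix.add_vecMul, habs, hv]
  have hu0 : ∀ i, 0 ≤ u i := fun i => by simp only [hu]; linarith [neg_abs_le (v i)]
  have hneg : ∀ i, v i ≤ 0 := by
    intro i
    by_contra hi
    push Not at hi
    have hui : 0 < u i := by simp only [hu]; linarith [abs_nonneg (v i)]
    have hall : ∀ j, 0 < v j := by
      intro j
      have := pos_of_vecMul_eq_self hW hc u hufix hu0 i hui j
      simp only [hu] at this
      rcases abs_cases (v j) with ⟨h1, h2⟩ | ⟨h1, h2⟩ <;> linarith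
    have := Finset.sum_pos (fun j _ => hall j) ⟨i, Finset.mem_univ i⟩
    linarith
  ext i
  exact (Finset.sum_eq_zero_iff_of_nonpos (fun j _ => hneg j)).1 hs i (Finset.mem_univ i)

theorem eq_zero_of_vecMul_eq_self_complex (hW : W ∈ Matrix.rowStochastic ℝ ι)
    (hc : W.PosConnected) (v : ι → ℂ) (hv : Matrix.vecMul v (W.map (algebraMap ℝ ℂ)) = v)
    (hs : ∑ i, v i = 0) : v = 0 := by
  have h1 : (fun i => (v i).re) = 0 := by
    refine eq_zero_of_vecMul_eq_self hW hc _ ?_ (by simpa using congrArg Complex.re hs)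
    ext k
    have := congrArg Complex.re (congrFun hv k)
    simpa [Matrix.vecMul, dotProduct] using this
  have h2 : (fun i => (v i).im) = 0 := by
    refine eq_zero_of_vecMul_eq_self hW hc _ ?_ (by simpa using congrArg Complex.im hs)
    ext k
    have := congrArg Complex.im (congrFun hv k)
    simpa [Matrix.vecMul, dotProduct] using this
  ext i
  exact Complex.ext (congrFun h1 i) (congrFun h2 i)

/-- The stationary distribution of an irreducible row-stochastic matrix. -/
theorem exists_stationary [Nonempty ι] (hW : W ∈ Matrix.rowStochastic ℝ ι) (hc : W.PosConnected) :
    ∃ v : ι → ℝ, (∀ i, 0 < v i) ∧ ∑ i, v i = 1 ∧ Matrix.vecMul v W = v := by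
  have hdet : (W - 1).det = 0 := by
    rw [← Matrix.exists_mulVec_eq_zero_iff]
    refine ⟨1, one_ne_zero, ?_⟩
    rw [Matrix.sub_mulVec, Matrix.one_vecMul_of_mem_rowStochastic hW, Matrix.one_mulVec, sub_self]
  obtain ⟨u, hu0, hu⟩ := Matrix.exists_vecMul_eq_zero_iff.2 hdet
  have hu' : Matrix.vecMul u W = u := by
    rw [Matrix.vecMul_sub, Matrix.vecMul_one, sub_eq_zero] at hu
    exact hu
  have habs := abs_vecMul_eq_self hW u hu'
  obtain ⟨i, hi⟩ := Function.ne_iff.1 hu0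
  have hpos := pos_of_vecMul_eq_self hW hc _ habs (fun i => abs_nonneg _) i (abs_pos.2 hi)
  have hS : 0 < ∑ j, |u j| := Finset.sum_pos (fun j _ => hpos j) Finset.univ_nonempty
  refine ⟨(∑ j, |u j|)⁻¹ • fun i => |u i|, fun j => ?_, ?_, ?_⟩
  · simp only [Pi.smul_apply, smul_eq_mul]
    exact mul_pos (inv_pos.2 hS) (hpos j)
  · simp only [Pi.smul_apply, smul_eq_mul, ← Finset.mul_sum]
    exact inv_mul_cancel₀ hS.ne'
  · rw [Matrix.smul_vecMul, habs]

/-! ### Resolvents of stochastic matrices -/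

theorem norm_mulVec_le_of_rowStochastic (hW : W ∈ Matrix.rowStochastic ℝ ι) (x : ι → ℂ) :
    ‖(W.map (algebraMap ℝ ℂ)).mulVec x‖ ≤ ‖x‖ := by
  refine (pi_norm_le_iff_of_nonneg (norm_nonneg x)).2 fun i => ?_
  simp only [Matrix.mulVec, dotProduct, Matrix.map_apply]
  calc _ ≤ ∑ j, W i j * ‖x‖ := by
        refine (norm_sum_le _ _).trans (Finset.sum_le_sum fun j _ => ?_)
        rw [norm_mul]
        simp only [Complex.coe_algebraMap, Complex.norm_real]
        rw [Real.norm_of_nonneg (Matrix.nonneg_of_mem_rowStochastic hW)]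
        exact mul_le_mul_of_nonneg_left (norm_le_pi_norm x j)
          (Matrix.nonneg_of_mem_rowStochastic hW)
    _ = ‖x‖ := by rw [← Finset.sum_mul, Matrix.sum_row_of_mem_rowStochastic hW, one_mul]

theorem sum_norm_vecMul_le_of_rowStochastic (hW : W ∈ Matrix.rowStochastic ℝ ι) (x : ι → ℂ) :
    ∑ j, ‖Matrix.vecMul x (W.map (algebraMap ℝ ℂ)) j‖ ≤ ∑ i, ‖x i‖ := by
  simp only [Matrix.vecMul, dotProduct, Matrix.map_apply]
  calc _ ≤ ∑ j, ∑ i, ‖x i‖ * W i j := by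
        refine Finset.sum_le_sum fun j _ => (norm_sum_le _ _).trans
          (le_of_eq (Finset.sum_congr rfl fun i _ => ?_))
        rw [norm_mul]
        simp only [Complex.coe_algebraMap, Complex.norm_real]
        rw [Real.norm_of_nonneg (Matrix.nonneg_of_mem_rowStochastic hW)]
    _ = ∑ i, ‖x i‖ := by
        rw [Finset.sum_comm]
        simp only [← Finset.mul_sum, Matrix.sum_row_of_mem_rowStochastic hW, mul_one]

/-- A linear functional fixed by `T` sees a polynomial in `T` only through its value at `1`. -/
theorem apply_aeval_of_comp_eq {E : Type*} [AddCommGroup E] [Module ℂ E] (T : Module.End ℂ E)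
    (φ : E →ₗ[ℂ] ℂ) (h : ∀ x, φ (T x) = φ x) (q : Polynomial ℂ) (x : E) :
    φ (Polynomial.aeval T q x) = q.eval 1 * φ x := by
  induction q using Polynomial.induction_on' generalizing x with
  | add p q hp hq => simp [hp, hq, add_mul]
  | monomial k a =>
    rw [Polynomial.aeval_monomial, Module.End.mul_apply, Module.algebraMap_end_apply]
    have : ∀ k : ℕ, φ ((T ^ k) x) = φ x := by
      intro k
      induction k with
      | zero => simp
      | succ k ih => rw [pow_succ', Module.End.mul_apply, h, ih]
    simp [this]

/-- Resolvent bound for an irreducible row-stochastic matrix on the vectors that the stationary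
distribution annihilates, in the sup norm. -/
theorem norm_le_resolvent_of_rowStochastic (hW : W ∈ Matrix.rowStochastic ℝ ι)
    (hc : W.PosConnected) (v : ι → ℝ) (hv : Matrix.vecMul v W = v) (hv1 : ∑ i, v i = 1)
    (s : Multiset ℂ) (hs : (W.map (algebraMap ℝ ℂ)).charpoly =
      (Polynomial.X - Polynomial.C 1) * (s.map fun a => Polynomial.X - Polynomial.C a).prod)
    {δ : ℝ} (hδ : 0 < δ) (hsδ : ∀ a ∈ s, ‖a‖ ≤ 1 - δ) (l : ℂ) (hl : 1 ≤ ‖l‖)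
    (x : ι → ℂ) (hx : ∑ i, (v i : ℂ) * x i = 0) :
    ‖x‖ ≤ (3 ^ s.card - 1) / (‖l‖ - 1 + δ) * ‖l • x - (W.map (algebraMap ℝ ℂ)).mulVec x‖ := by
  set A := W.map (algebraMap ℝ ℂ) with hA
  refine norm_le_resolvent (Matrix.toLin' A) (norm_mulVec_le_of_rowStochastic hW) hδ l hl s hsδ x ?_
  set y := Polynomial.aeval (Matrix.toLin' A)
    (s.map fun a => Polynomial.X - Polynomial.C a).prod x with hy
  have h1 : A.mulVec y = y := by
    have h2 : Polynomial.aeval (Matrix.toLin' A) A.charpoly = 0 := by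
      rw [← Matrix.charpoly_toLin']; exact LinearMap.aeval_self_charpoly _
    have h3 := LinearMap.congr_fun h2 x
    rw [hs, map_mul, Module.End.mul_apply, ← hy] at h3
    simpa [sub_eq_zero] using h3
  let φ : (ι → ℂ) →ₗ[ℂ] ℂ := ∑ i, (v i : ℂ) • LinearMap.proj i
  have hφ : ∀ u, φ u = ∑ i, (v i : ℂ) * u i := fun u => by simp [φ]
  have hφT : ∀ u, φ (Matrix.toLin' A u) = φ u := by
    intro u
    rw [hφ, hφ, Matrix.toLin'_apply]
    simp only [Matrix.mulVec, dotProduct, Finset.mul_sum]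
    rw [Finset.sum_comm]
    refine Finset.sum_congr rfl fun j _ => ?_
    have := congrArg (fun r : ℝ => (r : ℂ)) (congrFun hv j)
    simp only [Matrix.vecMul, dotProduct] at this
    rw [← this]
    push_cast
    rw [Finset.sum_mul]
    refine Finset.sum_congr rfl fun i _ => ?_
    simp [hA, mul_assoc]
  have h4 : φ y = 0 := by
    rw [hy, apply_aeval_of_comp_eq _ φ hφT, hφ, hx, mul_zero]
  have h5 := eq_of_mulVec_eq_self_complex hW hc y h1
  ext i
  have h6 : φ y = y i := by
    rw [hφ]
    calc ∑ j, (v j : ℂ) * y j = ∑ j, (v j : ℂ) * y i :=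
          Finset.sum_congr rfl fun j _ => by rw [h5 j i]
      _ = y i := by rw [← Finset.sum_mul, ← Complex.ofReal_sum, hv1]; simp
  rw [← h6, h4]; rfl

/-- Resolvent bound for the transpose of an irreducible row-stochastic matrix on the vectors with
sum zero, in the `ℓ¹` norm. -/
theorem sum_norm_le_resolvent_of_rowStochastic (hW : W ∈ Matrix.rowStochastic ℝ ι)
    (hc : W.PosConnected)
    (s : Multiset ℂ) (hs : (W.map (algebraMap ℝ ℂ)).charpoly =
      (Polynomial.X - Polynomial.C 1) * (s.map fun a => Polynomial.X - Polynomial.C a).prod)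
    {δ : ℝ} (hδ : 0 < δ) (hsδ : ∀ a ∈ s, ‖a‖ ≤ 1 - δ) (l : ℂ) (hl : 1 ≤ ‖l‖)
    (x : ι → ℂ) (hx : ∑ i, x i = 0) :
    ∑ i, ‖x i‖ ≤ (3 ^ s.card - 1) / (‖l‖ - 1 + δ) *
      ∑ i, ‖l * x i - Matrix.vecMul x (W.map (algebraMap ℝ ℂ)) i‖ := by
  set A := W.map (algebraMap ℝ ℂ) with hA
  let e := (WithLp.linearEquiv 1 ℂ (ι → ℂ))
  let T : Module.End ℂ (PiLp 1 fun _ : ι => ℂ) := e.symm.conj (Matrix.toLin' A.transpose)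
  have hTapp : ∀ u i, T u i = Matrix.vecMul (WithLp.ofLp u) A i := by
    intro u i
    simp [T, e, LinearEquiv.conj_apply, Matrix.mulVec_transpose]
  have hnorm : ∀ u : PiLp 1 fun _ : ι => ℂ, ‖u‖ = ∑ i, ‖u i‖ := by
    intro u
    rw [PiLp.norm_eq_of_nat 1 (by simp)]
    simp
  have hT : ∀ u, ‖T u‖ ≤ ‖u‖ := by
    intro u
    rw [hnorm, hnorm]
    simp only [hTapp]
    exact sum_norm_vecMul_le_of_rowStochastic hW _
  have main := norm_le_resolvent T hT hδ l hl s hsδ (WithLp.toLp 1 x) ?_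
  · rw [hnorm, hnorm] at main
    simpa [hTapp] using main
  · set y := Polynomial.aeval T
      (s.map fun a => Polynomial.X - Polynomial.C a).prod (WithLp.toLp 1 x) with hy
    have h1 : T y = y := by
      have h2 : Polynomial.aeval T A.charpoly = 0 := by
        rw [← Matrix.charpoly_transpose, ← Matrix.charpoly_toLin', ← LinearEquiv.charpoly_conj e.symm]
        exact LinearMap.aeval_self_charpoly _
      have h3 := LinearMap.congr_fun h2 (WithLp.toLp 1 x)
      rw [hs, map_mul, Module.End.mul_apply, ← hy] at h3
      simpa [sub_eq_zero] using h3
    let φ : (PiLp 1 fun _ : ι => ℂ) →ₗ[ℂ] ℂ := (∑ i, LinearMap.proj i) ∘ₗ e.toLinearMap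
    have hφ : ∀ u, φ u = ∑ i, u i := fun u => by simp [φ, e]
    have hφT : ∀ u, φ (T u) = φ u := by
      intro u
      rw [hφ, hφ]
      simp only [hTapp, Matrix.vecMul, dotProduct]
      rw [Finset.sum_comm]
      simp only [← Finset.mul_sum]
      refine Finset.sum_congr rfl fun i _ => ?_
      have : ∑ j, A i j = 1 := by
        have := congrArg (fun r : ℝ => (r : ℂ)) (Matrix.sum_row_of_mem_rowStochastic hW i)
        simpa [hA] using this
      rw [this, mul_one]
    have h4 : φ y = 0 := by
      rw [hy, apply_aeval_of_comp_eq _ φ hφT, hφ]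
      simp [hx]
    have h5 : WithLp.ofLp y = 0 := by
      refine eq_zero_of_vecMul_eq_self_complex hW hc _ ?_ (by rw [← hφ, h4])
      ext i
      rw [← hTapp, h1]
    ext i
    exact congrFun h5 i

end Stochastic

/-! ### The third largest eigenvalue modulus -/

section Eigenvalues

variable {ι : Type*} [Fintype ι] [DecidableEq ι] {W : Matrix ι ι ℝ}

theorem norm_le_one_of_mem_roots_charpoly (hW : W ∈ Matrix.rowStochastic ℝ ι) (a : ℂ)
    (ha : a ∈ (W.map (algebraMap ℝ ℂ)).charpoly.roots) : ‖a‖ ≤ 1 := by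
  have h1 : (W.map (algebraMap ℝ ℂ)).charpoly.IsRoot a := Polynomial.isRoot_of_mem_roots ha
  rw [← Matrix.charpoly_toLin', ← Module.End.hasEigenvalue_iff_isRoot_charpoly] at h1
  obtain ⟨v, hv⟩ := h1.exists_hasEigenvector
  have h2 := norm_mulVec_le_of_rowStochastic hW v
  have h3 : (W.map (algebraMap ℝ ℂ)).mulVec v = a • v := hv.apply_eq_smul
  rw [h3, norm_smul] at h2
  have h4 : 0 < ‖v‖ := norm_pos_iff.2 hv.2
  exact le_of_mul_le_mul_right (by simpa using h2) h4

/-- The characteristic polynomial of a stochastic matrix, with the factor of the eigenvalue `1` split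
off. -/
theorem exists_charpoly_eq_of_rowStochastic [Nonempty ι] (hW : W ∈ Matrix.rowStochastic ℝ ι) :
    ∃ s : Multiset ℂ, (W.map (algebraMap ℝ ℂ)).charpoly.roots = 1 ::ₘ s ∧
      s.card + 1 = Fintype.card ι ∧ (W.map (algebraMap ℝ ℂ)).charpoly =
      (Polynomial.X - Polynomial.C 1) * (s.map fun a => Polynomial.X - Polynomial.C a).prod := by
  set A := W.map (algebraMap ℝ ℂ) with hA
  have hsplit := IsAlgClosed.splits A.charpoly
  have hprod := hsplit.eq_prod_roots_of_monic A.charpoly_monic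
  have hcard : A.charpoly.roots.card = Fintype.card ι := by
    rw [← hsplit.natDegree_eq_card_roots, Matrix.charpoly_natDegree_eq_dim]
  have h1 : (1 : ℂ) ∈ A.charpoly.roots := by
    rw [Polynomial.mem_roots A.charpoly_monic.ne_zero, ← Matrix.charpoly_toLin',
      ← Module.End.hasEigenvalue_iff_isRoot_charpoly]
    refine Module.End.hasEigenvalue_of_hasEigenvector (x := 1) ⟨?_, one_ne_zero⟩
    rw [Module.End.mem_eigenspace_iff, one_smul, Matrix.toLin'_apply]
    ext i
    have := congrArg (fun r : ℝ => (r : ℂ)) (Matrix.sum_row_of_mem_rowStochastic hW i)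
    simpa [hA, Matrix.mulVec, dotProduct] using this
  obtain ⟨s, hs⟩ := Multiset.exists_cons_of_mem h1
  refine ⟨s, hs, by rw [← hcard, hs, Multiset.card_cons], ?_⟩
  conv_lhs => rw [hprod, hs]
  rw [Multiset.map_cons, Multiset.prod_cons]

end Eigenvalues

/-- In a decreasingly sorted list of numbers at most `1` that starts with two ones, every further
entry is bounded by the one at position `2`. -/
theorem le_getD_two_sort (u : Multiset ℝ) (hu : ∀ b ∈ u, b ≤ 1) :
    (∀ b ∈ u, b ≤ ((1 ::ₘ 1 ::ₘ u).sort (fun a b => b ≤ a)).getD 2 0) ∧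
      ((1 ::ₘ 1 ::ₘ u).sort (fun a b => b ≤ a)).getD 2 0 ≤ 1 := by
  rw [Multiset.sort_cons 1 (1 ::ₘ u) (r := fun a b : ℝ => b ≤ a) (by simpa using hu),
    Multiset.sort_cons 1 u (r := fun a b : ℝ => b ≤ a) (by simpa using hu)]
  have hmem : ∀ b, b ∈ u.sort (fun a b => b ≤ a) ↔ b ∈ u := fun b => Multiset.mem_sort _
  have hsorted : (u.sort (fun a b => b ≤ a)).Pairwise (fun a b => b ≤ a) :=
    Multiset.pairwise_sort _ _
  cases hL : u.sort (fun a b => b ≤ a) with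
  | nil =>
    rw [hL] at hmem
    refine ⟨fun b hb => absurd ((hmem b).2 hb) (by simp), by simp⟩
  | cons c L =>
    rw [hL] at hmem hsorted
    refine ⟨fun b hb => ?_, ?_⟩
    · have : b ≤ c := by
        rcases List.mem_cons.1 ((hmem b).2 hb) with h | h
        · exact h.le
        · exact (List.pairwise_cons.1 hsorted).1 b h
      simpa using this
    · simpa using hu c ((hmem c).1 (by simp))

theorem charpoly_surplusMatrix_zero {n : ℕ} (Wr Wc : Matrix (Fin n) (Fin n) ℝ) :
    ((surplusMatrix Wr Wc 0).map (algebraMap ℝ ℂ)).charpoly =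
      (Wr.map (algebraMap ℝ ℂ)).charpoly * (Wc.transpose.map (algebraMap ℝ ℂ)).charpoly := by
  rw [Matrix.charpoly_map, Matrix.charpoly_map, Matrix.charpoly_map, ← Polynomial.map_mul,
    Matrix.charpoly_transpose, surplusMatrix, zero_smul, sub_zero,
    Matrix.charpoly_fromBlocks_zero₁₂]

/-- All eigenvalues of the two weight matrices, except one eigenvalue `1` of each, are bounded by
the third modulus. -/
theorem norm_le_thirdModulus {n : ℕ} (Wr Wc : Matrix (Fin n) (Fin n) ℝ)
    (hWr : Wr ∈ Matrix.rowStochastic ℝ (Fin n))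
    (hWc : Wc.transpose ∈ Matrix.rowStochastic ℝ (Fin n)) (s t : Multiset ℂ)
    (hs : (Wr.map (algebraMap ℝ ℂ)).charpoly.roots = 1 ::ₘ s)
    (ht : (Wc.transpose.map (algebraMap ℝ ℂ)).charpoly.roots = 1 ::ₘ t) :
    (∀ a ∈ s, ‖a‖ ≤ thirdModulus Wr Wc) ∧ (∀ a ∈ t, ‖a‖ ≤ thirdModulus Wr Wc) ∧
      thirdModulus Wr Wc ≤ 1 := by
  have hroots : ((surplusMatrix Wr Wc 0).map (algebraMap ℝ ℂ)).charpoly.roots.map (fun z => ‖z‖) =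
      1 ::ₘ 1 ::ₘ ((s + t).map fun z => ‖z‖) := by
    rw [charpoly_surplusMatrix_zero, Polynomial.roots_mul
      (mul_ne_zero (Matrix.charpoly_monic _).ne_zero (Matrix.charpoly_monic _).ne_zero), hs, ht]
    simp
  have hle : ∀ b ∈ (s + t).map (fun z : ℂ => ‖z‖), b ≤ 1 := by
    intro b hb
    obtain ⟨a, ha, rfl⟩ := Multiset.mem_map.1 hb
    rcases Multiset.mem_add.1 ha with h | h
    · exact norm_le_one_of_mem_roots_charpoly hWr a (by rw [hs]; exact Multiset.mem_cons_of_mem h)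
    · exact norm_le_one_of_mem_roots_charpoly hWc a (by rw [ht]; exact Multiset.mem_cons_of_mem h)
  obtain ⟨h1, h2⟩ := le_getD_two_sort _ hle
  rw [← hroots] at h1 h2
  refine ⟨fun a ha => h1 _ (Multiset.mem_map.2 ⟨a, by simp [ha], rfl⟩),
    fun a ha => h1 _ (Multiset.mem_map.2 ⟨a, by simp [ha], rfl⟩), h2⟩

/-! ### Eigenvalues of the surplus-based weight matrix -/

/-- What the upper limit on `ε` gives for the resolvent constant `R = (3 ^ (n - 1) - 1) / M`, where
`M = ‖l‖ - 1 + δ` and `x` stands for `‖l - 1‖`. -/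
theorem resolvent_constant_bounds {n : ℕ} (hn : 1 ≤ n) {δ ε M x : ℝ} (hδ0 : 0 < δ) (hδ1 : δ ≤ 1)
    (hε0 : 0 < ε) (hε : ε ≤ 1 / (20 + 8 * (n : ℝ)) ^ n * δ ^ n) (hM : δ ≤ M)
    (hxM : x ≤ M + 2) :
    2 * n * ((3 ^ (n - 1) - 1) / M) * ε ≤ 1 / 48 ∧
      4 * n * ((3 ^ (n - 1) - 1) / M) ^ 2 * ε * x ≤ 3 / 8 ∧ ε * n ≤ 1 := by
  have hM0 : 0 < M := lt_of_lt_of_le hδ0 hM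
  obtain rfl | hn2 := hn.eq_or_lt
  · norm_num at hε ⊢
    linarith
  obtain ⟨k, rfl⟩ : ∃ k, n = k + 2 := ⟨n - 2, by omega⟩
  have hk : k + 2 - 1 = k + 1 := rfl
  rw [hk]
  set N : ℝ := ((k + 2 : ℕ) : ℝ) with hN
  have hN2 : 2 ≤ N := by rw [hN]; push_cast; linarith [(Nat.cast_nonneg k : (0 : ℝ) ≤ k)]
  set q : ℝ := 3 ^ (k + 1) with hq
  have hq3 : 3 ≤ q := by
    rw [hq, pow_succ]
    have : (1 : ℝ) ≤ 3 ^ k := one_le_pow₀ (by norm_num)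
    linarith
  have hpow : 32 * N * q ^ 2 ≤ (20 + 8 * N) ^ (k + 2) := by
    have h1 : (36 : ℝ) ^ (k + 1) ≤ (20 + 8 * N) ^ (k + 1) :=
      pow_le_pow_left₀ (by norm_num) (by linarith) _
    have h2 : 4 * q ^ 2 ≤ (36 : ℝ) ^ (k + 1) := by
      have h3 : (36 : ℝ) ^ (k + 1) = 4 ^ (k + 1) * q ^ 2 := by
        rw [hq, ← pow_mul, mul_comm (k + 1) 2, pow_mul, ← mul_pow]; norm_num
      rw [h3]
      have : (1 : ℝ) ≤ 4 ^ k := one_le_pow₀ (by norm_num)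
      have : (4 : ℝ) ≤ 4 ^ (k + 1) := by rw [pow_succ]; linarith
      exact mul_le_mul_of_nonneg_right this (sq_nonneg _)
    have h3 : 4 * q ^ 2 ≤ (20 + 8 * N) ^ (k + 1) := h2.trans h1
    rw [pow_succ (20 + 8 * N) (k + 1)]
    calc 32 * N * q ^ 2 = 4 * q ^ 2 * (8 * N) := by ring
      _ ≤ _ := mul_le_mul h3 (by linarith) (by positivity) (by positivity)
  have hδn : δ ^ (k + 2) ≤ δ ^ 2 := pow_le_pow_of_le_one hδ0.le hδ1 (by omega)
  have hεn : ε * (32 * N * q ^ 2) ≤ δ ^ 2 := by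
    have hpos : 0 < (20 + 8 * N) ^ (k + 2) := by positivity
    have : ε * (20 + 8 * N) ^ (k + 2) ≤ δ ^ (k + 2) := by
      rw [one_div, inv_mul_eq_div, le_div_iff₀ hpos] at hε
      exact hε
    calc _ ≤ ε * (20 + 8 * N) ^ (k + 2) := mul_le_mul_of_nonneg_left hpow hε0.le
      _ ≤ _ := this.trans hδn
  have hNε : N * ε * q ^ 2 ≤ δ ^ 2 / 32 := by linarith
  have hR0 : 0 ≤ (q - 1) / M := div_nonneg (by linarith) hM0.le
  have hR : (q - 1) / M ≤ q / M := by gcongr; linarith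
  have hNε0 : 0 ≤ N * ε := by positivity
  have hδM : δ ^ 2 ≤ M := by nlinarith
  have hδM2 : δ ^ 2 ≤ M ^ 2 := by nlinarith
  refine ⟨?_, ?_, ?_⟩
  · calc 2 * N * ((q - 1) / M) * ε = 2 * (N * ε) * ((q - 1) / M) := by ring
      _ ≤ 2 * (N * ε) * (q / M) := by gcongr
      _ = 2 * (N * ε * q ^ 2) / (q * M) := by field_simp
      _ ≤ 1 / 48 := by
        rw [div_le_div_iff₀ (by positivity) (by norm_num)]
        nlinarith
  · rcases le_or_gt x 0 with hx | hx
    · have : 4 * N * ((q - 1) / M) ^ 2 * ε * x ≤ 0 :=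
        mul_nonpos_of_nonneg_of_nonpos (by positivity) hx
      linarith
    · calc 4 * N * ((q - 1) / M) ^ 2 * ε * x = 4 * (N * ε) * x * ((q - 1) / M) ^ 2 := by ring
        _ ≤ 4 * (N * ε) * x * (q / M) ^ 2 := by gcongr
        _ = 4 * (N * ε * q ^ 2) * x / M ^ 2 := by field_simp
        _ ≤ 3 / 8 := by
          rw [div_le_div_iff₀ (by positivity) (by norm_num)]
          have h1 : N * ε * q ^ 2 * x ≤ δ ^ 2 / 32 * (M + 2) := by gcongr
          have h2 : δ ^ 2 * M ≤ M ^ 2 := by nlinarith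
          nlinarith
  · nlinarith [mul_nonneg hε0.le (by linarith : 0 ≤ N)]

/-- The scalar core of the eigenvalue estimate: the shift `z` of an eigenvalue `1 + z` is close,
relative to its size, to the first-order term `-t`, hence `1 + z` lies inside the unit disc. -/
theorem norm_one_add_lt_one_of_perturbation {N p ε R A V U B : ℝ} {z a : ℂ} (hN : 1 ≤ N)
    (hp0 : 0 < p) (hp1 : p ≤ 1) (hε0 : 0 < ε) (hR : 0 ≤ R) (hA : A = ‖a‖) (hA0 : 0 < A)
    (hV : 0 ≤ V)
    (h1 : U ≤ R * (ε * ‖z‖ * (2 * (A + V)))) (h2 : V ≤ R * (2 * N * (U + ε * B)))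
    (h3 : B ≤ p * A + V)
    (h4 : ‖z * a + (ε * N * p : ℝ) * a‖ ≤ N * U + ε * N * V)
    (hc1 : 2 * N * R * ε ≤ 1 / 48) (hc2 : 4 * N * R ^ 2 * ε * ‖z‖ ≤ 3 / 8) (hc3 : ε * N ≤ 1) :
    ‖1 + z‖ < 1 := by
  set x := ‖z‖ with hx
  have hx0 : 0 ≤ x := norm_nonneg z
  set k1 := 2 * N * R * ε with hk1
  set k2 := 4 * N * R ^ 2 * ε * x with hk2
  have hk10 : 0 ≤ k1 := by positivity
  have hk20 : 0 ≤ k2 := by positivity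
  have hV1 : V ≤ k2 * (A + V) + k1 * (p * A + V) := by
    calc V ≤ R * (2 * N * (U + ε * B)) := h2
      _ ≤ R * (2 * N * (R * (ε * x * (2 * (A + V))) + ε * (p * A + V))) := by gcongr
      _ = _ := by rw [hk1, hk2]; ring
  have hV2 : V ≤ 2 * A * (k1 * p + k2) := by nlinarith
  have hk1p : k1 * p ≤ 1 / 48 := (mul_le_of_le_one_right hk10 hp1).trans hc1
  have hV3 : V ≤ A := by nlinarith
  have hNU : N * U ≤ 2 * k1 * x * A := by
    calc N * U ≤ N * (R * (ε * x * (2 * (A + A)))) := by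
          refine mul_le_mul_of_nonneg_left (h1.trans ?_) (by linarith)
          gcongr
      _ = _ := by rw [hk1]; ring
  set t := ε * N * p with ht
  have ht0 : 0 < t := by positivity
  have ht1 : t ≤ 1 := by nlinarith
  have hεV : ε * N * V ≤ 2 * A * (k1 * t + k1 ^ 2 * x) := by
    calc ε * N * V ≤ ε * N * (2 * A * (k1 * p + k2)) := by gcongr
      _ = _ := by rw [hk2, hk1, ht]; ring
  have hzt : ‖z + (t : ℂ)‖ * A ≤ (x / 20 + t / 20) * A := by
    have e : z * a + (t : ℂ) * a = (z + t) * a := by ring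
    rw [e, norm_mul, ← hA] at h4
    refine h4.trans ?_
    have hkk : k1 ^ 2 ≤ k1 / 48 := by nlinarith
    have e1 : 2 * k1 * x * A ≤ 2 / 48 * x * A := by
      have : k1 * (x * A) ≤ 1 / 48 * (x * A) := by gcongr
      linarith
    have e2 : k1 * t ≤ t / 48 := by nlinarith
    have e3 : k1 ^ 2 * x ≤ x / 2304 := by nlinarith
    nlinarith
  have hzt' : ‖z + (t : ℂ)‖ ≤ x / 20 + t / 20 := le_of_mul_le_mul_right hzt hA0
  have hxle : x ≤ t + ‖z + (t : ℂ)‖ := by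
    have : z = (z + t) - t := by ring
    calc x = ‖(z + t) - t‖ := by rw [hx, ← this]
      _ ≤ ‖z + (t : ℂ)‖ + ‖(t : ℂ)‖ := norm_sub_le _ _
      _ = _ := by rw [Complex.norm_real, Real.norm_of_nonneg ht0.le]; ring
  have : (1 : ℂ) + z = ((1 - t : ℝ) : ℂ) + (z + t) := by push_cast; ring
  calc ‖1 + z‖ ≤ ‖((1 - t : ℝ) : ℂ)‖ + ‖z + (t : ℂ)‖ := by rw [this]; exact norm_add_le _ _
    _ = 1 - t + ‖z + (t : ℂ)‖ := by
      rw [Complex.norm_real, Real.norm_of_nonneg (by linarith)]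
    _ < 1 := by linarith

theorem norm_sum_mul_le_of_sum_eq_one {ι : Type*} [Fintype ι] (π : ι → ℝ) (h0 : ∀ i, 0 ≤ π i)
    (h1 : ∑ i, π i = 1) (v : ι → ℂ) : ‖∑ i, (π i : ℂ) * v i‖ ≤ ‖v‖ := by
  calc _ ≤ ∑ i, π i * ‖v‖ := by
        refine (norm_sum_le _ _).trans (Finset.sum_le_sum fun i _ => ?_)
        rw [norm_mul, Complex.norm_real, Real.norm_of_nonneg (h0 i)]
        exact mul_le_mul_of_nonneg_left (norm_le_pi_norm v i) (h0 i)
    _ = _ := by rw [← Finset.sum_mul, h1, one_mul]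

/-- For `0 < ε ≤ epsBar Wr Wc` the surplus-based weight matrix has no eigenvalue other than `1`
outside the open unit disc.

Write `l = 1 + z` for the eigenvalue, `w = (l - Wc) v`, and let `π`, `ρ` be the stationary vectors of
`Wr` and `Wc`. Then `(l - Wr) w = -ε z v`. The component of `v` with sum zero and the component of
`w` annihilated by `π` are controlled by the resolvent bounds, and the remaining scalar equation says
that `z` is `-ε n ⟨π, ρ⟩` up to a small relative error. -/
theorem surplusMatrix_eigenvector_eq_zero {n : ℕ} (hn : 1 ≤ n) (Wr Wc : Matrix (Fin n) (Fin n) ℝ)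
    (hWr : Wr ∈ Matrix.rowStochastic ℝ (Fin n)) (hcr : Wr.PosConnected)
    (hWc : Wc.transpose ∈ Matrix.rowStochastic ℝ (Fin n)) (hcc : Wc.transpose.PosConnected)
    (ε : ℝ) (hε0 : 0 < ε) (hε : ε ≤ epsBar Wr Wc) (l : ℂ) (hl : 1 ≤ ‖l‖) (hl1 : l ≠ 1)
    (u v : Fin n → ℂ)
    (hu : (Wr.map (algebraMap ℝ ℂ)).mulVec u + (ε : ℂ) • v = l • u)
    (hv : u - (Wr.map (algebraMap ℝ ℂ)).mulVec u + (Wc.map (algebraMap ℝ ℂ)).mulVec v -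
      (ε : ℂ) • v = l • v) : u = 0 ∧ v = 0 := by
  have : Nonempty (Fin n) := ⟨⟨0, hn⟩⟩
  obtain ⟨s, hs, hscard, hsp⟩ := exists_charpoly_eq_of_rowStochastic hWr
  obtain ⟨t, ht, htcard, htp⟩ := exists_charpoly_eq_of_rowStochastic hWc
  obtain ⟨hsm, htm, hle1⟩ := norm_le_thirdModulus Wr Wc hWr hWc s t hs ht
  rw [Fintype.card_fin] at hscard htcard
  set δ := 1 - thirdModulus Wr Wc with hδ
  have hδ0 : 0 < δ := by
    have h0 : 0 ≤ δ := by linarith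
    rcases h0.eq_or_lt with h | h
    · rw [epsBar, ← hδ, ← h, zero_pow (by omega), mul_zero] at hε
      linarith
    · exact h
  have hδ1 : δ ≤ 1 := by
    have : 0 ≤ thirdModulus Wr Wc := by
      rw [thirdModulus, List.getD_eq_getElem?_getD]
      cases h : (eigenvalueModuli (surplusMatrix Wr Wc 0))[2]? with
      | none => simp
      | some r =>
        have hr := List.mem_of_getElem? h
        rw [eigenvalueModuli, Multiset.mem_sort, Multiset.mem_map] at hr
        obtain ⟨a, -, rfl⟩ := hr
        simp
    linarith
  have hsδ : ∀ a ∈ s, ‖a‖ ≤ 1 - δ := fun a ha => by linarith [hsm a ha]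
  have htδ : ∀ a ∈ t, ‖a‖ ≤ 1 - δ := fun a ha => by linarith [htm a ha]
  obtain ⟨π, hπ0, hπ1, hπ⟩ := exists_stationary hWr hcr
  obtain ⟨ρ, hρ0, hρ1, hρ⟩ : ∃ ρ : Fin n → ℝ, (∀ i, 0 ≤ ρ i) ∧ ∑ i, ρ i = 1 ∧ Wc.mulVec ρ = ρ := by
    obtain ⟨ρ, h1, h2, h3⟩ := exists_stationary hWc hcc
    exact ⟨ρ, fun i => (h1 i).le, h2, by rwa [Matrix.vecMul_transpose] at h3⟩
  set Ar := Wr.map (algebraMap ℝ ℂ) with hAr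
  set Ac := Wc.map (algebraMap ℝ ℂ) with hAc
  set z := l - 1 with hz
  have hz0 : z ≠ 0 := sub_ne_zero.2 hl1
  set w : Fin n → ℂ := l • v - Ac.mulVec v with hw
  have hwu : w = -(z • u) := by
    have e : l • v = u - Ar.mulVec u + Ac.mulVec v - (ε : ℂ) • v := hv.symm
    have e2 : Ar.mulVec u = l • u - (ε : ℂ) • v := eq_sub_of_add_eq hu
    rw [hw, e, e2, hz]; module
  have hw2 : l • w - Ar.mulVec w = -((ε * z : ℂ) • v) := by
    have e2 : Ar.mulVec u = l • u - (ε : ℂ) • v := eq_sub_of_add_eq hu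
    rw [hwu, Matrix.mulVec_neg, Matrix.mulVec_smul, e2]; module
  -- the functional of `π` and the sum are fixed by the two weight matrices
  have hπA : ∀ y : Fin n → ℂ, ∑ i, (π i : ℂ) * Ar.mulVec y i = ∑ i, (π i : ℂ) * y i := by
    intro y
    simp only [Matrix.mulVec, dotProduct, Finset.mul_sum]
    rw [Finset.sum_comm]
    refine Finset.sum_congr rfl fun j _ => ?_
    have := congrArg (fun r : ℝ => (r : ℂ)) (congrFun hπ j)
    simp only [Matrix.vecMul, dotProduct] at this
    rw [← this]
    push_cast
    rw [Finset.sum_mul]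
    refine Finset.sum_congr rfl fun i _ => ?_
    simp [hAr, mul_assoc]
  have h1A : ∀ y : Fin n → ℂ, ∑ i, Ac.mulVec y i = ∑ i, y i := by
    intro y
    simp only [Matrix.mulVec, dotProduct]
    rw [Finset.sum_comm]
    refine Finset.sum_congr rfl fun j _ => ?_
    rw [← Finset.sum_mul]
    have := congrArg (fun r : ℝ => (r : ℂ)) (Matrix.sum_row_of_mem_rowStochastic hWc j)
    simp only [Matrix.transpose_apply] at this
    push_cast at this
    simp only [hAc, Matrix.map_apply, Complex.coe_algebraMap]
    rw [this, one_mul]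
  have hπ1' : ∑ i, (π i : ℂ) = 1 := by rw [← Complex.ofReal_sum, hπ1, Complex.ofReal_one]
  have hρ1' : ∑ i, (ρ i : ℂ) = 1 := by rw [← Complex.ofReal_sum, hρ1, Complex.ofReal_one]
  set β : ℂ := ∑ i, (π i : ℂ) * v i with hβ
  set a : ℂ := ∑ i, v i with ha
  set b : ℂ := ∑ i, (π i : ℂ) * w i with hb
  have hbβ : b = -(ε * β) := by
    have e := congrArg (fun y : Fin n → ℂ => ∑ i, (π i : ℂ) * y i) hw2
    simp only [Pi.sub_apply, Pi.smul_apply, Pi.neg_apply, smul_eq_mul, mul_sub,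
      Finset.sum_sub_distrib, hπA] at e
    have e1 : ∑ i, (π i : ℂ) * (l * w i) = l * b := by
      rw [hb, Finset.mul_sum]; exact Finset.sum_congr rfl fun i _ => by ring
    have e2 : ∑ i, (π i : ℂ) * -(ε * z * v i) = -(ε * z * β) := by
      rw [hβ, Finset.mul_sum, ← Finset.sum_neg_distrib]
      exact Finset.sum_congr rfl fun i _ => by ring
    rw [e1, e2, ← hb] at e
    have e3 : z * b = z * (-(ε * β)) := by rw [hz] at *; linear_combination e
    exact mul_left_cancel₀ hz0 e3
  have hwsum : ∑ i, w i = z * a := by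
    rw [hw]
    simp only [Pi.sub_apply, Pi.smul_apply, smul_eq_mul, Finset.sum_sub_distrib, h1A,
      ← Finset.mul_sum]
    rw [← ha, hz]; ring
  -- the two components
  set w' : Fin n → ℂ := fun i => w i - b with hw'
  set v' : Fin n → ℂ := fun i => v i - a * ρ i with hv'
  have hw'0 : ∑ i, (π i : ℂ) * w' i = 0 := by
    simp only [hw', mul_sub, Finset.sum_sub_distrib, ← Finset.sum_mul]
    rw [hπ1', ← hb]; ring
  have hv'0 : ∑ i, v' i = 0 := by
    simp only [hv', Finset.sum_sub_distrib, ← Finset.mul_sum]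
    rw [hρ1', ← ha]; ring
  have hw'eq : ∀ i, l * w' i - Ar.mulVec w' i = -(ε * z) * (v i - β) := by
    intro i
    have e := congrFun hw2 i
    simp only [Pi.sub_apply, Pi.smul_apply, Pi.neg_apply, smul_eq_mul] at e
    have e1 : Ar.mulVec w' i = Ar.mulVec w i - b := by
      have : w' = w - b • (fun _ => 1) := by ext j; simp [hw']
      rw [this, Matrix.mulVec_sub, Matrix.mulVec_smul]
      have e2 := congrArg (fun r : ℝ => (r : ℂ)) (Matrix.sum_row_of_mem_rowStochastic hWr i)
      push_cast at e2
      simp [Matrix.mulVec, dotProduct, hAr, e2]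
    rw [e1]
    simp only [hw']
    rw [hbβ] at *
    rw [hz] at *
    linear_combination e
  have hv'eq : ∀ i, l * v' i - Ac.mulVec v' i = w i - (∑ j, w j) * ρ i := by
    intro i
    have e1 : Ac.mulVec v' i = Ac.mulVec v i - a * ρ i := by
      have : v' = v - a • (fun j => (ρ j : ℂ)) := by ext j; simp [hv']
      rw [this, Matrix.mulVec_sub, Matrix.mulVec_smul]
      have e2 := congrArg (fun r : ℝ => (r : ℂ)) (congrFun hρ i)
      simp only [Matrix.mulVec, dotProduct] at e2
      push_cast at e2
      simp [Matrix.mulVec, dotProduct, hAc, e2]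
    rw [e1, hwsum]
    simp only [hv', hw, Pi.sub_apply, Pi.smul_apply, smul_eq_mul, hz]
    ring
  set M := ‖l‖ - 1 + δ with hM
  set R : ℝ := (3 ^ (n - 1) - 1) / M with hR
  have hMδ : δ ≤ M := by linarith
  have hR0 : 0 ≤ R := by
    refine div_nonneg ?_ (by linarith)
    have : (1 : ℝ) ≤ 3 ^ (n - 1) := one_le_pow₀ (by norm_num)
    linarith
  have hscard' : s.card = n - 1 := by omega
  have htcard' : t.card = n - 1 := by omega
  have hres1 := norm_le_resolvent_of_rowStochastic hWr hcr π hπ hπ1 s hsp hδ0 hsδ l hl w' hw'0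
  have hres2 := sum_norm_le_resolvent_of_rowStochastic hWc hcc t htp hδ0 htδ l hl v' hv'0
  rw [hscard'] at hres1
  rw [htcard'] at hres2
  have hct : Wc.transpose.map (algebraMap ℝ ℂ) = Ac.transpose := by
    rw [hAc, Matrix.transpose_map]
  simp only [hct, Matrix.vecMul_transpose, hv'eq] at hres2
  -- norms
  set V := ∑ i, ‖v' i‖ with hV
  have hV0 : 0 ≤ V := Finset.sum_nonneg fun i _ => norm_nonneg _
  have hvnorm : ‖v‖ ≤ ‖a‖ + V := by
    refine (pi_norm_le_iff_of_nonneg (by positivity)).2 fun i => ?_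
    have e : v i = a * ρ i + v' i := by simp [hv']
    rw [e]
    refine (norm_add_le _ _).trans (add_le_add ?_ ?_)
    · rw [norm_mul, Complex.norm_real, Real.norm_of_nonneg (hρ0 i)]
      have : ρ i ≤ 1 := by
        rw [← hρ1]; exact Finset.single_le_sum (fun j _ => hρ0 j) (Finset.mem_univ i)
      exact mul_le_of_le_one_right (norm_nonneg _) this
    · exact Finset.single_le_sum (f := fun j => ‖v' j‖) (fun j _ => norm_nonneg _)
        (Finset.mem_univ i)
  have hβv : ‖β‖ ≤ ‖v‖ := norm_sum_mul_le_of_sum_eq_one π (fun i => (hπ0 i).le) hπ1 v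
  have h1 : ‖w'‖ ≤ R * (ε * ‖z‖ * (2 * (‖a‖ + V))) := by
    refine hres1.trans (mul_le_mul_of_nonneg_left ?_ hR0)
    refine (pi_norm_le_iff_of_nonneg (by positivity)).2 fun i => ?_
    have e := hw'eq i
    simp only [Pi.sub_apply, Pi.smul_apply, smul_eq_mul]
    rw [e, norm_mul, norm_neg, norm_mul, Complex.norm_real, Real.norm_of_nonneg hε0.le]
    refine mul_le_mul_of_nonneg_left ?_ (by positivity)
    have := norm_le_pi_norm v i
    calc ‖v i - β‖ ≤ ‖v i‖ + ‖β‖ := norm_sub_le _ _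
      _ ≤ _ := by linarith
  have h2 : V ≤ R * (2 * n * (‖w'‖ + ε * ‖β‖)) := by
    refine hres2.trans (mul_le_mul_of_nonneg_left ?_ hR0)
    have hwi : ∀ i, ‖w i‖ ≤ ‖w'‖ + ε * ‖β‖ := by
      intro i
      have e : w i = w' i + b := by simp [hw']
      have e2 : ‖b‖ = ε * ‖β‖ := by
        rw [hbβ, norm_neg, norm_mul, Complex.norm_real, Real.norm_of_nonneg hε0.le]
      rw [e, ← e2]
      exact (norm_add_le _ _).trans (add_le_add_left (norm_le_pi_norm w' i) _)
    have hsumw : ∑ i, ‖w i‖ ≤ n * (‖w'‖ + ε * ‖β‖) := by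
      refine (Finset.sum_le_sum fun i _ => hwi i).trans ?_
      simp [mul_add]
    calc ∑ i, ‖w i - (∑ j, w j) * ρ i‖ ≤ ∑ i, (‖w i‖ + (∑ j, ‖w j‖) * ρ i) := by
          refine Finset.sum_le_sum fun i _ => (norm_sub_le _ _).trans (add_le_add_right ?_ _)
          rw [norm_mul, Complex.norm_real, Real.norm_of_nonneg (hρ0 i)]
          exact mul_le_mul_of_nonneg_right (norm_sum_le _ _) (hρ0 i)
      _ = 2 * ∑ i, ‖w i‖ := by
          rw [Finset.sum_add_distrib, ← Finset.mul_sum, hρ1]; ring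
      _ ≤ _ := by linarith
  set p := ∑ i, π i * ρ i with hp
  have hβp : ‖β - a * p‖ ≤ V := by
    have e : β - a * p = ∑ i, (π i : ℂ) * v' i := by
      simp only [hβ, hp, hv', mul_sub, Finset.sum_sub_distrib]
      push_cast
      rw [Finset.mul_sum]
      congr 1
      exact Finset.sum_congr rfl fun i _ => by ring
    rw [e]
    refine (norm_sum_mul_le_of_sum_eq_one π (fun i => (hπ0 i).le) hπ1 v').trans ?_
    exact (pi_norm_le_iff_of_nonneg hV0).2 fun i => Finset.single_le_sum
      (f := fun j => ‖v' j‖) (fun j _ => norm_nonneg _) (Finset.mem_univ i)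
  have hp0 : 0 < p := by
    obtain ⟨i, -, hi⟩ : ∃ i ∈ Finset.univ, 0 < ρ i := by
      by_contra hcon
      push Not at hcon
      have := Finset.sum_nonpos hcon
      linarith
    exact lt_of_lt_of_le (mul_pos (hπ0 i) hi) (Finset.single_le_sum
      (f := fun j => π j * ρ j) (fun j _ => mul_nonneg (hπ0 j).le (hρ0 j)) (Finset.mem_univ i))
  have hp1 : p ≤ 1 := by
    rw [← hρ1]
    refine Finset.sum_le_sum fun i _ => mul_le_of_le_one_left (hρ0 i) ?_
    rw [← hπ1]; exact Finset.single_le_sum (fun j _ => (hπ0 j).le) (Finset.mem_univ i)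
  have h3 : ‖β‖ ≤ p * ‖a‖ + V := by
    calc ‖β‖ = ‖a * p + (β - a * p)‖ := by congr 1; ring
      _ ≤ ‖a * p‖ + ‖β - a * p‖ := norm_add_le _ _
      _ ≤ _ := by
        rw [norm_mul, Complex.norm_real, Real.norm_of_nonneg hp0.le]; linarith
  have h4 : ‖z * a + (ε * n * p : ℝ) * a‖ ≤ n * ‖w'‖ + ε * n * V := by
    have e : z * a + (ε * n * p : ℝ) * a = ∑ i, w' i - ε * n * (β - a * p) := by
      have : ∑ i, w' i = z * a - n * b := by
        simp [hw', Finset.sum_sub_distrib, hwsum]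
      rw [this, hbβ]; push_cast; ring
    rw [e]
    refine (norm_sub_le _ _).trans (add_le_add ?_ ?_)
    · refine (norm_sum_le _ _).trans ((Finset.sum_le_sum fun i _ => norm_le_pi_norm w' i).trans ?_)
      simp
    · rw [norm_mul, norm_mul, Complex.norm_real, Real.norm_of_nonneg hε0.le, Complex.norm_natCast]
      exact mul_le_mul_of_nonneg_left hβp (by positivity)
  have hzM : ‖z‖ ≤ M + 2 := by
    have : ‖z‖ ≤ ‖l‖ + ‖(1 : ℂ)‖ := norm_sub_le _ _
    rw [norm_one] at this
    linarith
  obtain ⟨hc1, hc2, hc3⟩ := resolvent_constant_bounds hn hδ0 hδ1 hε0 hε hMδ hzM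
  have hN1 : (1 : ℝ) ≤ n := by exact_mod_cast hn
  by_cases ha0 : a = 0
  · -- then the sum-zero component vanishes as well
    have hV' : V ≤ 0 := by
      rw [ha0, norm_zero, mul_zero, zero_add] at h3
      rw [ha0, norm_zero, zero_add] at h1
      have : V ≤ 4 * n * R ^ 2 * ε * ‖z‖ * V + 2 * n * R * ε * V := by
        calc V ≤ R * (2 * n * (‖w'‖ + ε * ‖β‖)) := h2
          _ ≤ R * (2 * n * (R * (ε * ‖z‖ * (2 * V)) + ε * V)) := by gcongr
          _ = _ := by ring
      nlinarith
    have hv0 : v = 0 := by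
      rw [ha0, norm_zero] at hvnorm
      exact norm_le_zero_iff.1 (by linarith)
    refine ⟨?_, hv0⟩
    have : z • u = 0 := by
      rw [← neg_eq_zero, ← hwu, hw, hv0]; simp
    exact (smul_eq_zero.1 this).resolve_left hz0
  · exfalso
    have := norm_one_add_lt_one_of_perturbation (z := z) (a := a) hN1 hp0 hp1 hε0 hR0 rfl
      (norm_pos_iff.2 ha0) hV0 h1 h2 h3 h4 hc1 hc2 hc3
    rw [hz, add_sub_cancel] at this
    linarith

/-! ### Geometric convergence of the powers -/

/-- Gelfand's formula in the form of a geometric bound: a complex matrix whose eigenvalues all lie in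
the open unit disc has geometrically decaying powers. -/
theorem exists_pow_entry_le_of_eigenvalues {ι : Type*} [Fintype ι] [DecidableEq ι] [Nonempty ι]
    (B : Matrix ι ι ℂ) (hB : ∀ (l : ℂ) (v : ι → ℂ), v ≠ 0 → B.mulVec v = l • v → ‖l‖ < 1) :
    ∃ C r : ℝ, 1 ≤ C ∧ 0 < r ∧ r < 1 ∧ ∀ k i j, ‖(B ^ k) i j‖ ≤ C * r ^ k := by
  let _ : NormedRing (Matrix ι ι ℂ) := Matrix.linftyOpNormedRing
  let _ : NormedAlgebra ℂ (Matrix ι ι ℂ) := Matrix.linftyOpNormedAlgebra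
  have : CompleteSpace (Matrix ι ι ℂ) := FiniteDimensional.complete ℂ _
  have hspec : ∀ l ∈ spectrum ℂ B, ‖l‖₊ < 1 := by
    intro l hl
    rw [← Matrix.spectrum_toLin', ← Module.End.hasEigenvalue_iff_mem_spectrum] at hl
    obtain ⟨v, hv⟩ := hl.exists_hasEigenvector
    exact hB l v hv.2 (by simpa using hv.apply_eq_smul)
  have hrad : spectralRadius ℂ B < 1 := by
    have := spectrum.spectralRadius_lt_of_forall_lt B hspec
    simpa using this
  obtain ⟨r, hr1, hr2⟩ := ENNReal.lt_iff_exists_nnreal_btwn.1 hrad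
  have hr0 : 0 < r := by
    have : (0 : ENNReal) < r := lt_of_le_of_lt (zero_le) hr1
    exact_mod_cast this
  have hev : ∀ᶠ k : ℕ in atTop, ‖B ^ k‖₊ / r ^ k ≤ 1 := by
    have h := (spectrum.pow_nnnorm_pow_one_div_tendsto_nhds_spectralRadius B).eventually_lt_const hr1
    filter_upwards [h, eventually_gt_atTop 0] with k hk hk0
    have h2 : ((‖B ^ k‖₊ : ENNReal) ^ (1 / k : ℝ)) ^ (k : ℝ) ≤ (r : ENNReal) ^ (k : ℝ) :=
      ENNReal.rpow_le_rpow hk.le (by positivity)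
    rw [← ENNReal.rpow_mul, one_div_mul_cancel (by positivity), ENNReal.rpow_one,
      ENNReal.rpow_natCast] at h2
    rw [div_le_one (by positivity)]
    exact_mod_cast h2
  have hbdd : BddAbove (Set.range fun k : ℕ => ‖B ^ k‖₊ / r ^ k) :=
    (Filter.isBoundedUnder_of_eventually_le hev).bddAbove_range
  obtain ⟨C, hC⟩ := hbdd
  refine ⟨max C 1, r, le_max_right _ _, hr0, by exact_mod_cast hr2, fun k i j => ?_⟩
  have h1 : ‖B ^ k‖₊ ≤ C * r ^ k := by
    have := hC ⟨k, rfl⟩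
    rwa [div_le_iff₀ (by positivity)] at this
  have h2 : ‖(B ^ k) i j‖₊ ≤ ‖B ^ k‖₊ := by
    rw [Matrix.linfty_opNNNorm_def]
    refine le_trans ?_ (Finset.le_sup (f := fun i => ∑ j, ‖(B ^ k) i j‖₊) (Finset.mem_univ i))
    exact Finset.single_le_sum (f := fun j => ‖(B ^ k) i j‖₊) (fun _ _ => zero_le)
      (Finset.mem_univ j)
  have h3 : ‖(B ^ k) i j‖ ≤ C * r ^ k := by exact_mod_cast h2.trans h1
  refine h3.trans ?_
  have : (C : ℝ) ≤ max (C : ℝ) 1 := le_max_left _ _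
  gcongr

/-- The limit of the powers of the surplus-based weight matrix: it replaces every state by the
average of all states and surpluses, and every surplus by `0`. -/
noncomputable def averagingMatrix (n : ℕ) : Matrix (Fin n ⊕ Fin n) (Fin n ⊕ Fin n) ℝ :=
  Matrix.fromBlocks (Matrix.of fun _ _ => (n : ℝ)⁻¹) (Matrix.of fun _ _ => (n : ℝ)⁻¹) 0 0

section Averaging

variable {n : ℕ} {Wr Wc : Matrix (Fin n) (Fin n) ℝ}

theorem averagingMatrix_mul_surplusMatrix
    (hWc : Wc ∈ Matrix.colStochastic ℝ (Fin n)) (ε : ℝ) :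
    averagingMatrix n * surplusMatrix Wr Wc ε = averagingMatrix n := by
  have h : (Matrix.of fun _ _ => (n : ℝ)⁻¹ : Matrix (Fin n) (Fin n) ℝ) * Wc =
      Matrix.of fun _ _ => (n : ℝ)⁻¹ := by
    ext i j
    simp [Matrix.mul_apply, ← Finset.mul_sum, Matrix.sum_col_of_mem_colStochastic hWc]
  rw [surplusMatrix, averagingMatrix, Matrix.fromBlocks_multiply, Matrix.mul_sub, Matrix.mul_sub, h]
  simp

theorem averagingMatrix_mul_self (hn : 1 ≤ n) :
    averagingMatrix n * averagingMatrix n = averagingMatrix n := by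
  have h : (Matrix.of fun _ _ => (n : ℝ)⁻¹ : Matrix (Fin n) (Fin n) ℝ) *
      (Matrix.of fun _ _ => (n : ℝ)⁻¹) = Matrix.of fun _ _ => (n : ℝ)⁻¹ := by
    have : (n : ℝ) ≠ 0 := by positivity
    ext i j
    simp [Matrix.mul_apply, this]
  rw [averagingMatrix, Matrix.fromBlocks_multiply, h]
  simp

/-- The powers of the surplus-based weight matrix converge geometrically to `averagingMatrix n`; for
`k ≥ 1` the power `(W - P) ^ k` is `W ^ k - P`. -/
theorem exists_pow_sub_averagingMatrix_le (hn : 1 ≤ n)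
    (hWr : Wr ∈ Matrix.rowStochastic ℝ (Fin n)) (hcr : Wr.PosConnected)
    (hWc : Wc ∈ Matrix.colStochastic ℝ (Fin n)) (hcc : Wc.transpose.PosConnected)
    (ε : ℝ) (hε0 : 0 < ε) (hε : ε ≤ epsBar Wr Wc) :
    ∃ C r : ℝ, 1 ≤ C ∧ 0 < r ∧ r < 1 ∧
      ∀ k i j, |((surplusMatrix Wr Wc ε - averagingMatrix n) ^ k) i j| ≤ C * r ^ k := by
  have : Nonempty (Fin n) := ⟨⟨0, hn⟩⟩
  have hWct : Wc.transpose ∈ Matrix.rowStochastic ℝ (Fin n) :=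
    Matrix.transpose_mem_rowStochastic_iff_mem_colStochastic.2 hWc
  set W := surplusMatrix Wr Wc ε with hW
  set P := averagingMatrix n with hP
  have hPW : P * (W - P) = 0 := by
    rw [mul_sub, averagingMatrix_mul_surplusMatrix hWc, averagingMatrix_mul_self hn, sub_self]
  suffices hB : ∀ (l : ℂ) (v : Fin n ⊕ Fin n → ℂ), v ≠ 0 →
      ((W - P).map (algebraMap ℝ ℂ)).mulVec v = l • v → ‖l‖ < 1 by
    obtain ⟨C, r, hC, hr0, hr1, h⟩ := exists_pow_entry_le_of_eigenvalues _ hB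
    refine ⟨C, r, hC, hr0, hr1, fun k i j => ?_⟩
    have e : ((W - P).map (algebraMap ℝ ℂ)) ^ k = ((W - P) ^ k).map (algebraMap ℝ ℂ) :=
      (Matrix.map_pow (W - P) (algebraMap ℝ ℂ) k).symm
    have := h k i j
    rw [e] at this
    simpa using this
  · intro l v hv0 hv
    by_contra hcon
    push Not at hcon
    have hl0 : l ≠ 0 := by rintro rfl; simp at hcon; linarith
    -- an eigenvector for a nonzero eigenvalue is annihilated by `P`
    have hPv : (P.map (algebraMap ℝ ℂ)).mulVec v = 0 := by
      have h1 : (P.map (algebraMap ℝ ℂ)).mulVec (l • v) = 0 := by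
        rw [← hv, Matrix.mulVec_mulVec, ← Matrix.map_mul, hPW]
        simp
      rw [Matrix.mulVec_smul] at h1
      exact (smul_eq_zero.1 h1).resolve_left hl0
    have hWv : (W.map (algebraMap ℝ ℂ)).mulVec v = l • v := by
      have : (W - P).map (algebraMap ℝ ℂ) = W.map (algebraMap ℝ ℂ) - P.map (algebraMap ℝ ℂ) :=
        Matrix.map_sub _ (by simp) _ _
      rw [this, Matrix.sub_mulVec, hPv, sub_zero] at hv
      exact hv
    set x : Fin n → ℂ := fun i => v (Sum.inl i) with hx
    set y : Fin n → ℂ := fun i => v (Sum.inr i) with hy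
    have hvxy : v = Sum.elim x y := by ext (i | i) <;> rfl
    have hWmap : W.map (algebraMap ℝ ℂ) = Matrix.fromBlocks (Wr.map (algebraMap ℝ ℂ))
        ((ε : ℂ) • 1) (1 - Wr.map (algebraMap ℝ ℂ)) (Wc.map (algebraMap ℝ ℂ) - (ε : ℂ) • 1) := by
      have e1 : (1 : Matrix (Fin n) (Fin n) ℝ).map (algebraMap ℝ ℂ) = 1 :=
        Matrix.map_one _ (by simp) (by simp)
      have e2 : (ε • (1 : Matrix (Fin n) (Fin n) ℝ)).map (algebraMap ℝ ℂ) = (ε : ℂ) • 1 := by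
        ext i j
        by_cases hij : i = j <;> simp [hij]
      rw [hW, surplusMatrix, Matrix.fromBlocks_map, Matrix.map_sub _ (by simp),
        Matrix.map_sub _ (by simp), e1, e2]
    rw [hWmap, hvxy, Matrix.fromBlocks_mulVec] at hWv
    have hEx : (Wr.map (algebraMap ℝ ℂ)).mulVec x + (ε : ℂ) • y = l • x := by
      ext i
      have := congrFun hWv (Sum.inl i)
      simpa [Matrix.smul_mulVec] using this
    have hEy : x - (Wr.map (algebraMap ℝ ℂ)).mulVec x + (Wc.map (algebraMap ℝ ℂ)).mulVec y -
        (ε : ℂ) • y = l • y := by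
      ext i
      have := congrFun hWv (Sum.inr i)
      simp [Matrix.sub_mulVec, Matrix.smul_mulVec] at this
      simp [← this]
      ring
    by_cases hl1 : l = 1
    · subst hl1
      rw [one_smul] at hEx hEy
      -- `y` is fixed by `Wc`
      have hyfix : Matrix.vecMul y (Wc.transpose.map (algebraMap ℝ ℂ)) = y := by
        rw [Matrix.transpose_map, Matrix.vecMul_transpose]
        ext i
        have h1 := congrFun hEx i
        have h2 := congrFun hEy i
        simp only [Pi.add_apply, Pi.sub_apply, Pi.smul_apply, smul_eq_mul] at h1 h2
        linear_combination h1 + h2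
      obtain ⟨π, hπ0, hπ1, hπ⟩ := exists_stationary hWr hcr
      obtain ⟨ρ, hρ0, hρ1, hρ⟩ := exists_stationary hWct hcc
      have hπy : ∑ i, (π i : ℂ) * y i = 0 := by
        have h1 : ∑ i, (π i : ℂ) * (Wr.map (algebraMap ℝ ℂ)).mulVec x i =
            ∑ i, (π i : ℂ) * x i := by
          simp only [Matrix.mulVec, dotProduct, Finset.mul_sum]
          rw [Finset.sum_comm]
          refine Finset.sum_congr rfl fun j _ => ?_
          have := congrArg (fun r : ℝ => (r : ℂ)) (congrFun hπ j)
          simp only [Matrix.vecMul, dotProduct] at this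
          rw [← this]
          push_cast
          rw [Finset.sum_mul]
          refine Finset.sum_congr rfl fun i _ => ?_
          simp [mul_assoc]
        have h2 := congrArg (fun u : Fin n → ℂ => ∑ i, (π i : ℂ) * u i) hEx
        simp only [Pi.add_apply, Pi.smul_apply, smul_eq_mul, mul_add, Finset.sum_add_distrib,
          h1] at h2
        have h3 : ∑ i, (π i : ℂ) * (ε * y i) = ε * ∑ i, (π i : ℂ) * y i := by
          rw [Finset.mul_sum]; exact Finset.sum_congr rfl fun i _ => by ring
        rw [h3] at h2
        have h4 : (ε : ℂ) * ∑ i, (π i : ℂ) * y i = 0 := by linear_combination h2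
        exact (mul_eq_zero.1 h4).resolve_left (by exact_mod_cast hε0.ne')
      -- `y` is a multiple of the stationary vector `ρ`, and `⟨π, ρ⟩ > 0`
      set a : ℂ := ∑ i, y i with ha
      have hyρ : y - a • (fun i => (ρ i : ℂ)) = 0 := by
        refine eq_zero_of_vecMul_eq_self_complex hWct hcc _ ?_ ?_
        · rw [Matrix.sub_vecMul, Matrix.smul_vecMul, hyfix]
          congr 2
          ext i
          have := congrArg (fun r : ℝ => (r : ℂ)) (congrFun hρ i)
          simp only [Matrix.vecMul, dotProduct] at this
          push_cast at this
          simpa [Matrix.vecMul, dotProduct] using this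
        · simp only [Pi.sub_apply, Pi.smul_apply, smul_eq_mul, Finset.sum_sub_distrib,
            ← Finset.mul_sum, ← Complex.ofReal_sum, hρ1, ← ha]
          simp
      have hya : ∀ i, y i = a * ρ i := fun i => by
        have := congrFun hyρ i
        simpa [sub_eq_zero] using this
      have ha0 : a = 0 := by
        have h1 : a * ((∑ i, π i * ρ i : ℝ) : ℂ) = 0 := by
          rw [← hπy]
          push_cast
          rw [Finset.mul_sum]
          exact Finset.sum_congr rfl fun i _ => by rw [hya i]; ring
        refine (mul_eq_zero.1 h1).resolve_right ?_
        have : 0 < ∑ i, π i * ρ i :=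
          Finset.sum_pos (fun i _ => mul_pos (hπ0 i) (hρ0 i)) Finset.univ_nonempty
        exact_mod_cast this.ne'
      have hy0 : y = 0 := by ext i; rw [hya i, ha0]; simp
      rw [hy0, smul_zero, add_zero] at hEx
      have hconst := eq_of_mulVec_eq_self_complex hWr hcr x hEx
      have hn0 : (n : ℂ) ≠ 0 := by exact_mod_cast (by omega : n ≠ 0)
      have hx0 : x = 0 := by
        ext i
        have h1 := congrFun hPv (Sum.inl i)
        have hPmap : P.map (algebraMap ℝ ℂ) = Matrix.fromBlocks (Matrix.of fun _ _ => (n : ℂ)⁻¹)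
            (Matrix.of fun _ _ => (n : ℂ)⁻¹) 0 0 := by
          rw [hP, averagingMatrix, Matrix.fromBlocks_map]
          congr 1 <;> ext <;> simp
        rw [hPmap, hvxy, hy0, Matrix.fromBlocks_mulVec] at h1
        have h2 : ∑ j, x j = n * x i := by
          rw [Finset.sum_congr rfl fun j _ => hconst j i]; simp
        have h3 : ∑ j, (n : ℂ)⁻¹ * x j = 0 := by
          simpa [Matrix.mulVec, dotProduct] using h1
        rw [← Finset.mul_sum, h2, inv_mul_cancel_left₀ hn0] at h3
        exact h3
      exact hv0 (by rw [hvxy, hx0, hy0]; ext (i | i) <;> rfl)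
    · obtain ⟨h1, h2⟩ := surplusMatrix_eigenvector_eq_zero hn Wr Wc hWr hcr hWct hcc ε hε0 hε l hcon
        hl1 x y hEx hEy
      exact hv0 (by rw [hvxy, h1, h2]; ext (i | i) <;> rfl)

end Averaging

/-! ### The standard Gaussian measure and Gaussian smoothing -/

section Gaussian

variable {E : Type*} [NormedAddCommGroup E] [InnerProductSpace ℝ E] [FiniteDimensional ℝ E]
  [MeasurableSpace E] [BorelSpace E]

theorem integrable_exp_neg_mul_sq_norm {b : ℝ} (hb : 0 < b) :
    Integrable fun v : E => Real.exp (-b * ‖v‖ ^ 2) := by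
  have h := (GaussianFourier.integrable_cexp_neg_mul_sq_norm_add (V := E) (b := (b : ℂ))
    (by simpa using hb) 0 0).re
  refine h.congr (Eventually.of_forall fun v => ?_)
  simp only [zero_mul, add_zero]
  have : (-(b : ℂ) * (‖v‖ : ℂ) ^ 2) = ((-b * ‖v‖ ^ 2 : ℝ) : ℂ) := by push_cast; ring
  rw [this]
  exact Complex.exp_ofReal_re _

theorem integral_exp_neg_half_sq_norm_pos :
    0 < ∫ v : E, Real.exp (-(1 / 2) * ‖v‖ ^ 2) :=
  integral_exp_pos (integrable_exp_neg_mul_sq_norm (by norm_num))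

/-- The standard Gaussian measure has density `κ⁻¹ exp (-‖v‖² / 2)`: both measures have the same
characteristic function. -/
theorem stdGaussian_eq_withDensity :
    stdGaussian E = (volume : Measure E).withDensity fun v => ENNReal.ofReal
      ((∫ u : E, Real.exp (-(1 / 2) * ‖u‖ ^ 2))⁻¹ * Real.exp (-(1 / 2) * ‖v‖ ^ 2)) := by
  set κ := ∫ u : E, Real.exp (-(1 / 2) * ‖u‖ ^ 2) with hκ
  have hκ0 : 0 < κ := integral_exp_neg_half_sq_norm_pos
  have hint : Integrable fun v : E => κ⁻¹ * Real.exp (-(1 / 2) * ‖v‖ ^ 2) :=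
    (integrable_exp_neg_mul_sq_norm (by norm_num)).const_mul _
  have : IsFiniteMeasure ((volume : Measure E).withDensity fun v => ENNReal.ofReal
      (κ⁻¹ * Real.exp (-(1 / 2) * ‖v‖ ^ 2))) := isFiniteMeasure_withDensity_ofReal hint.2
  apply Measure.ext_of_charFun
  ext t
  rw [charFun_stdGaussian, charFun_apply, integral_withDensity_eq_integral_toReal_smul
    (by fun_prop) (Eventually.of_forall fun _ => ENNReal.ofReal_lt_top)]
  have h1 : ∀ v : E, (ENNReal.ofReal (κ⁻¹ * Real.exp (-(1 / 2) * ‖v‖ ^ 2))).toReal •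
      Complex.exp (inner ℝ v t * Complex.I) = (κ : ℂ)⁻¹ *
      Complex.exp (-(1 / 2 : ℂ) * ‖v‖ ^ 2 + Complex.I * inner ℝ t v) := by
    intro v
    rw [ENNReal.toReal_ofReal (by positivity), Complex.real_smul, Complex.exp_add,
      real_inner_comm v t]
    push_cast
    ring_nf
  simp_rw [h1]
  have hre : 0 < (1 / 2 : ℂ).re := by norm_num
  rw [integral_const_mul, GaussianFourier.integral_cexp_neg_mul_sq_norm_add hre]
  have h2 : (κ : ℂ) = (Real.pi / (1 / 2 : ℂ)) ^ (Module.finrank ℝ E / 2 : ℂ) := by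
    rw [← GaussianFourier.integral_cexp_neg_mul_sq_norm (V := E) hre, hκ,
      ← integral_complex_ofReal]
    congr 1; ext v; push_cast; rfl
  have hκ1 : (κ : ℂ) ≠ 0 := by exact_mod_cast hκ0.ne'
  rw [← h2, inv_mul_cancel_left₀ hκ1, Complex.I_sq]
  congr 1
  ring

theorem integral_stdGaussian (g : E → ℝ) :
    ∫ v, g v ∂(stdGaussian E) = 1 / (∫ u : E, Real.exp (-(1 / 2) * ‖u‖ ^ 2)) *
      ∫ v : E, g v * Real.exp (-(1 / 2) * ‖v‖ ^ 2) := by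
  rw [stdGaussian_eq_withDensity, integral_withDensity_eq_integral_toReal_smul
    (by fun_prop) (Eventually.of_forall fun _ => ENNReal.ofReal_lt_top), ← integral_const_mul]
  congr 1
  ext v
  rw [ENNReal.toReal_ofReal (by have := integral_exp_neg_half_sq_norm_pos (E := E); positivity),
    smul_eq_mul]
  ring

theorem memLp_id_stdGaussian (p : ENNReal) (hp : p ≠ ⊤) :
    MemLp (fun v : E => v) p (stdGaussian E) :=
  IsGaussian.memLp_id _ p hp

theorem integrable_norm_stdGaussian : Integrable (fun v : E => ‖v‖) (stdGaussian E) :=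
  ((memLp_id_stdGaussian 1 (by simp)).integrable le_rfl).norm

theorem memLp_norm_sq_stdGaussian : MemLp (fun v : E => ‖v‖ ^ 2) 2 (stdGaussian E) := by
  have h := (memLp_id_stdGaussian (E := E) 4 (by simp)).norm
  have : (fun v : E => ‖v‖ ^ 2) = fun v : E => ‖(‖v‖ : ℝ)‖ ^ (2 : ENNReal).toReal := by
    ext v; simp
  rw [this]
  convert! h.norm_rpow_div (q := 2) using 1
  rw [show (4 : ENNReal) = 2 * 2 by norm_num, ENNReal.mul_div_cancel_right (by simp) (by simp)]

theorem integral_norm_stdGaussian_le :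
    ∫ v : E, ‖v‖ ∂(stdGaussian E) ≤ √(Module.finrank ℝ E) := by
  have h2 : ∫ v : E, ‖v‖ ^ 2 ∂(stdGaussian E) ≤ Module.finrank ℝ E := by
    let b := stdOrthonormalBasis ℝ E
    have e : ∀ v : E, ‖v‖ ^ 2 = ∑ i, (innerSL ℝ (b i) v) ^ 2 := by
      intro v
      rw [← b.sum_sq_norm_inner_right v]
      refine Finset.sum_congr rfl fun i _ => ?_
      simp
    have hL2 : ∀ i, MemLp (fun v => innerSL ℝ (b i) v) 2 (stdGaussian E) := fun i =>
      (innerSL ℝ (b i)).comp_memLp' (memLp_id_stdGaussian 2 (by simp))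
    simp_rw [e]
    rw [integral_finsetSum _ fun i _ => (hL2 i).integrable_sq]
    have : ∀ i, ∫ v, (innerSL ℝ (b i) v) ^ 2 ∂(stdGaussian E) = 1 := by
      intro i
      have h1 := variance_dual_stdGaussian (innerSL ℝ (b i))
      rw [variance_of_integral_eq_zero (hL2 i).aestronglyMeasurable.aemeasurable
        (integral_strongDual_stdGaussian _), innerSL_apply_norm, b.norm_eq_one] at h1
      simpa using h1
    rw [Finset.sum_congr rfl fun i _ => this i]
    simp
  have h3 : (∫ v : E, ‖v‖ ∂(stdGaussian E)) ^ 2 ≤ ∫ v : E, ‖v‖ ^ 2 ∂(stdGaussian E) := by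
    have hm : MemLp (fun v : E => ‖v‖) 2 (stdGaussian E) := (memLp_id_stdGaussian 2 (by simp)).norm
    have h4 := variance_nonneg (fun v : E => ‖v‖) (stdGaussian E)
    rw [variance_eq_sub hm] at h4
    simp only [Pi.pow_apply] at h4
    linarith
  exact Real.le_sqrt_of_sq_le (h3.trans h2)

/-- Differentiation of a Gaussian average under translation: the derivative falls on the density, so
that no regularity of `F` is needed. -/
theorem hasDerivAt_integral_translate (F : E → ℝ) (hF : Continuous F) (K : ℝ)
    (hK : ∀ v, |F v| ≤ K * (1 + ‖v‖)) (c : E) :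
    HasDerivAt (fun t : ℝ => ∫ v : E, F (v + t • c) * Real.exp (-(1 / 2) * ‖v‖ ^ 2))
      (∫ v : E, F v * inner ℝ v c * Real.exp (-(1 / 2) * ‖v‖ ^ 2)) 0 := by
  have hshift : (fun t : ℝ => ∫ v : E, F (v + t • c) * Real.exp (-(1 / 2) * ‖v‖ ^ 2)) =
      fun t : ℝ => ∫ v : E, F v * Real.exp (-(1 / 2) * ‖v - t • c‖ ^ 2) := by
    ext t
    rw [← integral_sub_right_eq_self _ (t • c)]
    simp
  have hK0 : 0 ≤ K := by
    have := (abs_nonneg _).trans (hK 0)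
    simpa using this
  have hpoly : ∀ s : ℝ, (1 + s) ^ 2 ≤ 18 * Real.exp (1 / 8 * s ^ 2) := by
    intro s
    have h1 := Real.add_one_le_exp (1 / 8 * s ^ 2)
    nlinarith [sq_nonneg (s - 1)]
  rw [hshift]
  have key := hasDerivAt_integral_of_dominated_loc_of_deriv_le (𝕜 := ℝ) (μ := (volume : Measure E))
    (s := Metric.ball (0 : ℝ) 1) (x₀ := 0)
    (F := fun t v => F v * Real.exp (-(1 / 2) * ‖v - t • c‖ ^ 2))
    (F' := fun t v => F v * (Real.exp (-(1 / 2) * ‖v - t • c‖ ^ 2) * inner ℝ (v - t • c) c))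
    (bound := fun v => K * (1 + ‖c‖) * ‖c‖ * Real.exp (1 / 2 * ‖c‖ ^ 2) * 18 *
      Real.exp (-(1 / 8) * ‖v‖ ^ 2))
    (Metric.ball_mem_nhds _ one_pos)
    (Eventually.of_forall fun t => Continuous.aestronglyMeasurable (by fun_prop)) ?_
    (Continuous.aestronglyMeasurable (by fun_prop)) ?_ ?_ ?_
  · convert! key.2 using 3
    simp
    ring
  · refine Integrable.mono' (g := fun v => K * 18 * Real.exp (-(3 / 8) * ‖v‖ ^ 2)) ?_
      (Continuous.aestronglyMeasurable (by fun_prop)) (Eventually.of_forall fun v => ?_)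
    · exact (integrable_exp_neg_mul_sq_norm (by norm_num)).const_mul _
    · rw [norm_mul, Real.norm_eq_abs, Real.norm_eq_abs, Real.abs_exp, zero_smul, sub_zero]
      have h1 : (1 + ‖v‖) ≤ (1 + ‖v‖) ^ 2 := by nlinarith [norm_nonneg v]
      have h2 : |F v| ≤ K * (18 * Real.exp (1 / 8 * ‖v‖ ^ 2)) :=
        (hK v).trans (mul_le_mul_of_nonneg_left (h1.trans (hpoly _)) hK0)
      calc _ ≤ K * (18 * Real.exp (1 / 8 * ‖v‖ ^ 2)) * Real.exp (-(1 / 2) * ‖v‖ ^ 2) := by gcongr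
        _ = K * 18 * (Real.exp (1 / 8 * ‖v‖ ^ 2) * Real.exp (-(1 / 2) * ‖v‖ ^ 2)) := by ring
        _ = _ := by rw [← Real.exp_add]; ring_nf
  · refine Eventually.of_forall fun v t ht => ?_
    have ht1 : |t| ≤ 1 := by
      have := Metric.mem_ball.1 ht
      rw [dist_zero_right, Real.norm_eq_abs] at this
      exact this.le
    have htc : ‖t • c‖ ≤ ‖c‖ := by
      rw [norm_smul, Real.norm_eq_abs]
      exact mul_le_of_le_one_left (norm_nonneg _) ht1
    have hinner : |inner ℝ (v - t • c) c| ≤ (1 + ‖v‖) * ((1 + ‖c‖) * ‖c‖) := by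
      calc |inner ℝ (v - t • c) c| ≤ ‖v - t • c‖ * ‖c‖ := abs_real_inner_le_norm _ _
        _ ≤ (‖v‖ + ‖c‖) * ‖c‖ := by
          gcongr; exact (norm_sub_le _ _).trans (add_le_add_right htc _)
        _ ≤ _ := by
          rw [← mul_assoc]
          gcongr
          nlinarith [norm_nonneg v, norm_nonneg c]
    -- `‖v - t c‖² ≥ ‖v‖² / 2 - ‖c‖²`
    have hexp : -(1 / 2) * ‖v - t • c‖ ^ 2 ≤ -(1 / 4) * ‖v‖ ^ 2 + 1 / 2 * ‖c‖ ^ 2 := by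
      have h1 : ‖v‖ ≤ ‖v - t • c‖ + ‖c‖ := by
        calc ‖v‖ = ‖(v - t • c) + t • c‖ := by rw [sub_add_cancel]
          _ ≤ _ := (norm_add_le _ _).trans (add_le_add_right htc _)
      nlinarith [norm_nonneg v, norm_nonneg c, norm_nonneg (v - t • c),
        sq_nonneg (‖v - t • c‖ - ‖c‖)]
    rw [norm_mul, norm_mul, Real.norm_eq_abs, Real.norm_eq_abs, Real.abs_exp, Real.norm_eq_abs]
    calc |F v| * (Real.exp (-(1 / 2) * ‖v - t • c‖ ^ 2) * |inner ℝ (v - t • c) c|)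
        ≤ K * (1 + ‖v‖) * (Real.exp (-(1 / 4) * ‖v‖ ^ 2 + 1 / 2 * ‖c‖ ^ 2) *
            ((1 + ‖v‖) * ((1 + ‖c‖) * ‖c‖))) := by
          have := hK v
          gcongr
      _ = K * (1 + ‖c‖) * ‖c‖ * Real.exp (1 / 2 * ‖c‖ ^ 2) * (1 + ‖v‖) ^ 2 *
            Real.exp (-(1 / 4) * ‖v‖ ^ 2) := by rw [Real.exp_add]; ring
      _ ≤ K * (1 + ‖c‖) * ‖c‖ * Real.exp (1 / 2 * ‖c‖ ^ 2) * (18 * Real.exp (1 / 8 * ‖v‖ ^ 2)) *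
            Real.exp (-(1 / 4) * ‖v‖ ^ 2) := by
          have := hpoly ‖v‖
          gcongr
      _ = K * (1 + ‖c‖) * ‖c‖ * Real.exp (1 / 2 * ‖c‖ ^ 2) * 18 * (Real.exp (1 / 8 * ‖v‖ ^ 2) *
            Real.exp (-(1 / 4) * ‖v‖ ^ 2)) := by ring
      _ = _ := by rw [← Real.exp_add]; ring_nf
  · exact (integrable_exp_neg_mul_sq_norm (by norm_num)).const_mul _
  · refine Eventually.of_forall fun v t _ => ?_
    have h1 : HasDerivAt (fun t : ℝ => v - t • c) (-c) t := by
      simpa using ((hasDerivAt_id t).smul_const c).const_sub v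
    have h2 := (h1.norm_sq.const_mul (-(1 / 2 : ℝ))).exp.const_mul (F v)
    convert! h2 using 1
    rw [inner_neg_right]
    ring

end Gaussian

/-! ### The randomized gradient-free oracle -/

section Oracle

variable {m : ℕ} {μ D : ℝ} {g : EuclideanSpace ℝ (Fin m) → ℝ}

/-- The mean of the randomized gradient-free oracle, which is the gradient of the Gaussian
smoothing. -/
noncomputable def meanOracle (μ : ℝ) (g : EuclideanSpace ℝ (Fin m) → ℝ)
    (x : EuclideanSpace ℝ (Fin m)) : EuclideanSpace ℝ (Fin m) :=
  ∫ v, gradFreeOracle μ g x v ∂(stdGaussian (EuclideanSpace ℝ (Fin m)))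

theorem continuous_of_abs_sub_le (hg : ∀ x y, |g x - g y| ≤ D * ‖x - y‖) : Continuous g := by
  have hD : ∀ x y, dist (g x) (g y) ≤ (D ⊔ 0).toNNReal * dist x y := by
    intro x y
    rw [Real.dist_eq, dist_eq_norm, Real.coe_toNNReal _ le_sup_right]
    exact (hg x y).trans (mul_le_mul_of_nonneg_right le_sup_left (norm_nonneg _))
  exact (LipschitzWith.of_dist_le_mul hD).continuous

theorem norm_gradFreeOracle_le (hμ : 0 < μ) (hg : ∀ x y, |g x - g y| ≤ D * ‖x - y‖)
    (x v : EuclideanSpace ℝ (Fin m)) : ‖gradFreeOracle μ g x v‖ ≤ D * ‖v‖ ^ 2 := by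
  rw [gradFreeOracle, norm_smul, norm_div, Real.norm_eq_abs, Real.norm_of_nonneg hμ.le]
  have h := hg (x + μ • v) x
  rw [add_sub_cancel_left, norm_smul, Real.norm_of_nonneg hμ.le] at h
  calc |g (x + μ • v) - g x| / μ * ‖v‖ ≤ D * (μ * ‖v‖) / μ * ‖v‖ := by gcongr
    _ = D * ‖v‖ ^ 2 := by field_simp

theorem norm_gradFreeOracle_sub_le (hμ : 0 < μ) (hg : ∀ x y, |g x - g y| ≤ D * ‖x - y‖)
    (x y v : EuclideanSpace ℝ (Fin m)) :
    ‖gradFreeOracle μ g x v - gradFreeOracle μ g y v‖ ≤ 2 * D / μ * ‖x - y‖ * ‖v‖ := by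
  rw [gradFreeOracle, gradFreeOracle, ← sub_smul, ← sub_div, norm_smul, norm_div,
    Real.norm_of_nonneg hμ.le, Real.norm_eq_abs]
  have h1 := hg (x + μ • v) (y + μ • v)
  have h2 := hg x y
  rw [add_sub_add_right_eq_sub] at h1
  have h3 : |g (x + μ • v) - g x - (g (y + μ • v) - g y)| ≤ 2 * D * ‖x - y‖ := by
    have : g (x + μ • v) - g x - (g (y + μ • v) - g y) =
        (g (x + μ • v) - g (y + μ • v)) - (g x - g y) := by ring
    rw [this]
    refine (abs_sub _ _).trans ?_
    linarith
  calc _ ≤ 2 * D * ‖x - y‖ / μ * ‖v‖ := by gcongr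
    _ = _ := by ring

theorem continuous_gradFreeOracle (hg : Continuous g) :
    Continuous fun p : EuclideanSpace ℝ (Fin m) × EuclideanSpace ℝ (Fin m) =>
      gradFreeOracle μ g p.1 p.2 := by
  unfold gradFreeOracle
  fun_prop

theorem integrable_gradFreeOracle (hμ : 0 < μ) (hg : ∀ x y, |g x - g y| ≤ D * ‖x - y‖)
    (x : EuclideanSpace ℝ (Fin m)) :
    Integrable (gradFreeOracle μ g x) (stdGaussian (EuclideanSpace ℝ (Fin m))) :=
  ((memLp_norm_sq_stdGaussian.integrable (by simp)).const_mul D).mono'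
    ((continuous_gradFreeOracle (continuous_of_abs_sub_le hg)).comp
      (Continuous.prodMk_right x)).aestronglyMeasurable
    (Eventually.of_forall fun v => norm_gradFreeOracle_le hμ hg x v)

theorem norm_meanOracle_sub_le (hμ : 0 < μ) (hg : ∀ x y, |g x - g y| ≤ D * ‖x - y‖)
    (x y : EuclideanSpace ℝ (Fin m)) :
    ‖meanOracle μ g x - meanOracle μ g y‖ ≤
      2 * D / μ * (∫ v, ‖v‖ ∂(stdGaussian (EuclideanSpace ℝ (Fin m)))) * ‖x - y‖ := by
  rw [meanOracle, meanOracle, ← integral_sub (integrable_gradFreeOracle hμ hg x)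
    (integrable_gradFreeOracle hμ hg y)]
  refine (norm_integral_le_of_norm_le (integrable_norm_stdGaussian.const_mul _)
    (Eventually.of_forall fun v => norm_gradFreeOracle_sub_le hμ hg x y v)).trans (le_of_eq ?_)
  rw [integral_const_mul]
  ring

theorem continuous_meanOracle (hμ : 0 < μ) (hg : ∀ x y, |g x - g y| ≤ D * ‖x - y‖) :
    Continuous (meanOracle μ g) := by
  have h : ∀ x y, dist (meanOracle μ g x) (meanOracle μ g y) ≤
      ((2 * D / μ * (∫ v, ‖v‖ ∂(stdGaussian (EuclideanSpace ℝ (Fin m))))) ⊔ 0).toNNReal *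
        dist x y := by
    intro x y
    rw [dist_eq_norm, dist_eq_norm, Real.coe_toNNReal _ le_sup_right]
    exact (norm_meanOracle_sub_le hμ hg x y).trans
      (mul_le_mul_of_nonneg_right le_sup_left (norm_nonneg _))
  exact (LipschitzWith.of_dist_le_mul h).continuous

theorem norm_meanOracle_le (hμ : 0 < μ) (hg : ∀ x y, |g x - g y| ≤ D * ‖x - y‖)
    (x : EuclideanSpace ℝ (Fin m)) :
    ‖meanOracle μ g x‖ ≤ D * ∫ v, ‖v‖ ^ 2 ∂(stdGaussian (EuclideanSpace ℝ (Fin m))) := by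
  rw [meanOracle, ← integral_const_mul]
  exact norm_integral_le_of_norm_le ((memLp_norm_sq_stdGaussian.integrable (by simp)).const_mul D)
    (Eventually.of_forall fun v => norm_gradFreeOracle_le hμ hg x v)

theorem meanOracle_sum {n : ℕ} {f : Fin n → EuclideanSpace ℝ (Fin m) → ℝ} (hμ : 0 < μ)
    (hf : ∀ i x y, |f i x - f i y| ≤ D * ‖x - y‖) (x : EuclideanSpace ℝ (Fin m)) :
    meanOracle μ (fun x => ∑ i, f i x) x = ∑ i, meanOracle μ (f i) x := by
  simp only [meanOracle]
  rw [← integral_finsetSum _ fun i _ => integrable_gradFreeOracle hμ (hf i) x]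
  congr 1
  ext1 v
  simp only [gradFreeOracle]
  rw [← Finset.sum_sub_distrib, Finset.sum_div, Finset.sum_smul]

theorem gaussianSmoothing_eq_integral (x : EuclideanSpace ℝ (Fin m)) :
    gaussianSmoothing μ g x = ∫ v, g (x + μ • v) ∂(stdGaussian (EuclideanSpace ℝ (Fin m))) :=
  (integral_stdGaussian fun v => g (x + μ • v)).symm

theorem integrable_translate (hμ : 0 < μ) (hg : ∀ x y, |g x - g y| ≤ D * ‖x - y‖)
    (x : EuclideanSpace ℝ (Fin m)) :
    Integrable (fun v => g (x + μ • v)) (stdGaussian (EuclideanSpace ℝ (Fin m))) := by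
  have hcont := continuous_of_abs_sub_le hg
  refine Integrable.mono' (g := fun v => |g x| + D * μ * ‖v‖)
    ((integrable_const _).add (integrable_norm_stdGaussian.const_mul _))
    (Continuous.aestronglyMeasurable (by fun_prop)) (Eventually.of_forall fun v => ?_)
  have h := hg (x + μ • v) x
  rw [add_sub_cancel_left, norm_smul, Real.norm_of_nonneg hμ.le] at h
  have h2 := abs_sub_abs_le_abs_sub (g (x + μ • v)) (g x)
  rw [Real.norm_eq_abs]
  linarith

theorem gaussianSmoothing_sum {n : ℕ} {f : Fin n → EuclideanSpace ℝ (Fin m) → ℝ} (hμ : 0 < μ)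
    (hf : ∀ i x y, |f i x - f i y| ≤ D * ‖x - y‖) (x : EuclideanSpace ℝ (Fin m)) :
    gaussianSmoothing μ (fun x => ∑ i, f i x) x = ∑ i, gaussianSmoothing μ (f i) x := by
  simp only [gaussianSmoothing_eq_integral]
  exact integral_finsetSum _ fun i _ => integrable_translate hμ (hf i) x

theorem abs_gaussianSmoothing_sub_le (hμ : 0 < μ) (hD : 0 ≤ D)
    (hg : ∀ x y, |g x - g y| ≤ D * ‖x - y‖)
    (x : EuclideanSpace ℝ (Fin m)) : |gaussianSmoothing μ g x - g x| ≤ D * μ * √m := by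
  have h1 : gaussianSmoothing μ g x - g x =
      ∫ v, (g (x + μ • v) - g x) ∂(stdGaussian (EuclideanSpace ℝ (Fin m))) := by
    rw [gaussianSmoothing_eq_integral, integral_sub (integrable_translate hμ hg x)
      (integrable_const _)]
    simp
  rw [h1, ← Real.norm_eq_abs]
  have h2 := integral_norm_stdGaussian_le (E := EuclideanSpace ℝ (Fin m))
  rw [finrank_euclideanSpace_fin] at h2
  refine (norm_integral_le_of_norm_le (integrable_norm_stdGaussian.const_mul (D * μ))
    (Eventually.of_forall fun v => ?_)).trans ?_
  · have h := hg (x + μ • v) x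
    rw [add_sub_cancel_left, norm_smul, Real.norm_of_nonneg hμ.le] at h
    rw [Real.norm_eq_abs]
    linarith
  · rw [integral_const_mul]
    gcongr

theorem abs_gaussianSmoothing_sub_gaussianSmoothing_le (hμ : 0 < μ)
    (hg : ∀ x y, |g x - g y| ≤ D * ‖x - y‖) (x y : EuclideanSpace ℝ (Fin m)) :
    |gaussianSmoothing μ g x - gaussianSmoothing μ g y| ≤ D * ‖x - y‖ := by
  rw [gaussianSmoothing_eq_integral, gaussianSmoothing_eq_integral,
    ← integral_sub (integrable_translate hμ hg x) (integrable_translate hμ hg y),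
    ← Real.norm_eq_abs]
  refine (norm_integral_le_of_norm_le (integrable_const (D * ‖x - y‖))
    (Eventually.of_forall fun v => ?_)).trans (by simp)
  have h := hg (x + μ • v) (y + μ • v)
  rwa [add_sub_add_right_eq_sub] at h

/-- For a convex function the mean of the oracle is a subgradient of the Gaussian smoothing. -/
theorem inner_meanOracle_le (hμ : 0 < μ) (hD : 0 ≤ D) (hg : ∀ x y, |g x - g y| ≤ D * ‖x - y‖)
    (hconv : ConvexOn ℝ Set.univ g) (x y : EuclideanSpace ℝ (Fin m)) :
    inner ℝ (meanOracle μ g x) (y - x) ≤ gaussianSmoothing μ g y - gaussianSmoothing μ g x := by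
  set γ := stdGaussian (EuclideanSpace ℝ (Fin m)) with hγ
  set h := y - x with hh
  have hcont := continuous_of_abs_sub_le hg
  set ψ : ℝ → ℝ := fun t => gaussianSmoothing μ g (x + t • h) with hψ
  have hψconv : ConvexOn ℝ Set.univ ψ := by
    refine ⟨convex_univ, fun s _ t _ a b ha hb hab => ?_⟩
    simp only [hψ, gaussianSmoothing_eq_integral, smul_eq_mul]
    rw [← integral_const_mul, ← integral_const_mul,
      ← integral_add ((integrable_translate hμ hg _).const_mul a)
        ((integrable_translate hμ hg _).const_mul b)]
    refine integral_mono (integrable_translate hμ hg _)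
      (((integrable_translate hμ hg _).const_mul a).add
        ((integrable_translate hμ hg _).const_mul b)) fun v => ?_
    have e : x + (a * s + b * t) • h + μ • v =
        a • (x + s • h + μ • v) + b • (x + t • h + μ • v) := by
      have hb' : b = 1 - a := by linarith
      rw [hb']; module
    simp only []
    rw [e]
    exact hconv.2 (Set.mem_univ _) (Set.mem_univ _) ha hb hab
  set κ := ∫ u : EuclideanSpace ℝ (Fin m), Real.exp (-(1 / 2) * ‖u‖ ^ 2) with hκ
  have hderiv : HasDerivAt ψ (inner ℝ (meanOracle μ g x) h) 0 := by
    have key := (hasDerivAt_integral_translate (fun v => g (x + μ • v)) (by fun_prop)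
      (|g x| + D * μ) (fun v => ?_) (μ⁻¹ • h)).const_mul (1 / κ)
    · convert! key using 1
      · ext t
        simp only [hψ, gaussianSmoothing]
        congr 2
        ext v
        have e : x + μ • (v + t • μ⁻¹ • h) = x + t • h + μ • v := by
          rw [smul_add, smul_comm t, smul_inv_smul₀ hμ.ne']; abel
        rw [e]
      · rw [← integral_stdGaussian fun v => g (x + μ • v) * inner ℝ v (μ⁻¹ • h), real_inner_comm,
          meanOracle, ← integral_inner (integrable_gradFreeOracle hμ hg x)]
        have hi1 : Integrable (fun v => g (x + μ • v) * inner ℝ v (μ⁻¹ • h)) γ := by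
          have hi := ((integrable_gradFreeOracle hμ hg x).const_inner (𝕜 := ℝ) h).add
            ((((memLp_id_stdGaussian (E := EuclideanSpace ℝ (Fin m)) 1 (by simp)).integrable
              le_rfl).const_inner (𝕜 := ℝ) (μ⁻¹ • h)).const_mul (g x))
          refine hi.congr (Eventually.of_forall fun v => ?_)
          simp only [Pi.add_apply, gradFreeOracle, inner_smul_right, inner_smul_left,
            real_inner_comm v h]
          simp
          field_simp
          ring
        have hi0 : ∫ v, inner ℝ v (μ⁻¹ • h) ∂γ = 0 := by
          have := integral_inner (𝕜 := ℝ) ((memLp_id_stdGaussian (E := EuclideanSpace ℝ (Fin m)) 1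
            (by simp)).integrable le_rfl) (μ⁻¹ • h)
          simp_rw [real_inner_comm (μ⁻¹ • h)]
          rw [this, integral_id_stdGaussian, inner_zero_right]
        have hi2 : Integrable (fun v => inner ℝ v (μ⁻¹ • h)) γ :=
          ((memLp_id_stdGaussian (E := EuclideanSpace ℝ (Fin m)) 1 (by simp)).integrable
            le_rfl).inner_const (𝕜 := ℝ) (μ⁻¹ • h)
        calc ∫ v, inner ℝ h (gradFreeOracle μ g x v) ∂γ
            = ∫ v, (g (x + μ • v) * inner ℝ v (μ⁻¹ • h) - g x * inner ℝ v (μ⁻¹ • h)) ∂γ := by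
              congr 1; ext v
              simp only [gradFreeOracle, inner_smul_right, real_inner_comm v h]
              field_simp
          _ = _ := by
              rw [integral_sub hi1 (hi2.const_mul _), integral_const_mul, hi0, mul_zero, sub_zero]
    · have h1 := hg (x + μ • v) x
      rw [add_sub_cancel_left, norm_smul, Real.norm_of_nonneg hμ.le] at h1
      have h2 := abs_sub_abs_le_abs_sub (g (x + μ • v)) (g x)
      nlinarith [norm_nonneg v, abs_nonneg (g x), mul_nonneg hD hμ.le,
        mul_nonneg (abs_nonneg (g x)) (norm_nonneg v)]
  have hs := hψconv.le_slope_of_hasDerivAt (Set.mem_univ 0) (Set.mem_univ 1) one_pos hderiv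
  rw [slope_def_field] at hs
  simpa [hψ, hh] using hs

end Oracle

/-! ### Stochastic approximation of the minimizers of a function -/

/-- A discrete Grönwall inequality with summable coefficients. -/
theorem exists_bound_of_recursion {v p q : ℕ → ℝ} (hv : ∀ k, 0 ≤ v k) (hp : ∀ k, 0 ≤ p k)
    (hq : ∀ k, 0 ≤ q k) (hps : Summable p) (hqs : Summable q)
    (h : ∀ k, v (k + 1) ≤ (1 + p k) * v k + q k) : ∃ B, ∀ k, v k ≤ B := by
  have key : ∀ k, v k ≤ Real.exp (∑ l ∈ Finset.range k, p l) *
      (v 0 + ∑ l ∈ Finset.range k, q l) := by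
    intro k
    induction k with
    | zero => simp
    | succ k ih =>
      rw [Finset.sum_range_succ, Finset.sum_range_succ, Real.exp_add]
      have h1 : 1 + p k ≤ Real.exp (p k) := by linarith [Real.add_one_le_exp (p k)]
      have h2 : 1 ≤ Real.exp (∑ l ∈ Finset.range k, p l) * Real.exp (p k) := by
        rw [← Real.exp_add]
        exact Real.one_le_exp (add_nonneg (Finset.sum_nonneg fun l _ => hp l) (hp k))
      have h3 : (1 + p k) * v k ≤ Real.exp (p k) * (Real.exp (∑ l ∈ Finset.range k, p l) *
          (v 0 + ∑ l ∈ Finset.range k, q l)) :=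
        mul_le_mul h1 ih (hv k) (Real.exp_pos _).le
      nlinarith [h k, mul_le_mul_of_nonneg_right h2 (hq k)]
  refine ⟨Real.exp (∑' l, p l) * (v 0 + ∑' l, q l), fun k => (key k).trans ?_⟩
  have h1 := hps.sum_le_tsum (Finset.range k) fun l _ => hp l
  have h2 := hqs.sum_le_tsum (Finset.range k) fun l _ => hq l
  have h3 := hv 0
  have h4 : 0 ≤ ∑ l ∈ Finset.range k, q l := Finset.sum_nonneg fun l _ => hq l
  gcongr

/-- A sequence whose distances to the points of a dense set of minimizers converge, and along which
the function comes close to its minimum infinitely often, converges to a minimizer. -/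
theorem exists_tendsto_argmin {E : Type*} [NormedAddCommGroup E] [ProperSpace E]
    {φ : E → ℝ} (hφ : Continuous φ) {T : Set E} (hTne : T.Nonempty) (hT : T ⊆ argminSet φ)
    (hTd : argminSet φ ⊆ closure T) {a : ℕ → ℝ} (ha0 : ∀ k, 0 ≤ a k)
    (ha1 : Tendsto (fun N => ∑ k ∈ Finset.range N, a k) atTop atTop) {x : ℕ → E}
    (hx : ∀ c ∈ T, (∃ L, Tendsto (fun k => ‖x k - c‖ ^ 2) atTop (𝓝 L)) ∧
      Summable fun k => a k * (φ (x k) - φ c)) :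
    ∃ y ∈ argminSet φ, Tendsto x atTop (𝓝 y) := by
  obtain ⟨c, hc⟩ := hTne
  obtain ⟨⟨L, hL⟩, hs⟩ := hx c hc
  have hfreq : ∀ j : ℕ, ∃ᶠ k in atTop, φ (x k) - φ c < 1 / ((j : ℝ) + 1) := by
    intro j hcon
    have hpos : 0 < 1 / ((j : ℝ) + 1) := by positivity
    have hsa : Summable a := by
      have h1 : Summable fun k => a k * (φ (x k) - φ c) / (1 / ((j : ℝ) + 1)) := hs.div_const _
      refine Summable.of_norm_bounded_eventually_nat h1 ?_
      filter_upwards [hcon] with k hk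
      rw [not_lt] at hk
      rw [Real.norm_of_nonneg (ha0 k), le_div_iff₀ hpos]
      exact mul_le_mul_of_nonneg_left hk (ha0 k)
    exact not_tendsto_nhds_of_tendsto_atTop ha1 _ hsa.hasSum.tendsto_sum_nat
  obtain ⟨ψ, hψ, hψlt⟩ := extraction_forall_of_frequently hfreq
  have hbdd : Bornology.IsBounded (Set.range (x ∘ ψ)) := by
    obtain ⟨B, hB⟩ := hL.bddAbove_range
    refine (Metric.isBounded_closedBall (x := c) (r := √B)).subset ?_
    rintro _ ⟨j, rfl⟩
    rw [Metric.mem_closedBall, dist_eq_norm]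
    exact Real.le_sqrt_of_sq_le (hB ⟨ψ j, rfl⟩)
  obtain ⟨y, -, θ, hθ, hy⟩ := tendsto_subseq_of_bounded hbdd fun j => Set.mem_range_self j
  have hsub : Tendsto (ψ ∘ θ) atTop atTop := hψ.tendsto_atTop.comp hθ.tendsto_atTop
  have hyS : y ∈ argminSet φ := by
    have h1 : Tendsto (fun j => φ ((x ∘ ψ ∘ θ) j) - φ c) atTop (𝓝 (φ y - φ c)) :=
      ((hφ.tendsto y).comp hy).sub_const _
    have h2 : Tendsto (fun j => 1 / (((θ j : ℕ) : ℝ) + 1)) atTop (𝓝 0) :=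
      tendsto_one_div_add_atTop_nhds_zero_nat.comp hθ.tendsto_atTop
    have h3 : φ y - φ c ≤ 0 := le_of_tendsto_of_tendsto' h1 h2 fun j => (hψlt (θ j)).le
    exact fun z => (sub_nonpos.1 h3).trans (hT hc z)
  refine ⟨y, hyS, Metric.tendsto_atTop'.2 fun ε hε => ?_⟩
  obtain ⟨s, hsT, hys⟩ := Metric.mem_closure_iff.1 (hTd hyS) (ε / 2) (half_pos hε)
  obtain ⟨⟨L', hL'⟩, -⟩ := hx s hsT
  have hL'eq : L' = ‖y - s‖ ^ 2 :=
    tendsto_nhds_unique (hL'.comp hsub) ((hy.sub_const s).norm.pow 2)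
  rw [dist_eq_norm] at hys
  have hlt : L' < (ε / 2) ^ 2 := by
    rw [hL'eq]; exact pow_lt_pow_left₀ hys (norm_nonneg _) two_ne_zero
  obtain ⟨N, hN⟩ := eventually_atTop.1 (hL'.eventually_lt_const hlt)
  refine ⟨N, fun k hk => ?_⟩
  have h1 : ‖x k - s‖ < ε / 2 := lt_of_pow_lt_pow_left₀ 2 (half_pos hε).le (hN k hk.le)
  rw [dist_eq_norm]
  calc ‖x k - y‖ = ‖(x k - s) - (y - s)‖ := by congr 1; abel
    _ ≤ ‖x k - s‖ + ‖y - s‖ := norm_sub_le _ _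
    _ < ε := by linarith

section Probability

variable {Ω : Type*} {mΩ : MeasurableSpace Ω} {P : Measure Ω}

theorem ae_summable_of_summable_integral {F : ℕ → Ω → ℝ} (h0 : ∀ k ω, 0 ≤ F k ω)
    (hint : ∀ k, Integrable (F k) P) (hs : Summable fun k => ∫ ω, F k ω ∂P) :
    ∀ᵐ ω ∂P, Summable fun k => F k ω := by
  have h1 : ∫⁻ ω, ∑' k, ENNReal.ofReal (F k ω) ∂P ≠ ⊤ := by
    rw [lintegral_tsum fun k => (hint k).aestronglyMeasurable.aemeasurable.ennreal_ofReal]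
    have : ∀ k, ∫⁻ ω, ENNReal.ofReal (F k ω) ∂P = ENNReal.ofReal (∫ ω, F k ω ∂P) := fun k =>
      (ofReal_integral_eq_lintegral_ofReal (hint k) (Eventually.of_forall (h0 k))).symm
    simp_rw [this]
    rw [← ENNReal.ofReal_tsum_of_nonneg (fun k => integral_nonneg (h0 k)) hs]
    exact ENNReal.ofReal_ne_top
  filter_upwards [ae_lt_top' (AEMeasurable.tsum fun k =>
    (hint k).aestronglyMeasurable.aemeasurable.ennreal_ofReal) h1] with ω hω
  have h2 := ENNReal.summable_toReal hω.ne
  simpa [ENNReal.toReal_ofReal (h0 _ ω)] using h2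

theorem integrable_norm_sq {E : Type*} [NormedAddCommGroup E] {u : Ω → E} (hu : MemLp u 2 P) :
    Integrable (fun ω => ‖u ω‖ ^ 2) P :=
  hu.norm.integrable_sq

theorem integrable_norm_mul_norm {E F : Type*} [NormedAddCommGroup E] [NormedAddCommGroup F]
    {u : Ω → E} {v : Ω → F} (hu : MemLp u 2 P) (hv : MemLp v 2 P) :
    Integrable (fun ω => ‖u ω‖ * ‖v ω‖) P :=
  hu.norm.integrable_mul hv.norm

theorem integrable_inner_of_memLp_two {E : Type*} [NormedAddCommGroup E] [InnerProductSpace ℝ E]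
    {u v : Ω → E} (hu : MemLp u 2 P) (hv : MemLp v 2 P) :
    Integrable (fun ω => inner ℝ (u ω) (v ω)) P :=
  (integrable_norm_mul_norm hu hv).mono' (hu.1.inner hv.1)
    (Eventually.of_forall fun _ => norm_inner_le_norm _ _)

/-- A square-integrable sequence that is bounded in `L²` and converges almost surely converges in
`L¹`. -/
theorem tendsto_integral_norm_sub_of_ae [IsProbabilityMeasure P] {E : Type*}
    [NormedAddCommGroup E] {X : ℕ → Ω → E} {Y : Ω → E} (hX : ∀ k, MemLp (X k) 2 P)
    {B : ℝ} (hB : ∀ k, ∫ ω, ‖X k ω‖ ^ 2 ∂P ≤ B)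
    (hlim : ∀ᵐ ω ∂P, Tendsto (fun k => X k ω) atTop (𝓝 (Y ω))) :
    MemLp Y 2 P ∧ Tendsto (fun k => ∫ ω, ‖X k ω - Y ω‖ ∂P) atTop (𝓝 0) := by
  have hnormX : ∀ k, eLpNorm (X k) 2 P ≤ ENNReal.ofReal (B ^ (2 : ℝ)⁻¹) := by
    intro k
    rw [(hX k).eLpNorm_eq_integral_rpow_norm (by simp) (by simp)]
    refine ENNReal.ofReal_le_ofReal (Real.rpow_le_rpow (integral_nonneg fun ω => by positivity) ?_
      (by simp))
    simpa using hB k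
  have hYm : AEStronglyMeasurable Y P :=
    aestronglyMeasurable_of_tendsto_ae atTop (fun k => (hX k).1) hlim
  have hY : MemLp Y 2 P := by
    refine ⟨hYm, lt_of_le_of_lt (Lp.eLpNorm_lim_le_liminf_eLpNorm (fun k => (hX k).1) Y hlim) ?_⟩
    exact lt_of_le_of_lt (liminf_le_of_le (by isBoundedDefault) fun b hb =>
      (hb.exists.elim fun k hk => hk.trans (hnormX k))) ENNReal.ofReal_lt_top
  refine ⟨hY, ?_⟩
  have hd : ∀ k, MemLp (fun ω => X k ω - Y ω) 2 P := fun k => (hX k).sub hY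
  set B' := 2 * B + 2 * ∫ ω, ‖Y ω‖ ^ 2 ∂P with hB'
  have hdB : ∀ k, ∫ ω, ‖X k ω - Y ω‖ ^ 2 ∂P ≤ B' := by
    intro k
    have h1 : ∫ ω, ‖X k ω - Y ω‖ ^ 2 ∂P ≤ ∫ ω, (2 * ‖X k ω‖ ^ 2 + 2 * ‖Y ω‖ ^ 2) ∂P := by
      refine integral_mono (integrable_norm_sq (hd k))
        (((integrable_norm_sq (hX k)).const_mul 2).add ((integrable_norm_sq hY).const_mul 2))
        fun ω => ?_
      have h2 := norm_sub_le (X k ω) (Y ω)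
      have h3 := norm_nonneg (X k ω - Y ω)
      simp only []
      nlinarith [sq_nonneg (‖X k ω‖ - ‖Y ω‖)]
    rw [integral_add ((integrable_norm_sq (hX k)).const_mul 2) ((integrable_norm_sq hY).const_mul 2),
      integral_const_mul, integral_const_mul] at h1
    linarith [hB k]
  have hB'0 : 0 ≤ B' := (integral_nonneg fun ω => by positivity).trans (hdB 0)
  -- truncate at a high level `M`; the tail costs at most `B' / M`
  refine Metric.tendsto_atTop'.2 fun ε hε => ?_
  set M := 2 * B' / ε + 1 with hM
  have hM0 : 0 < M := by positivity
  have hBM : B' / M < ε / 2 := by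
    rw [div_lt_iff₀ hM0, hM]
    have : ε / 2 * (2 * B' / ε + 1) = B' + ε / 2 := by field_simp
    rw [this]; linarith
  have hmin : Tendsto (fun k => ∫ ω, min ‖X k ω - Y ω‖ M ∂P) atTop (𝓝 0) := by
    have h0 : ∫ _ : Ω, (0 : ℝ) ∂P = 0 := integral_zero _ _
    rw [← h0]
    refine tendsto_integral_of_dominated_convergence (fun _ => M)
      (fun k => ((hd k).1.norm.inf aestronglyMeasurable_const)) (integrable_const M)
      (fun k => Eventually.of_forall fun ω => ?_) ?_
    · rw [Real.norm_of_nonneg (le_min (norm_nonneg _) hM0.le)]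
      exact min_le_right _ _
    · filter_upwards [hlim] with ω hω
      have h1 : Tendsto (fun k => ‖X k ω - Y ω‖) atTop (𝓝 0) := by
        simpa using (hω.sub_const (Y ω)).norm
      simpa [hM0.le] using h1.min (tendsto_const_nhds (x := M))
  obtain ⟨N, hN⟩ := eventually_atTop.1 (hmin.eventually_lt_const (half_pos hε))
  refine ⟨N, fun k hk => ?_⟩
  rw [Real.dist_eq, sub_zero, abs_of_nonneg (integral_nonneg fun ω => norm_nonneg _)]
  have hi1 : Integrable (fun ω => min ‖X k ω - Y ω‖ M) P :=
    ((hd k).integrable (by simp)).norm.inf (integrable_const M)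
  have hi2 : Integrable (fun ω => ‖X k ω - Y ω‖ ^ 2 / M) P :=
    (integrable_norm_sq (hd k)).div_const M
  calc ∫ ω, ‖X k ω - Y ω‖ ∂P ≤ ∫ ω, (min ‖X k ω - Y ω‖ M + ‖X k ω - Y ω‖ ^ 2 / M) ∂P := by
        refine integral_mono ((hd k).integrable (by simp)).norm (hi1.add hi2) fun ω => ?_
        set s := ‖X k ω - Y ω‖ with hs
        have hs0 : 0 ≤ s := norm_nonneg _
        simp only []
        rcases le_total s M with h | h
        · rw [min_eq_left h]
          have : 0 ≤ s ^ 2 / M := by positivity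
          linarith
        · rw [min_eq_right h]
          have : s ≤ s ^ 2 / M := by rw [le_div_iff₀ hM0]; nlinarith
          linarith
    _ = (∫ ω, min ‖X k ω - Y ω‖ M ∂P) + (∫ ω, ‖X k ω - Y ω‖ ^ 2 ∂P) / M := by
        rw [integral_add hi1 hi2, integral_div]
    _ < ε / 2 + ε / 2 := by
        refine add_lt_add_of_lt_of_le (hN k hk.le) (le_trans ?_ hBM.le)
        exact div_le_div_of_nonneg_right (hdB k) hM0.le
    _ = ε := by ring

end Probability

section StochasticDescent

variable {Ω : Type*} {mΩ : MeasurableSpace Ω} {E : Type*} [NormedAddCommGroup E]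
  [InnerProductSpace ℝ E]

/-- A stochastic subgradient recursion `X (k + 1) = X k - a k • g k` for the function `φ`, adapted to
a filtration. The vector `h k` is the conditional mean of the noisy direction `g k`, expressed through
integrals over past events, and it satisfies the subgradient inequality at `X k` up to an error
`r k * ‖X k - c‖`, where the `L²` norms of the `r k` are square-summable. -/
structure IsStochasticDescent (P : Measure Ω) (ℱ : Filtration ℕ mΩ) (φ : E → ℝ)
    (a : ℕ → ℝ) (X h g : ℕ → Ω → E) (r : ℕ → Ω → ℝ) : Prop where
  continuous : Continuous φ
  step_nonneg : ∀ k, 0 ≤ a k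
  step_tendsto : Tendsto (fun N => ∑ k ∈ Finset.range N, a k) atTop atTop
  step_sq_summable : Summable fun k => a k ^ 2
  adapted : ∀ k, StronglyMeasurable[ℱ k] (X k)
  memLp : ∀ k, MemLp (X k) 2 P
  adapted_mean : ∀ k, StronglyMeasurable[ℱ k] (h k)
  memLp_mean : ∀ k, MemLp (h k) 2 P
  adapted_dir : ∀ k, StronglyMeasurable[ℱ (k + 1)] (g k)
  memLp_dir : ∀ k, MemLp (g k) 2 P
  bound_dir : ∃ C, ∀ k, ∫ ω, ‖g k ω‖ ^ 2 ∂P ≤ C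
  step : ∀ k ω, X (k + 1) ω = X k ω - a k • g k ω
  setIntegral_eq : ∀ k s, MeasurableSet[ℱ k] s → ∀ c,
    ∫ ω in s, inner ℝ (g k ω) (X k ω - c) ∂P = ∫ ω in s, inner ℝ (h k ω) (X k ω - c) ∂P
  err_nonneg : ∀ k ω, 0 ≤ r k ω
  memLp_err : ∀ k, MemLp (r k) 2 P
  summable_err : Summable fun k => ∫ ω, r k ω ^ 2 ∂P
  subgradient : ∀ k ω c, φ (X k ω) - φ c ≤ inner ℝ (h k ω) (X k ω - c) + r k ω * ‖X k ω - c‖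

namespace IsStochasticDescent

variable {P : Measure Ω} {ℱ : Filtration ℕ mΩ} {φ : E → ℝ} {a : ℕ → ℝ}
  {X h g : ℕ → Ω → E} {r : ℕ → Ω → ℝ}

theorem norm_sub_sq_step (H : IsStochasticDescent P ℱ φ a X h g r) (c : E) (k : ℕ) (ω : Ω) :
    ‖X (k + 1) ω - c‖ ^ 2 = ‖X k ω - c‖ ^ 2 - 2 * a k * inner ℝ (g k ω) (X k ω - c) +
      a k ^ 2 * ‖g k ω‖ ^ 2 := by
  have : X (k + 1) ω - c = (X k ω - c) - a k • g k ω := by rw [H.step]; abel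
  rw [this, norm_sub_sq_real, inner_smul_right, real_inner_comm, norm_smul, mul_pow,
    Real.norm_eq_abs, sq_abs]
  ring

theorem sub_nonneg_le (H : IsStochasticDescent P ℱ φ a X h g r) {c : E} (hc : c ∈ argminSet φ)
    (k : ℕ) (ω : Ω) : 0 ≤ inner ℝ (h k ω) (X k ω - c) + r k ω * ‖X k ω - c‖ :=
  (sub_nonneg.2 (hc (X k ω))).trans (H.subgradient k ω c)

theorem summable_integral_dir (H : IsStochasticDescent P ℱ φ a X h g r) :
    Summable fun k => ∫ ω, a k ^ 2 * ‖g k ω‖ ^ 2 ∂P := by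
  obtain ⟨C, hC⟩ := H.bound_dir
  refine Summable.of_nonneg_of_le (fun k => integral_nonneg fun ω => by positivity) (fun k => ?_)
    (H.step_sq_summable.mul_right C)
  rw [integral_const_mul]
  exact mul_le_mul_of_nonneg_left (hC k) (sq_nonneg _)

variable [IsProbabilityMeasure P]

theorem memLp_sub (H : IsStochasticDescent P ℱ φ a X h g r) (c : E) (k : ℕ) :
    MemLp (fun ω => X k ω - c) 2 P :=
  (H.memLp k).sub (memLp_const c)

theorem integral_norm_sub_sq_step (H : IsStochasticDescent P ℱ φ a X h g r) (c : E) (k : ℕ) :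
    ∫ ω, ‖X (k + 1) ω - c‖ ^ 2 ∂P = (∫ ω, ‖X k ω - c‖ ^ 2 ∂P) -
      2 * a k * (∫ ω, inner ℝ (h k ω) (X k ω - c) ∂P) + a k ^ 2 * ∫ ω, ‖g k ω‖ ^ 2 ∂P := by
  have hU := H.memLp_sub c k
  have h1 := integrable_inner_of_memLp_two (H.memLp_dir k) hU
  have h2 := integrable_norm_sq hU
  have h3 := integrable_norm_sq (H.memLp_dir k)
  have h21 : Integrable (fun ω => ‖X k ω - c‖ ^ 2 - 2 * a k * inner ℝ (g k ω) (X k ω - c)) P :=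
    h2.sub (h1.const_mul _)
  simp_rw [H.norm_sub_sq_step c k]
  rw [integral_add h21 (h3.const_mul _), integral_sub h2 (h1.const_mul _),
    integral_const_mul, integral_const_mul]
  have := H.setIntegral_eq k Set.univ MeasurableSet.univ c
  rw [setIntegral_univ, setIntegral_univ] at this
  rw [this]

theorem integrable_err_mul (H : IsStochasticDescent P ℱ φ a X h g r) (c : E) (k : ℕ) :
    Integrable (fun ω => r k ω * ‖X k ω - c‖) P := by
  refine (integrable_norm_mul_norm (H.memLp_err k) (H.memLp_sub c k)).congr
    (Eventually.of_forall fun ω => ?_)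
  simp only [Real.norm_of_nonneg (H.err_nonneg k ω)]

/-- The error term is absorbed by `2 r (a u) ≤ r² + a² u²`. -/
theorem integral_err_mul_le (H : IsStochasticDescent P ℱ φ a X h g r) (c : E) (k : ℕ) :
    2 * a k * (∫ ω, r k ω * ‖X k ω - c‖ ∂P) ≤
      (∫ ω, r k ω ^ 2 ∂P) + a k ^ 2 * ∫ ω, ‖X k ω - c‖ ^ 2 ∂P := by
  have h1 := (H.memLp_err k).integrable_sq
  have h2 := integrable_norm_sq (H.memLp_sub c k)
  rw [← integral_const_mul, ← integral_const_mul, ← integral_add h1 (h2.const_mul _)]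
  refine integral_mono ((H.integrable_err_mul c k).const_mul _) (h1.add (h2.const_mul _))
    fun ω => ?_
  simp only []
  nlinarith [sq_nonneg (r k ω - a k * ‖X k ω - c‖)]

theorem exists_integral_norm_sub_sq_le (H : IsStochasticDescent P ℱ φ a X h g r) {c : E}
    (hc : c ∈ argminSet φ) : ∃ B, ∀ k, ∫ ω, ‖X k ω - c‖ ^ 2 ∂P ≤ B := by
  obtain ⟨C, hC⟩ := H.bound_dir
  have hC0 : 0 ≤ C := (integral_nonneg fun ω => by positivity).trans (hC 0)
  refine exists_bound_of_recursion (p := fun k => a k ^ 2)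
    (q := fun k => (∫ ω, r k ω ^ 2 ∂P) + a k ^ 2 * C) (fun k => integral_nonneg fun ω => by positivity)
    (fun k => sq_nonneg _)
    (fun k => add_nonneg (integral_nonneg fun ω => sq_nonneg _) (by positivity))
    H.step_sq_summable (H.summable_err.add (H.step_sq_summable.mul_right C)) fun k => ?_
  rw [H.integral_norm_sub_sq_step c k]
  have h1 := H.integral_err_mul_le c k
  have h2 : 0 ≤ (∫ ω, inner ℝ (h k ω) (X k ω - c) ∂P) + ∫ ω, r k ω * ‖X k ω - c‖ ∂P := by
    rw [← integral_add (integrable_inner_of_memLp_two (H.memLp_mean k) (H.memLp_sub c k))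
      (H.integrable_err_mul c k)]
    exact integral_nonneg fun ω => H.sub_nonneg_le hc k ω
  have h3 := mul_nonneg (mul_nonneg zero_le_two (H.step_nonneg k)) h2
  have h4 := mul_le_mul_of_nonneg_left (hC k) (sq_nonneg (a k))
  linarith

theorem summable_integral_err (H : IsStochasticDescent P ℱ φ a X h g r) {c : E}
    (hc : c ∈ argminSet φ) :
    Summable fun k => ∫ ω, 2 * a k * (r k ω * ‖X k ω - c‖) ∂P := by
  obtain ⟨B, hB⟩ := H.exists_integral_norm_sub_sq_le hc
  refine Summable.of_nonneg_of_le (fun k => integral_nonneg fun ω => ?_) (fun k => ?_)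
    (H.summable_err.add (H.step_sq_summable.mul_right B))
  · exact mul_nonneg (mul_nonneg zero_le_two (H.step_nonneg k))
      (mul_nonneg (H.err_nonneg k ω) (norm_nonneg _))
  · rw [integral_const_mul]
    exact (H.integral_err_mul_le c k).trans
      (add_le_add_right (mul_le_mul_of_nonneg_left (hB k) (sq_nonneg _)) _)

/-- The drift terms are absolutely summable in mean: their sum telescopes against the bounded second
moments, and their negative parts are controlled by the error terms. -/
theorem summable_integral_drift (H : IsStochasticDescent P ℱ φ a X h g r) {c : E}
    (hc : c ∈ argminSet φ) :
    Summable fun k => ∫ ω, 2 * a k * |inner ℝ (h k ω) (X k ω - c)| ∂P := by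
  set R : ℕ → ℝ := fun k => ∫ ω, 2 * a k * (r k ω * ‖X k ω - c‖) ∂P with hR
  set Q : ℕ → ℝ := fun k => ∫ ω, a k ^ 2 * ‖g k ω‖ ^ 2 ∂P with hQ
  set v : ℕ → ℝ := fun k => ∫ ω, ‖X k ω - c‖ ^ 2 ∂P with hv
  have ha2 : ∀ k, 0 ≤ 2 * a k := fun k => mul_nonneg zero_le_two (H.step_nonneg k)
  have hR0 : ∀ k, 0 ≤ R k := fun k => integral_nonneg fun ω =>
    mul_nonneg (ha2 k) (mul_nonneg (H.err_nonneg k ω) (norm_nonneg _))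
  have hQ0 : ∀ k, 0 ≤ Q k := fun k => integral_nonneg fun ω => by positivity
  have hle : ∀ k, ∫ ω, 2 * a k * |inner ℝ (h k ω) (X k ω - c)| ∂P ≤
      v k - v (k + 1) + Q k + 2 * R k := by
    intro k
    have hd := integrable_inner_of_memLp_two (H.memLp_mean k) (H.memLp_sub c k)
    have hr := H.integrable_err_mul c k
    have e : v k - v (k + 1) + Q k + 2 * R k =
        2 * a k * (∫ ω, inner ℝ (h k ω) (X k ω - c) ∂P) +
          2 * a k * (2 * ∫ ω, r k ω * ‖X k ω - c‖ ∂P) := by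
      simp only [hv, hQ, hR, H.integral_norm_sub_sq_step c k, integral_const_mul]
      ring
    rw [e, integral_const_mul, ← mul_add, ← integral_const_mul 2, ← integral_add hd (hr.const_mul _)]
    refine mul_le_mul_of_nonneg_left (integral_mono hd.abs (hd.add (hr.const_mul _)) fun ω => ?_)
      (ha2 k)
    have h1 := H.sub_nonneg_le hc k ω
    have h2 := mul_nonneg (H.err_nonneg k ω) (norm_nonneg (X k ω - c))
    exact abs_le.2 ⟨by linarith, by linarith⟩
  refine summable_of_sum_range_le (c := v 0 + ∑' k, Q k + 2 * ∑' k, R k)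
    (fun k => integral_nonneg fun ω => mul_nonneg (ha2 k) (abs_nonneg _)) fun n => ?_
  calc _ ≤ ∑ k ∈ Finset.range n, (v k - v (k + 1) + Q k + 2 * R k) :=
        Finset.sum_le_sum fun k _ => hle k
    _ = v 0 - v n + ∑ k ∈ Finset.range n, Q k + 2 * ∑ k ∈ Finset.range n, R k := by
        rw [Finset.sum_add_distrib, Finset.sum_add_distrib, Finset.sum_range_sub', Finset.mul_sum]
    _ ≤ _ := by
        have h1 := H.summable_integral_dir.sum_le_tsum (Finset.range n) fun k _ => hQ0 k
        have h2 := (H.summable_integral_err hc).sum_le_tsum (Finset.range n) fun k _ => hR0 k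
        have h3 : 0 ≤ v n := integral_nonneg fun ω => by positivity
        linarith

/-- The squared distance to a minimizer, compensated by its drift and by the squared step lengths, is
a martingale that is bounded in `L¹`, hence converges almost surely. -/
theorem ae_tendsto_compensated (H : IsStochasticDescent P ℱ φ a X h g r) {c : E}
    (hc : c ∈ argminSet φ) :
    ∀ᵐ ω ∂P, ∃ L, Tendsto (fun n => ‖X n ω - c‖ ^ 2 + ∑ l ∈ Finset.range n,
      (2 * a l * inner ℝ (h l ω) (X l ω - c) - a l ^ 2 * ‖g l ω‖ ^ 2)) atTop (𝓝 L) := by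
  set S : ℕ → Ω → ℝ := fun n ω => ‖X n ω - c‖ ^ 2 + ∑ l ∈ Finset.range n,
      (2 * a l * inner ℝ (h l ω) (X l ω - c) - a l ^ 2 * ‖g l ω‖ ^ 2) with hS
  have hV := fun k => integrable_norm_sq (H.memLp_sub c k)
  have hd := fun k => integrable_inner_of_memLp_two (H.memLp_mean k) (H.memLp_sub c k)
  have he := fun k => integrable_inner_of_memLp_two (H.memLp_dir k) (H.memLp_sub c k)
  have hg := fun k => integrable_norm_sq (H.memLp_dir k)
  have hSint : ∀ n, Integrable (S n) P := fun n => (hV n).add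
    (integrable_finsetSum _ fun l _ => ((hd l).const_mul _).sub ((hg l).const_mul _))
  have hSadp : StronglyAdapted ℱ S := by
    intro n
    have hX : ∀ l, StronglyMeasurable[ℱ l] fun ω => X l ω - c := fun l =>
      (H.adapted l).sub stronglyMeasurable_const
    refine StronglyMeasurable.add ((hX n).norm.pow 2) ?_
    refine Finset.stronglyMeasurable_fun_sum _ fun l hl => ?_
    have hln : l < n := Finset.mem_range.1 hl
    refine StronglyMeasurable.sub ?_ ?_
    · exact (((H.adapted_mean l).inner (hX l)).mono (ℱ.mono hln.le)).const_mul _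
    · exact (((H.adapted_dir l).norm.pow 2).mono (ℱ.mono hln)).const_mul _
  have hmart : Martingale S ℱ P := by
    refine martingale_of_setIntegral_eq_succ hSadp hSint fun n s hs => ?_
    have e : ∀ ω, S (n + 1) ω = S n ω + 2 * a n * (inner ℝ (h n ω) (X n ω - c) -
        inner ℝ (g n ω) (X n ω - c)) := by
      intro ω
      simp only [hS, Finset.sum_range_succ, H.norm_sub_sq_step c n]
      ring
    have hde : Integrable (fun ω => inner ℝ (h n ω) (X n ω - c) - inner ℝ (g n ω) (X n ω - c)) P :=
      (hd n).sub (he n)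
    simp_rw [e]
    rw [integral_add (hSint n).integrableOn (hde.const_mul _).integrableOn,
      integral_const_mul, integral_sub (hd n).integrableOn (he n).integrableOn,
      H.setIntegral_eq n s hs c, sub_self, mul_zero, add_zero]
  obtain ⟨B, hB⟩ := H.exists_integral_norm_sub_sq_le hc
  set A : ℕ → ℝ := fun k => ∫ ω, 2 * a k * |inner ℝ (h k ω) (X k ω - c)| ∂P with hA
  set Q : ℕ → ℝ := fun k => ∫ ω, a k ^ 2 * ‖g k ω‖ ^ 2 ∂P with hQ
  have ha2 : ∀ k, 0 ≤ 2 * a k := fun k => mul_nonneg zero_le_two (H.step_nonneg k)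
  have hbdd : ∀ n, ∫ ω, ‖S n ω‖ ∂P ≤ B + (∑' k, A k + ∑' k, Q k) := by
    intro n
    have hi : ∀ l, Integrable (fun ω => 2 * a l * |inner ℝ (h l ω) (X l ω - c)| +
        a l ^ 2 * ‖g l ω‖ ^ 2) P := fun l => ((hd l).abs.const_mul _).add ((hg l).const_mul _)
    calc ∫ ω, ‖S n ω‖ ∂P ≤ ∫ ω, (‖X n ω - c‖ ^ 2 + ∑ l ∈ Finset.range n,
          (2 * a l * |inner ℝ (h l ω) (X l ω - c)| + a l ^ 2 * ‖g l ω‖ ^ 2)) ∂P := by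
          refine integral_mono (hSint n).norm ((hV n).add (integrable_finsetSum _ fun l _ => hi l))
            fun ω => ?_
          refine (norm_add_le _ _).trans (add_le_add ?_ ?_)
          · rw [Real.norm_of_nonneg (by positivity)]
          · refine (norm_sum_le _ _).trans (Finset.sum_le_sum fun l _ => ?_)
            refine (norm_sub_le _ _).trans (le_of_eq ?_)
            rw [Real.norm_of_nonneg (by positivity : 0 ≤ a l ^ 2 * ‖g l ω‖ ^ 2), norm_mul,
              Real.norm_of_nonneg (ha2 l), Real.norm_eq_abs]
      _ = (∫ ω, ‖X n ω - c‖ ^ 2 ∂P) + ∑ l ∈ Finset.range n, (A l + Q l) := by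
          rw [integral_add (hV n) (integrable_finsetSum _ fun l _ => hi l),
            integral_finsetSum _ fun l _ => hi l]
          congr 1
          exact Finset.sum_congr rfl fun l _ =>
            integral_add ((hd l).abs.const_mul _) ((hg l).const_mul _)
      _ ≤ _ := by
          rw [Finset.sum_add_distrib]
          refine add_le_add (hB n) (add_le_add ?_ ?_)
          · exact (H.summable_integral_drift hc).sum_le_tsum _ fun k _ =>
              integral_nonneg fun ω => mul_nonneg (ha2 k) (abs_nonneg _)
          · exact H.summable_integral_dir.sum_le_tsum _ fun k _ =>
              integral_nonneg fun ω => by positivity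
  refine hmart.submartingale.exists_ae_tendsto_of_bdd
    (R := (B + (∑' k, A k + ∑' k, Q k)).toNNReal) fun n => ?_
  rw [eLpNorm_one_eq_lintegral_enorm, ← ofReal_integral_norm_eq_lintegral_enorm (hSint n)]
  exact ENNReal.ofReal_le_ofReal (hbdd n)

theorem ae_tendsto_and_summable (H : IsStochasticDescent P ℱ φ a X h g r) {c : E}
    (hc : c ∈ argminSet φ) :
    ∀ᵐ ω ∂P, (∃ L, Tendsto (fun k => ‖X k ω - c‖ ^ 2) atTop (𝓝 L)) ∧
      Summable fun k => a k * (φ (X k ω) - φ c) := by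
  have hd := fun k => integrable_inner_of_memLp_two (H.memLp_mean k) (H.memLp_sub c k)
  have ha2 : ∀ k, 0 ≤ 2 * a k := fun k => mul_nonneg zero_le_two (H.step_nonneg k)
  filter_upwards [H.ae_tendsto_compensated hc,
    ae_summable_of_summable_integral (fun k ω => mul_nonneg (ha2 k) (abs_nonneg _))
      (fun k => (hd k).abs.const_mul _) (H.summable_integral_drift hc),
    ae_summable_of_summable_integral (fun k ω => by positivity)
      (fun k => (integrable_norm_sq (H.memLp_dir k)).const_mul _) H.summable_integral_dir,
    ae_summable_of_summable_integral (fun k ω => mul_nonneg (ha2 k)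
      (mul_nonneg (H.err_nonneg k ω) (norm_nonneg _)))
      (fun k => (H.integrable_err_mul c k).const_mul _) (H.summable_integral_err hc)]
    with ω ⟨L, hL⟩ hs1 hs2 hs3
  have hs1' : Summable fun k => 2 * a k * inner ℝ (h k ω) (X k ω - c) := by
    refine Summable.of_norm_bounded hs1 fun k => le_of_eq ?_
    rw [norm_mul, Real.norm_of_nonneg (ha2 k), Real.norm_eq_abs]
  constructor
  · refine ⟨_, (hL.sub (hs1'.sub hs2).hasSum.tendsto_sum_nat).congr fun n => ?_⟩
    ring
  · refine Summable.of_nonneg_of_le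
      (fun k => mul_nonneg (H.step_nonneg k) (sub_nonneg.2 (hc _))) (fun k => ?_)
      ((hs1'.add hs3).div_const 2)
    have := mul_le_mul_of_nonneg_left (H.subgradient k ω c) (H.step_nonneg k)
    refine this.trans (le_of_eq ?_)
    ring

/-- A stochastic subgradient recursion converges, almost surely and in mean, to a minimizer. -/
theorem exists_tendsto [FiniteDimensional ℝ E] [MeasurableSpace E] [BorelSpace E]
    (H : IsStochasticDescent P ℱ φ a X h g r) (hne : (argminSet φ).Nonempty) :
    ∃ Y : Ω → E, Measurable Y ∧ (∀ᵐ ω ∂P, Y ω ∈ argminSet φ) ∧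
      (∀ᵐ ω ∂P, Tendsto (fun k => X k ω) atTop (𝓝 (Y ω))) ∧ MemLp Y 2 P ∧
      Tendsto (fun k => ∫ ω, ‖X k ω - Y ω‖ ∂P) atTop (𝓝 0) := by
  have : ProperSpace E := FiniteDimensional.proper ℝ E
  -- a countable dense subset of the set of minimizers reduces everything to one null set
  obtain ⟨T, hTc, hTd⟩ := TopologicalSpace.exists_countable_dense (argminSet φ)
  set T' : Set E := Subtype.val '' T with hT'
  have hT'sub : T' ⊆ argminSet φ := by rintro _ ⟨t, -, rfl⟩; exact t.2
  have hT'dense : argminSet φ ⊆ closure T' := by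
    intro y hy
    have h1 : (⟨y, hy⟩ : argminSet φ) ∈ closure T := hTd _
    exact image_closure_subset_closure_image continuous_subtype_val ⟨_, h1, rfl⟩
  have hT'ne : T'.Nonempty := by
    obtain ⟨y, hy⟩ := hne
    exact closure_nonempty_iff.1 ⟨y, hT'dense hy⟩
  have hT'c : T'.Countable := hTc.image _
  have hae : ∀ᵐ ω ∂P, ∀ c ∈ T', (∃ L, Tendsto (fun k => ‖X k ω - c‖ ^ 2) atTop (𝓝 L)) ∧
      Summable fun k => a k * (φ (X k ω) - φ c) :=
    (ae_ball_iff hT'c).2 fun c hc => H.ae_tendsto_and_summable (hT'sub hc)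
  have hlim : ∀ᵐ ω ∂P, ∃ y ∈ argminSet φ, Tendsto (fun k => X k ω) atTop (𝓝 y) := by
    filter_upwards [hae] with ω hω
    exact exists_tendsto_argmin H.continuous hT'ne hT'sub hT'dense H.step_nonneg H.step_tendsto hω
  obtain ⟨Y, hYm, hY⟩ := measurable_limit_of_tendsto_metrizable_ae
    (f := X) (fun k => (H.memLp k).1.aemeasurable)
    (hlim.mono fun ω ⟨y, _, hy⟩ => ⟨y, hy⟩)
  obtain ⟨c, hc⟩ := hne
  obtain ⟨B, hB⟩ := H.exists_integral_norm_sub_sq_le hc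
  obtain ⟨h1, h2⟩ := tendsto_integral_norm_sub_of_ae (X := fun k ω => X k ω - c)
    (Y := fun ω => Y ω - c) (H.memLp_sub c) hB (hY.mono fun ω hω => hω.sub_const c)
  refine ⟨Y, hYm, ?_, hY, ?_, ?_⟩
  · filter_upwards [hlim, hY] with ω ⟨y, hy, hyt⟩ hYω
    rwa [tendsto_nhds_unique hYω hyt]
  · have h3 := h1.add (memLp_const c)
    exact h3.ae_eq (Eventually.of_forall fun ω => by simp)
  · simpa using h2

end IsStochasticDescent

end StochasticDescent

/-! ### Consensus error -/

/-- The scalar recursion `e (k + 1) = r * e k + C * β k` that dominates the consensus error. -/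
def errorRecursion (C r e0 : ℝ) (β : ℕ → ℝ) : ℕ → ℝ
  | 0 => e0
  | k + 1 => r * errorRecursion C r e0 β k + C * β k

theorem errorRecursion_nonneg {C r e0 : ℝ} {β : ℕ → ℝ} (hC : 0 ≤ C) (hr : 0 ≤ r) (h0 : 0 ≤ e0)
    (hβ : ∀ k, 0 ≤ β k) (k : ℕ) : 0 ≤ errorRecursion C r e0 β k := by
  induction k with
  | zero => exact h0
  | succ k ih => exact add_nonneg (mul_nonneg hr ih) (mul_nonneg hC (hβ k))

/-- The square of the recursion obeys a recursion of the same kind, by convexity of the square. -/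
theorem errorRecursion_succ_sq_le {C r e0 : ℝ} {β : ℕ → ℝ} (hr0 : 0 ≤ r) (hr1 : r < 1) (k : ℕ) :
    errorRecursion C r e0 β (k + 1) ^ 2 ≤
      r * errorRecursion C r e0 β k ^ 2 + C ^ 2 / (1 - r) * β k ^ 2 := by
  have h1 : 0 < 1 - r := by linarith
  set e := errorRecursion C r e0 β k with he
  change (r * e + C * β k) ^ 2 ≤ _
  have h2 : r * e ^ 2 + C ^ 2 / (1 - r) * β k ^ 2 - (r * e + C * β k) ^ 2 =
      r * (1 - r) * (e - C * β k / (1 - r)) ^ 2 := by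
    field_simp
    ring
  have h3 : 0 ≤ r * (1 - r) * (e - C * β k / (1 - r)) ^ 2 := by positivity
  linarith

theorem summable_of_contracting_recursion {e q : ℕ → ℝ} {r : ℝ} (hr : r < 1)
    (he : ∀ k, 0 ≤ e k) (hq : ∀ k, 0 ≤ q k) (hqs : Summable q)
    (h : ∀ k, e (k + 1) ≤ r * e k + q k) : Summable e := by
  have h1 : 0 < 1 - r := by linarith
  refine summable_of_sum_range_le (c := (e 0 + ∑' k, q k) / (1 - r)) he fun n => ?_
  rw [le_div_iff₀ h1]
  have h2 : ∑ k ∈ Finset.range n, e (k + 1) ≤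
      r * ∑ k ∈ Finset.range n, e k + ∑ k ∈ Finset.range n, q k := by
    rw [Finset.mul_sum, ← Finset.sum_add_distrib]
    exact Finset.sum_le_sum fun k _ => h k
  have h3 := Finset.sum_range_succ' e n
  have h4 := Finset.sum_range_succ e n
  have h5 := hqs.sum_le_tsum (Finset.range n) fun k _ => hq k
  have h6 := he n
  linarith

/-- A linear recursion whose matrix has geometrically decaying powers is dominated by
`errorRecursion`. -/
theorem norm_le_errorRecursion {ι F : Type*} [Fintype ι] [DecidableEq ι] [NormedAddCommGroup F]
    [NormedSpace ℝ F] (B : Matrix ι ι ℝ) {C r : ℝ} (hC : 0 ≤ C) (hr : 0 ≤ r)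
    (hB : ∀ k i j, |(B ^ k) i j| ≤ C * r ^ k) (v b : ℕ → ι → F) (β : ℕ → ℝ)
    (hv : ∀ k i, v (k + 1) i = ∑ j, B i j • v k j + b k i) (hb : ∀ k, ∑ j, ‖b k j‖ ≤ β k)
    (k : ℕ) (i : ι) : ‖v k i‖ ≤ errorRecursion C r (C * ∑ j, ‖v 0 j‖) β k := by
  have hsum : ∀ (p : ℕ) (i : ι) (u : ι → F),
      ‖∑ j, (B ^ p) i j • u j‖ ≤ r ^ p * (C * ∑ j, ‖u j‖) := by
    intro p i u
    rw [← mul_assoc, Finset.mul_sum]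
    refine (norm_sum_le _ _).trans (Finset.sum_le_sum fun j _ => ?_)
    rw [norm_smul, Real.norm_eq_abs, mul_comm (r ^ p)]
    exact mul_le_mul_of_nonneg_right (hB p i j) (norm_nonneg _)
  have key : ∀ (k p : ℕ) (i : ι), ‖∑ j, (B ^ p) i j • v k j‖ ≤
      r ^ p * errorRecursion C r (C * ∑ j, ‖v 0 j‖) β k := by
    intro k
    induction k with
    | zero => exact fun p i => hsum p i (v 0)
    | succ k ih =>
      intro p i
      have e : ∑ j, (B ^ p) i j • v (k + 1) j =
          ∑ j, (B ^ (p + 1)) i j • v k j + ∑ j, (B ^ p) i j • b k j := by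
        simp only [hv, smul_add, Finset.sum_add_distrib, Finset.smul_sum, smul_smul]
        congr 1
        rw [Finset.sum_comm]
        simp only [← Finset.sum_smul, pow_succ, Matrix.mul_apply]
      rw [e]
      refine (norm_add_le _ _).trans ?_
      have h1 := ih (p + 1) i
      have h2 := hsum p i (b k)
      have h3 : r ^ p * (C * ∑ j, ‖b k j‖) ≤ r ^ p * (C * β k) := by
        have := hb k
        gcongr
      calc _ ≤ r ^ (p + 1) * errorRecursion C r (C * ∑ j, ‖v 0 j‖) β k + r ^ p * (C * β k) :=
            add_le_add h1 (h2.trans h3)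
        _ = _ := by rw [errorRecursion, pow_succ]; ring
  simpa [Matrix.one_apply] using key k 0 i

section Surplus

variable {n m : ℕ} {Wr Wc : Matrix (Fin n) (Fin n) ℝ} {ε μ : ℝ} {α : ℕ → ℝ}
  {f : Fin n → EuclideanSpace ℝ (Fin m) → ℝ} {x0 y0 : Fin n → EuclideanSpace ℝ (Fin m)}

/-- The average of all states and surpluses, which the weight matrix preserves. -/
noncomputable def surplusMean (Wr Wc : Matrix (Fin n) (Fin n) ℝ) (ε μ : ℝ)
    (α : ℕ → ℝ) (f : Fin n → EuclideanSpace ℝ (Fin m) → ℝ)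
    (x0 y0 : Fin n → EuclideanSpace ℝ (Fin m)) (z : Fin n → ℕ → EuclideanSpace ℝ (Fin m))
    (k : ℕ) : EuclideanSpace ℝ (Fin m) :=
  (n : ℝ)⁻¹ • ∑ i, ((surplusState Wr Wc ε μ α f x0 y0 z k).1 i +
    (surplusState Wr Wc ε μ α f x0 y0 z k).2 i)

theorem surplusMean_succ (hWc : Wc ∈ Matrix.colStochastic ℝ (Fin n))
    (z : Fin n → ℕ → EuclideanSpace ℝ (Fin m)) (k : ℕ) :
    surplusMean Wr Wc ε μ α f x0 y0 z (k + 1) = surplusMean Wr Wc ε μ α f x0 y0 z k -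
      (α k / n) • ∑ i, gradFreeOracle μ (f i) ((surplusState Wr Wc ε μ α f x0 y0 z k).1 i)
        (z i k) := by
  simp only [surplusMean, surplusState]
  set x := (surplusState Wr Wc ε μ α f x0 y0 z k).1
  set y := (surplusState Wr Wc ε μ α f x0 y0 z k).2
  have h1 : ∑ i, ∑ j, Wc i j • y j = ∑ j, y j := by
    rw [Finset.sum_comm]
    simp only [← Finset.sum_smul, Matrix.sum_col_of_mem_colStochastic hWc, one_smul]
  rw [div_eq_inv_mul, mul_smul, ← smul_sub]
  congr 1
  calc _ = ∑ i, (x i - α k • gradFreeOracle μ (f i) (x i) (z i k) + ∑ j, Wc i j • y j) :=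
        Finset.sum_congr rfl fun i _ => by abel
    _ = _ := by
        rw [Finset.sum_add_distrib, h1, Finset.sum_sub_distrib, Finset.smul_sum,
          Finset.sum_add_distrib]
        abel

/-- The distance of every state from the average is dominated by a scalar recursion driven by the
squared norms of the random directions. -/
theorem norm_sub_surplusMean_le (hn : 1 ≤ n) (hWr : Wr ∈ Matrix.rowStochastic ℝ (Fin n))
    (hWc : Wc ∈ Matrix.colStochastic ℝ (Fin n)) (hα : ∀ k, 0 ≤ α k) (hμ : 0 < μ) {D : ℝ}
    (hf : ∀ i x y, |f i x - f i y| ≤ D * ‖x - y‖) {C r : ℝ} (hC : 0 ≤ C) (hr : 0 ≤ r)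
    (hB : ∀ k i j, |((surplusMatrix Wr Wc ε - averagingMatrix n) ^ k) i j| ≤ C * r ^ k) :
    ∃ e0 : ℝ, 0 ≤ e0 ∧ ∀ (z : Fin n → ℕ → EuclideanSpace ℝ (Fin m)) (k : ℕ) (i : Fin n),
      ‖(surplusState Wr Wc ε μ α f x0 y0 z k).1 i - surplusMean Wr Wc ε μ α f x0 y0 z k‖ ≤
        errorRecursion C r e0 (fun k => 2 * α k * (D * ∑ j, ‖z j k‖ ^ 2)) k := by
  have hn0 : (n : ℝ) ≠ 0 := by positivity
  refine ⟨C * ∑ j : Fin n ⊕ Fin n, ‖Sum.elim (fun i => x0 i - (n : ℝ)⁻¹ • ∑ i, (x0 i + y0 i))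
    y0 j‖, mul_nonneg hC (Finset.sum_nonneg fun j _ => norm_nonneg _), fun z k i => ?_⟩
  set X := fun k => (surplusState Wr Wc ε μ α f x0 y0 z k).1 with hX
  set Y := fun k => (surplusState Wr Wc ε μ α f x0 y0 z k).2 with hY
  set M := surplusMean Wr Wc ε μ α f x0 y0 z with hM
  set g : ℕ → Fin n → EuclideanSpace ℝ (Fin m) := fun k i =>
    gradFreeOracle μ (f i) (X k i) (z i k) with hg
  set v : ℕ → Fin n ⊕ Fin n → EuclideanSpace ℝ (Fin m) := fun k =>
    Sum.elim (fun i => X k i - M k) (Y k) with hv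
  set b : ℕ → Fin n ⊕ Fin n → EuclideanSpace ℝ (Fin m) := fun k =>
    Sum.elim (fun i => (α k / n) • ∑ j, g k j - α k • g k i) 0 with hb
  have hgle : ∀ k i, ‖g k i‖ ≤ D * ‖z i k‖ ^ 2 := fun k i => norm_gradFreeOracle_le hμ (hf i) _ _
  have hbsum : ∀ k, ∑ j, ‖b k j‖ ≤ 2 * α k * (D * ∑ j, ‖z j k‖ ^ 2) := by
    intro k
    have h1 : ∑ j, ‖g k j‖ ≤ D * ∑ j, ‖z j k‖ ^ 2 := by
      rw [Finset.mul_sum]; exact Finset.sum_le_sum fun j _ => hgle k j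
    have h2 : ∀ i, ‖(α k / n) • ∑ j, g k j - α k • g k i‖ ≤
        α k / n * ∑ j, ‖g k j‖ + α k * ‖g k i‖ := by
      intro i
      refine (norm_sub_le _ _).trans ?_
      rw [norm_smul, norm_smul, Real.norm_of_nonneg (hα k),
        Real.norm_of_nonneg (div_nonneg (hα k) n.cast_nonneg)]
      have := norm_sum_le Finset.univ (g k)
      have := div_nonneg (hα k) (Nat.cast_nonneg (α := ℝ) n)
      gcongr
    rw [Fintype.sum_sum_type]
    simp only [hb, Sum.elim_inl, Sum.elim_inr, Pi.zero_apply, norm_zero, Finset.sum_const_zero,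
      add_zero]
    calc _ ≤ ∑ i, (α k / n * ∑ j, ‖g k j‖ + α k * ‖g k i‖) := Finset.sum_le_sum fun i _ => h2 i
      _ = 2 * α k * ∑ j, ‖g k j‖ := by
        rw [Finset.sum_add_distrib, ← Finset.mul_sum (a := α k), Finset.sum_const, Finset.card_univ,
          Fintype.card_fin, nsmul_eq_mul]
        field_simp
        ring
      _ ≤ _ := mul_le_mul_of_nonneg_left h1 (mul_nonneg zero_le_two (hα k))
  have hzero : ∀ k, ∑ j, (X k j - M k) + ∑ j, Y k j = 0 := by
    intro k
    have : (n : ℝ) • M k = ∑ i, (X k i + Y k i) := by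
      rw [hM, surplusMean, smul_inv_smul₀ hn0]
    rw [Finset.sum_sub_distrib, Finset.sum_const, Finset.card_univ, Fintype.card_fin,
      ← Nat.cast_smul_eq_nsmul ℝ, this, Finset.sum_add_distrib]
    abel
  have hrow : ∀ i, ∑ j, Wr i j = 1 := Matrix.sum_row_of_mem_rowStochastic hWr
  have hstep : ∀ k i, v (k + 1) i = ∑ j, (surplusMatrix Wr Wc ε - averagingMatrix n) i j • v k j +
      b k i := by
    intro k i
    have hMk : M (k + 1) = M k - (α k / n) • ∑ j, g k j := surplusMean_succ hWc z k
    have hWM : ∀ i, ∑ j, Wr i j • (X k j - M k) = ∑ j, Wr i j • X k j - M k := by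
      intro i
      simp only [smul_sub, Finset.sum_sub_distrib, ← Finset.sum_smul, hrow, one_smul]
    rcases i with i | i
    · have hXk : X (k + 1) i = ∑ j, Wr i j • X k j + ε • Y k i - α k • g k i := rfl
      simp only [hv, hb, Sum.elim_inl, Fintype.sum_sum_type, Matrix.sub_apply, surplusMatrix,
        averagingMatrix, Matrix.fromBlocks_apply₁₁, Matrix.fromBlocks_apply₁₂, Matrix.of_apply,
        Sum.elim_inr, sub_smul, Finset.sum_sub_distrib, hWM, Matrix.smul_apply,
        Matrix.one_apply, smul_eq_mul, mul_ite, mul_one, mul_zero, ite_smul, zero_smul,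
        Finset.sum_ite_eq, Finset.mem_univ, if_true, ← Finset.smul_sum, hXk, hMk]
      have h := congrArg (fun u => (n : ℝ)⁻¹ • u) (hzero k)
      simp only [smul_add, smul_zero] at h
      rw [Finset.sum_sub_distrib] at h
      rw [← sub_eq_zero, ← h]
      simp only [smul_sub]
      abel
    · have hYk : Y (k + 1) i = X k i - ∑ j, Wr i j • X k j + ∑ j, Wc i j • Y k j - ε • Y k i := rfl
      simp only [hv, hb, Sum.elim_inl, Fintype.sum_sum_type, Matrix.sub_apply, surplusMatrix,
        averagingMatrix, Matrix.fromBlocks_apply₂₁, Matrix.fromBlocks_apply₂₂, Matrix.zero_apply,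
        Sum.elim_inr, sub_smul, Finset.sum_sub_distrib, hWM, Matrix.smul_apply,
        Finset.sum_const_zero,
        Matrix.one_apply, smul_eq_mul, mul_ite, mul_one, mul_zero, ite_smul, zero_smul, one_smul,
        Finset.sum_ite_eq, Finset.mem_univ, if_true, hYk, Pi.zero_apply]
      abel
  exact norm_le_errorRecursion _ hC hr hB v b _ hstep hbsum k (Sum.inl i)

end Surplus

/-! ### The random iterates -/

section Random

variable {Ω : Type*} {n m : ℕ} {Wr Wc : Matrix (Fin n) (Fin n) ℝ} {ε μ D : ℝ} {α : ℕ → ℝ}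
  {f : Fin n → EuclideanSpace ℝ (Fin m) → ℝ} {x0 y0 : Fin n → EuclideanSpace ℝ (Fin m)}
  {ζ : Fin n → ℕ → Ω → EuclideanSpace ℝ (Fin m)}

theorem measurable_pastSigma (ζ : Fin n → ℕ → Ω → EuclideanSpace ℝ (Fin m)) {r k : ℕ}
    (h : r < k) (j : Fin n) : Measurable[pastSigma ζ k] (ζ j r) :=
  (comap_measurable (ζ j r)).mono
    (le_iSup_of_le j (le_iSup_of_le r (le_iSup_of_le h le_rfl))) le_rfl

/-- The σ-algebras generated by the past directions, as a filtration. -/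
def pastFiltration [mΩ : MeasurableSpace Ω] (ζ : Fin n → ℕ → Ω → EuclideanSpace ℝ (Fin m))
    (hζ : ∀ i k, Measurable (ζ i k)) : Filtration ℕ mΩ where
  seq := pastSigma ζ
  mono' _ _ hkl := iSup_mono fun _ => iSup_mono fun _ => iSup_mono' fun h =>
    ⟨h.trans_le hkl, le_rfl⟩
  le' _ := iSup_le fun j => iSup_le fun r => iSup_le fun _ => (hζ j r).comap_le

/-- The surplus `y_k^i` of agent `i` at time `k`, as a random vector. -/
noncomputable def agentSurplus (Wr Wc : Matrix (Fin n) (Fin n) ℝ)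
    (ε μ : ℝ) (α : ℕ → ℝ) (f : Fin n → EuclideanSpace ℝ (Fin m) → ℝ)
    (x0 y0 : Fin n → EuclideanSpace ℝ (Fin m)) (ζ : Fin n → ℕ → Ω → EuclideanSpace ℝ (Fin m))
    (i : Fin n) (k : ℕ) (ω : Ω) : EuclideanSpace ℝ (Fin m) :=
  (surplusState Wr Wc ε μ α f x0 y0 (fun j r => ζ j r ω) k).2 i

theorem agentIterate_zero (i : Fin n) :
    agentIterate Wr Wc ε μ α f x0 y0 ζ i 0 = fun _ => x0 i := rfl

theorem agentSurplus_zero (i : Fin n) :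
    agentSurplus Wr Wc ε μ α f x0 y0 ζ i 0 = fun _ => y0 i := rfl

theorem agentIterate_succ (i : Fin n) (k : ℕ) :
    agentIterate Wr Wc ε μ α f x0 y0 ζ i (k + 1) = fun ω =>
      ∑ j, Wr i j • agentIterate Wr Wc ε μ α f x0 y0 ζ j k ω +
        ε • agentSurplus Wr Wc ε μ α f x0 y0 ζ i k ω -
        α k • gradFreeOracle μ (f i) (agentIterate Wr Wc ε μ α f x0 y0 ζ i k ω) (ζ i k ω) := rfl

theorem agentSurplus_succ (i : Fin n) (k : ℕ) :
    agentSurplus Wr Wc ε μ α f x0 y0 ζ i (k + 1) = fun ω =>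
      agentIterate Wr Wc ε μ α f x0 y0 ζ i k ω -
        ∑ j, Wr i j • agentIterate Wr Wc ε μ α f x0 y0 ζ j k ω +
        ∑ j, Wc i j • agentSurplus Wr Wc ε μ α f x0 y0 ζ j k ω -
        ε • agentSurplus Wr Wc ε μ α f x0 y0 ζ i k ω := rfl

theorem surplusMean_eq (k : ℕ) (ω : Ω) :
    surplusMean Wr Wc ε μ α f x0 y0 (fun j r => ζ j r ω) k = (n : ℝ)⁻¹ •
      ∑ i, (agentIterate Wr Wc ε μ α f x0 y0 ζ i k ω +
        agentSurplus Wr Wc ε μ α f x0 y0 ζ i k ω) := rfl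

attribute [local irreducible] gradFreeOracle agentIterate agentSurplus

theorem measurable_gradFreeOracle {_ : MeasurableSpace Ω} {g : EuclideanSpace ℝ (Fin m) → ℝ}
    (hg : Continuous g) {x z : Ω → EuclideanSpace ℝ (Fin m)} (hx : Measurable x)
    (hz : Measurable z) : Measurable fun ω => gradFreeOracle μ g (x ω) (z ω) :=
  (continuous_gradFreeOracle hg).measurable.comp (hx.prodMk hz)

theorem measurable_agent {_ : MeasurableSpace Ω} (hf : ∀ i, Continuous (f i)) (k : ℕ)
    (hζ : ∀ j r, r < k → Measurable (ζ j r)) :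
    (∀ i, Measurable (agentIterate Wr Wc ε μ α f x0 y0 ζ i k)) ∧
      ∀ i, Measurable (agentSurplus Wr Wc ε μ α f x0 y0 ζ i k) := by
  induction k with
  | zero =>
    simp only [agentIterate_zero, agentSurplus_zero]
    exact ⟨fun i => measurable_const, fun i => measurable_const⟩
  | succ k ih =>
    obtain ⟨h1, h2⟩ := ih fun j r hr => hζ j r (hr.trans k.lt_succ_self)
    have h3 : ∀ i, Measurable fun ω => gradFreeOracle μ (f i)
        (agentIterate Wr Wc ε μ α f x0 y0 ζ i k ω) (ζ i k ω) := fun i =>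
      measurable_gradFreeOracle (hf i) (h1 i) (hζ i k k.lt_succ_self)
    simp only [agentIterate_succ, agentSurplus_succ]
    constructor <;> intro i <;> fun_prop

theorem measurable_surplusMean {_ : MeasurableSpace Ω} (hf : ∀ i, Continuous (f i)) (k : ℕ)
    (hζ : ∀ j r, r < k → Measurable (ζ j r)) :
    Measurable fun ω => surplusMean Wr Wc ε μ α f x0 y0 (fun j r => ζ j r ω) k := by
  obtain ⟨h1, h2⟩ := measurable_agent (Wr := Wr) (Wc := Wc) (ε := ε) (μ := μ) (α := α)
    (x0 := x0) (y0 := y0) hf k hζ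
  simp only [surplusMean_eq]
  fun_prop

variable {mΩ : MeasurableSpace Ω} {P : Measure Ω}

theorem memLp_gradFreeOracle {g : EuclideanSpace ℝ (Fin m) → ℝ} (hμ : 0 < μ)
    (hg : ∀ x y, |g x - g y| ≤ D * ‖x - y‖) {x z : Ω → EuclideanSpace ℝ (Fin m)}
    (hx : Measurable x) (hz : Measurable z) (hzsq : MemLp (fun ω => ‖z ω‖ ^ 2) 2 P) :
    MemLp (fun ω => gradFreeOracle μ g (x ω) (z ω)) 2 P :=
  (hzsq.const_mul D).mono'
    (measurable_gradFreeOracle (continuous_of_abs_sub_le hg) hx hz).aestronglyMeasurable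
    (Eventually.of_forall fun _ => norm_gradFreeOracle_le hμ hg _ _)

section Law

variable {z : Ω → EuclideanSpace ℝ (Fin m)}

theorem memLp_norm_sq_of_map_eq (hz : Measurable z)
    (hlaw : P.map z = stdGaussian (EuclideanSpace ℝ (Fin m))) :
    MemLp (fun ω => ‖z ω‖ ^ 2) 2 P := by
  have h := memLp_norm_sq_stdGaussian (E := EuclideanSpace ℝ (Fin m))
  rw [← hlaw] at h
  exact h.comp_of_map hz.aemeasurable

theorem integral_comp_of_map_eq (hz : Measurable z)
    (hlaw : P.map z = stdGaussian (EuclideanSpace ℝ (Fin m)))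
    {G : EuclideanSpace ℝ (Fin m) → ℝ} (hG : Continuous G) :
    ∫ ω, G (z ω) ∂P = ∫ v, G v ∂(stdGaussian (EuclideanSpace ℝ (Fin m))) := by
  rw [← hlaw, integral_map hz.aemeasurable hG.aestronglyMeasurable]

/-- A random direction that is independent of the σ-algebra `m₀` can be averaged out of inner
products with `m₀`-measurable vectors. -/
theorem integral_inner_gradFreeOracle {m₀ mΩ : MeasurableSpace Ω} {P : Measure Ω}
    [IsProbabilityMeasure P] {z : Ω → EuclideanSpace ℝ (Fin m)} (hm₀ : m₀ ≤ mΩ) (hz : Measurable z)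
    (hlaw : P.map z = stdGaussian (EuclideanSpace ℝ (Fin m)))
    (hind : Indep (MeasurableSpace.comap z inferInstance) m₀ P)
    {g : EuclideanSpace ℝ (Fin m) → ℝ} (hμ : 0 < μ) (hg : ∀ x y, |g x - g y| ≤ D * ‖x - y‖)
    {x u : Ω → EuclideanSpace ℝ (Fin m)} (hx : Measurable[m₀] x) (hu : Measurable[m₀] u)
    (hint : Integrable (fun ω => inner ℝ (gradFreeOracle μ g (x ω) (z ω)) (u ω)) P) :
    ∫ ω, inner ℝ (gradFreeOracle μ g (x ω) (z ω)) (u ω) ∂P =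
      ∫ ω, inner ℝ (meanOracle μ g (x ω)) (u ω) ∂P := by
  have hgc := continuous_of_abs_sub_le hg
  have hp0 : Measurable[m₀] fun ω => (x ω, u ω) := hx.prodMk hu
  have hp : Measurable fun ω => (x ω, u ω) := hp0.mono hm₀ le_rfl
  have hindep : IndepFun (fun ω => (x ω, u ω)) z P :=
    indep_of_indep_of_le_left hind.symm hp0.comap_le
  have hmap := (indepFun_iff_map_prod_eq_prod_map_map hp.aemeasurable hz.aemeasurable).1 hindep
  rw [hlaw] at hmap
  have : IsProbabilityMeasure (P.map fun ω => (x ω, u ω)) :=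
    Measure.isProbabilityMeasure_map hp.aemeasurable
  set Φ : (EuclideanSpace ℝ (Fin m) × EuclideanSpace ℝ (Fin m)) × EuclideanSpace ℝ (Fin m) → ℝ :=
    fun q => inner ℝ (gradFreeOracle μ g q.1.1 q.2) q.1.2 with hΦ
  have hΦc : Continuous Φ :=
    ((continuous_gradFreeOracle hgc).comp (f := fun q : (EuclideanSpace ℝ (Fin m) ×
      EuclideanSpace ℝ (Fin m)) × _ => (q.1.1, q.2)) (by fun_prop)).inner (by fun_prop)
  have hΦint : Integrable Φ
      ((P.map fun ω => (x ω, u ω)).prod (stdGaussian (EuclideanSpace ℝ (Fin m)))) := by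
    rw [← hmap]
    exact (integrable_map_measure hΦc.aestronglyMeasurable (hp.prodMk hz).aemeasurable).2 hint
  calc ∫ ω, inner ℝ (gradFreeOracle μ g (x ω) (z ω)) (u ω) ∂P
      = ∫ q, Φ q ∂((P.map fun ω => (x ω, u ω)).prod (stdGaussian (EuclideanSpace ℝ (Fin m)))) := by
        rw [← hmap, integral_map (hp.prodMk hz).aemeasurable hΦc.aestronglyMeasurable]
    _ = ∫ p, inner ℝ (meanOracle μ g p.1) p.2 ∂(P.map fun ω => (x ω, u ω)) := by
        rw [integral_prod _ hΦint]
        congr 1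
        ext1 p
        simp only [hΦ, meanOracle, real_inner_comm p.2]
        exact integral_inner (integrable_gradFreeOracle hμ hg p.1) p.2
    _ = _ := by
        rw [integral_map hp.aemeasurable]
        exact (((continuous_meanOracle hμ hg).comp continuous_fst).inner
          continuous_snd).aestronglyMeasurable

end Law

theorem memLp_agent [IsProbabilityMeasure P] (hμ : 0 < μ)
    (hf : ∀ i x y, |f i x - f i y| ≤ D * ‖x - y‖) (hζ : ∀ i k, Measurable (ζ i k))
    (hζsq : ∀ i k, MemLp (fun ω => ‖ζ i k ω‖ ^ 2) 2 P) (k : ℕ) :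
    (∀ i, MemLp (agentIterate Wr Wc ε μ α f x0 y0 ζ i k) 2 P) ∧
      ∀ i, MemLp (agentSurplus Wr Wc ε μ α f x0 y0 ζ i k) 2 P := by
  induction k with
  | zero =>
    simp only [agentIterate_zero, agentSurplus_zero]
    exact ⟨fun i => memLp_const _, fun i => memLp_const _⟩
  | succ k ih =>
    obtain ⟨h1, h2⟩ := ih
    have hm := (measurable_agent (Wr := Wr) (Wc := Wc) (ε := ε) (μ := μ) (α := α)
      (x0 := x0) (y0 := y0) (fun i => continuous_of_abs_sub_le (hf i)) k fun j r _ => hζ j r).1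
    have h3 : ∀ i, MemLp (fun ω => gradFreeOracle μ (f i)
        (agentIterate Wr Wc ε μ α f x0 y0 ζ i k ω) (ζ i k ω)) 2 P := fun i =>
      memLp_gradFreeOracle hμ (hf i) (hm i) (hζ i k) (hζsq i k)
    simp only [agentIterate_succ, agentSurplus_succ]
    constructor
    · intro i
      exact ((memLp_finsetSum _ fun j _ => (h1 j).const_smul (Wr i j)).add
        ((h2 i).const_smul ε)).sub ((h3 i).const_smul (α k))
    · intro i
      exact (((h1 i).sub (memLp_finsetSum _ fun j _ => (h1 j).const_smul (Wr i j))).add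
        (memLp_finsetSum _ fun j _ => (h2 j).const_smul (Wc i j))).sub ((h2 i).const_smul ε)

theorem memLp_surplusMean [IsProbabilityMeasure P] (hμ : 0 < μ)
    (hf : ∀ i x y, |f i x - f i y| ≤ D * ‖x - y‖) (hζ : ∀ i k, Measurable (ζ i k))
    (hζsq : ∀ i k, MemLp (fun ω => ‖ζ i k ω‖ ^ 2) 2 P) (k : ℕ) :
    MemLp (fun ω => surplusMean Wr Wc ε μ α f x0 y0 (fun j r => ζ j r ω) k) 2 P := by
  obtain ⟨h1, h2⟩ := memLp_agent (Wr := Wr) (Wc := Wc) (ε := ε) (α := α) (x0 := x0) (y0 := y0)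
    hμ hf hζ hζsq k
  simp only [surplusMean_eq]
  have h : MemLp (fun ω => ∑ i, (agentIterate Wr Wc ε μ α f x0 y0 ζ i k ω +
      agentSurplus Wr Wc ε μ α f x0 y0 ζ i k ω)) 2 P :=
    memLp_finsetSum _ fun i _ => (h1 i).add (h2 i)
  exact h.const_smul (n : ℝ)⁻¹

theorem memLp_errorRecursion [IsFiniteMeasure P] {C r e0 : ℝ} {β : ℕ → Ω → ℝ}
    (hβ : ∀ k, MemLp (β k) 2 P) (k : ℕ) :
    MemLp (fun ω => errorRecursion C r e0 (fun k => β k ω) k) 2 P := by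
  induction k with
  | zero => exact memLp_const e0
  | succ k ih => exact (ih.const_mul r).add ((hβ k).const_mul C)

theorem summable_integral_sq_of_contracting {c r : ℝ} {e β : ℕ → Ω → ℝ} (hc : 0 ≤ c) (hr1 : r < 1)
    (he : ∀ k, MemLp (e k) 2 P) (hβ : ∀ k, MemLp (β k) 2 P)
    (hβs : Summable fun k => ∫ ω, β k ω ^ 2 ∂P)
    (h : ∀ k ω, e (k + 1) ω ^ 2 ≤ r * e k ω ^ 2 + c * β k ω ^ 2) :
    Summable fun k => ∫ ω, e k ω ^ 2 ∂P := by
  refine summable_of_contracting_recursion (q := fun k => c * ∫ ω, β k ω ^ 2 ∂P) hr1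
    (fun k => integral_nonneg fun ω => sq_nonneg _)
    (fun k => mul_nonneg hc (integral_nonneg fun ω => sq_nonneg _)) (hβs.mul_left _) fun k => ?_
  rw [← integral_const_mul, ← integral_const_mul, ← integral_add
    ((he k).integrable_sq.const_mul _) ((hβ k).integrable_sq.const_mul _)]
  exact integral_mono (he (k + 1)).integrable_sq (((he k).integrable_sq.const_mul _).add
    ((hβ k).integrable_sq.const_mul _)) (h k)

/-- Square-summable inputs give square-summable consensus errors. -/
theorem summable_integral_errorRecursion_sq [IsFiniteMeasure P] {C r e0 : ℝ} {β : ℕ → Ω → ℝ}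
    (hr0 : 0 ≤ r) (hr1 : r < 1) (hβ : ∀ k, MemLp (β k) 2 P)
    (hβs : Summable fun k => ∫ ω, β k ω ^ 2 ∂P) :
    Summable fun k => ∫ ω, errorRecursion C r e0 (fun k => β k ω) k ^ 2 ∂P :=
  summable_integral_sq_of_contracting (div_nonneg (sq_nonneg C) (sub_nonneg.2 hr1.le)) hr1
    (memLp_errorRecursion hβ) hβ hβs fun k _ => errorRecursion_succ_sq_le hr0 hr1 k

theorem integral_sum_norm_sq_sq_le (hζ : ∀ i k, Measurable (ζ i k))
    (hlaw : ∀ i k, P.map (ζ i k) = stdGaussian (EuclideanSpace ℝ (Fin m))) (k : ℕ) :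
    ∫ ω, (∑ j, ‖ζ j k ω‖ ^ 2) ^ 2 ∂P ≤
      n * (n * ∫ v, (‖v‖ ^ 2) ^ 2 ∂(stdGaussian (EuclideanSpace ℝ (Fin m)))) := by
  have hsq := fun j => memLp_norm_sq_of_map_eq (hζ j k) (hlaw j k)
  have h1 : MemLp (fun ω => ∑ j, ‖ζ j k ω‖ ^ 2) 2 P := memLp_finsetSum _ fun j _ => hsq j
  calc ∫ ω, (∑ j, ‖ζ j k ω‖ ^ 2) ^ 2 ∂P ≤ ∫ ω, n * ∑ j, (‖ζ j k ω‖ ^ 2) ^ 2 ∂P := by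
        refine integral_mono h1.integrable_sq
          ((integrable_finsetSum _ fun j _ => (hsq j).integrable_sq).const_mul _) fun ω => ?_
        have := sq_sum_le_card_mul_sum_sq (s := Finset.univ) (f := fun j => ‖ζ j k ω‖ ^ 2)
        simpa using this
    _ = _ := by
        rw [integral_const_mul, integral_finsetSum _ fun j _ => (hsq j).integrable_sq]
        congr 1
        rw [Finset.sum_congr rfl fun j _ => integral_comp_of_map_eq (hζ j k) (hlaw j k)
          (G := fun v => (‖v‖ ^ 2) ^ 2) (by fun_prop)]
        simp

theorem abs_sum_sub_sum_le (hf : ∀ i x y, |f i x - f i y| ≤ D * ‖x - y‖)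
    (x y : EuclideanSpace ℝ (Fin m)) : |∑ i, f i x - ∑ i, f i y| ≤ n * D * ‖x - y‖ := by
  rw [← Finset.sum_sub_distrib]
  refine (Finset.abs_sum_le_sum_abs _ _).trans ((Finset.sum_le_sum fun i _ => hf i x y).trans ?_)
  simp [mul_assoc]

end Random

/-! ### The average of the network as a stochastic descent -/

section Descent

variable {Ω : Type*} {mΩ : MeasurableSpace Ω} {P : Measure Ω} {n m : ℕ}
  {Wr Wc : Matrix (Fin n) (Fin n) ℝ} {ε μ D : ℝ} {α : ℕ → ℝ}
  {f : Fin n → EuclideanSpace ℝ (Fin m) → ℝ} {x0 y0 : Fin n → EuclideanSpace ℝ (Fin m)}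
  {ζ : Fin n → ℕ → Ω → EuclideanSpace ℝ (Fin m)}

attribute [local irreducible] gradFreeOracle agentIterate agentSurplus

/-- The sum of the mean oracles at the points `x i` is a subgradient of the smoothed cost at `X`, up to
an error proportional to the distance of the `x i` from `X`. -/
theorem sum_gaussianSmoothing_sub_le (hμ : 0 < μ) (hD : 0 ≤ D)
    (hf : ∀ i x y, |f i x - f i y| ≤ D * ‖x - y‖)
    (hconv : ConvexOn ℝ Set.univ fun x => ∑ i, f i x) {x : Fin n → EuclideanSpace ℝ (Fin m)}
    {X : EuclideanSpace ℝ (Fin m)} {e : ℝ} (hx : ∀ i, ‖x i - X‖ ≤ e)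
    (c : EuclideanSpace ℝ (Fin m)) :
    ∑ i, gaussianSmoothing μ (f i) X - ∑ i, gaussianSmoothing μ (f i) c ≤
      inner ℝ (∑ i, meanOracle μ (f i) (x i)) (X - c) +
        n * (2 * D / μ * ∫ v, ‖v‖ ∂(stdGaussian (EuclideanSpace ℝ (Fin m)))) * e * ‖X - c‖ := by
  set L := 2 * D / μ * ∫ v, ‖v‖ ∂(stdGaussian (EuclideanSpace ℝ (Fin m))) with hL
  have hL0 : 0 ≤ L := mul_nonneg (by positivity) (integral_nonneg fun v => norm_nonneg v)
  have h1 := inner_meanOracle_le hμ (mul_nonneg n.cast_nonneg hD) (abs_sum_sub_sum_le hf) hconv X c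
  rw [gaussianSmoothing_sum hμ hf, gaussianSmoothing_sum hμ hf, meanOracle_sum hμ hf] at h1
  have h2 : inner ℝ (∑ i, meanOracle μ (f i) X) (X - c) =
      inner ℝ (∑ i, meanOracle μ (f i) (x i)) (X - c) +
        inner ℝ (∑ i, (meanOracle μ (f i) X - meanOracle μ (f i) (x i))) (X - c) := by
    rw [← inner_add_left, Finset.sum_sub_distrib, add_sub_cancel]
  have h3 : ‖∑ i, (meanOracle μ (f i) X - meanOracle μ (f i) (x i))‖ ≤ n * L * e := by
    refine (norm_sum_le _ _).trans ?_
    calc _ ≤ ∑ _i : Fin n, L * e := Finset.sum_le_sum fun i _ => by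
          refine (norm_meanOracle_sub_le hμ (hf i) X (x i)).trans ?_
          rw [norm_sub_rev]
          exact mul_le_mul_of_nonneg_left (hx i) hL0
      _ = _ := by simp [mul_assoc]
  have h4 := (real_inner_le_norm (∑ i, (meanOracle μ (f i) X - meanOracle μ (f i) (x i)))
    (X - c)).trans (mul_le_mul_of_nonneg_right h3 (norm_nonneg _))
  have h5 : inner ℝ (∑ i, meanOracle μ (f i) X) (c - X) =
      -inner ℝ (∑ i, meanOracle μ (f i) X) (X - c) := by
    rw [← inner_neg_right, neg_sub]
  linarith

theorem memLp_sum_gradFreeOracle (hμ : 0 < μ) (hf : ∀ i x y, |f i x - f i y| ≤ D * ‖x - y‖)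
    (hζ : ∀ i k, Measurable (ζ i k))
    (hζsq : ∀ i k, MemLp (fun ω => ‖ζ i k ω‖ ^ 2) 2 P) (k : ℕ) :
    MemLp (fun ω => ∑ i, gradFreeOracle μ (f i) (agentIterate Wr Wc ε μ α f x0 y0 ζ i k ω)
      (ζ i k ω)) 2 P := by
  have hm := (measurable_agent (Wr := Wr) (Wc := Wc) (ε := ε) (μ := μ) (α := α)
    (x0 := x0) (y0 := y0) (fun i => continuous_of_abs_sub_le (hf i)) k fun j r _ => hζ j r).1
  exact memLp_finsetSum _ fun i _ => memLp_gradFreeOracle hμ (hf i) (hm i) (hζ i k) (hζsq i k)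

theorem norm_sum_gradFreeOracle_sq_le (hμ : 0 < μ) (hf : ∀ i x y, |f i x - f i y| ≤ D * ‖x - y‖)
    (x v : Fin n → EuclideanSpace ℝ (Fin m)) :
    ‖∑ i, gradFreeOracle μ (f i) (x i) (v i)‖ ^ 2 ≤ D ^ 2 * (∑ i, ‖v i‖ ^ 2) ^ 2 := by
  rw [← mul_pow]
  refine pow_le_pow_left₀ (norm_nonneg _) ?_ 2
  rw [Finset.mul_sum]
  exact (norm_sum_le _ _).trans (Finset.sum_le_sum fun i _ => norm_gradFreeOracle_le hμ (hf i) _ _)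

/-- Given the past, the mean of the summed oracles is the sum of the mean oracles. -/
theorem setIntegral_inner_sum_gradFreeOracle [IsProbabilityMeasure P] (hμ : 0 < μ)
    (hf : ∀ i x y, |f i x - f i y| ≤ D * ‖x - y‖)
    (hζ : ∀ i k, Measurable (ζ i k))
    (hlaw : ∀ i k, P.map (ζ i k) = stdGaussian (EuclideanSpace ℝ (Fin m)))
    (hind : ∀ i k, Indep (MeasurableSpace.comap (ζ i k) inferInstance) (pastSigma ζ k) P)
    (k : ℕ) {s : Set Ω} (hs : MeasurableSet[pastSigma ζ k] s)
    {u : Ω → EuclideanSpace ℝ (Fin m)} (hu : Measurable[pastSigma ζ k] u) (hu2 : MemLp u 2 P) :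
    ∫ ω in s, inner ℝ (∑ i, gradFreeOracle μ (f i)
        (agentIterate Wr Wc ε μ α f x0 y0 ζ i k ω) (ζ i k ω)) (u ω) ∂P =
      ∫ ω in s, inner ℝ (∑ i, meanOracle μ (f i)
        (agentIterate Wr Wc ε μ α f x0 y0 ζ i k ω)) (u ω) ∂P := by
  have hle : pastSigma ζ k ≤ mΩ := (pastFiltration ζ hζ).le k
  have hx : ∀ i, Measurable[pastSigma ζ k] (agentIterate Wr Wc ε μ α f x0 y0 ζ i k) :=
    (measurable_agent (fun i => continuous_of_abs_sub_le (hf i)) k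
      fun j r hr => measurable_pastSigma ζ hr j).1
  have hsu : Measurable[pastSigma ζ k] (s.indicator u) := hu.indicator hs
  have hsu2 : MemLp (s.indicator u) 2 P := hu2.indicator (hle s hs)
  have e : ∀ g : Ω → EuclideanSpace ℝ (Fin m),
      ∫ ω in s, inner ℝ (g ω) (u ω) ∂P = ∫ ω, inner ℝ (g ω) (s.indicator u ω) ∂P := by
    intro g
    rw [← integral_indicator (hle s hs)]
    congr 1
    ext ω
    by_cases hω : ω ∈ s <;> simp [hω]
  rw [e, e]
  simp only [sum_inner]
  have hi1 : ∀ i, Integrable (fun ω => inner ℝ (gradFreeOracle μ (f i)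
      (agentIterate Wr Wc ε μ α f x0 y0 ζ i k ω) (ζ i k ω)) (s.indicator u ω)) P := fun i =>
    integrable_inner_of_memLp_two (memLp_gradFreeOracle hμ (hf i) ((hx i).mono hle le_rfl) (hζ i k)
      (memLp_norm_sq_of_map_eq (hζ i k) (hlaw i k))) hsu2
  have hi2 : ∀ i, Integrable (fun ω => inner ℝ (meanOracle μ (f i)
      (agentIterate Wr Wc ε μ α f x0 y0 ζ i k ω)) (s.indicator u ω)) P := fun i =>
    integrable_inner_of_memLp_two (MemLp.of_bound ((continuous_meanOracle hμ (hf i)).measurable.comp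
      ((hx i).mono hle le_rfl)).aestronglyMeasurable _
      (Eventually.of_forall fun ω => norm_meanOracle_le hμ (hf i) _)) hsu2
  rw [integral_finsetSum _ fun i _ => hi1 i, integral_finsetSum _ fun i _ => hi2 i]
  exact Finset.sum_congr rfl fun i _ => integral_inner_gradFreeOracle hle (hζ i k) (hlaw i k)
    (hind i k) hμ (hf i) (hx i) hsu (hi1 i)

/-- If the disagreement of the agents is square-summable in mean square, then the average of the
network performs a stochastic descent for the smoothed cost. -/
theorem isStochasticDescent_surplusMean [IsProbabilityMeasure P] (hn : 1 ≤ n)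
    (hWc : Wc ∈ Matrix.colStochastic ℝ (Fin n))
    (hconv : ConvexOn ℝ Set.univ fun x => ∑ i, f i x) (hD : 0 ≤ D)
    (hf : ∀ i x y, |f i x - f i y| ≤ D * ‖x - y‖) (hμ : 0 < μ) (hα0 : ∀ k, 0 ≤ α k)
    (hα1 : Tendsto (fun N => ∑ k ∈ Finset.range N, α k) atTop atTop)
    (hα2 : Summable fun k => α k ^ 2) (hζ : ∀ i k, Measurable (ζ i k))
    (hlaw : ∀ i k, P.map (ζ i k) = stdGaussian (EuclideanSpace ℝ (Fin m)))
    (hind : ∀ i k, Indep (MeasurableSpace.comap (ζ i k) inferInstance) (pastSigma ζ k) P)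
    {e : ℕ → Ω → ℝ} (he0 : ∀ k ω, 0 ≤ e k ω) (he : ∀ k, MemLp (e k) 2 P)
    (hes : Summable fun k => ∫ ω, e k ω ^ 2 ∂P)
    (hxe : ∀ k ω i, ‖agentIterate Wr Wc ε μ α f x0 y0 ζ i k ω -
      surplusMean Wr Wc ε μ α f x0 y0 (fun j r => ζ j r ω) k‖ ≤ e k ω) :
    IsStochasticDescent P (pastFiltration ζ hζ) (fun x => ∑ i, gaussianSmoothing μ (f i) x)
      (fun k => α k / n) (fun k ω => surplusMean Wr Wc ε μ α f x0 y0 (fun j r => ζ j r ω) k)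
      (fun k ω => ∑ i, meanOracle μ (f i) (agentIterate Wr Wc ε μ α f x0 y0 ζ i k ω))
      (fun k ω => ∑ i, gradFreeOracle μ (f i) (agentIterate Wr Wc ε μ α f x0 y0 ζ i k ω) (ζ i k ω))
      (fun k ω => n * (2 * D / μ * ∫ v, ‖v‖ ∂(stdGaussian (EuclideanSpace ℝ (Fin m)))) * e k ω) := by
  have hζsq := fun i k => memLp_norm_sq_of_map_eq (hζ i k) (hlaw i k)
  have hfc := fun i => continuous_of_abs_sub_le (hf i)
  have hn0 : (0 : ℝ) < n := by exact_mod_cast hn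
  have hx : ∀ k i, Measurable[pastSigma ζ k] (agentIterate Wr Wc ε μ α f x0 y0 ζ i k) := fun k =>
    (measurable_agent hfc k fun j r hr => measurable_pastSigma ζ hr j).1
  have hX : ∀ k, Measurable[pastSigma ζ k] fun ω =>
      surplusMean Wr Wc ε μ α f x0 y0 (fun j r => ζ j r ω) k := fun k =>
    measurable_surplusMean hfc k fun j r hr => measurable_pastSigma ζ hr j
  have hXm : ∀ k, MemLp (fun ω => surplusMean Wr Wc ε μ α f x0 y0 (fun j r => ζ j r ω) k) 2 P :=
    memLp_surplusMean hμ hf hζ hζsq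
  have hmean : ∀ k, Measurable[pastSigma ζ k] fun ω =>
      ∑ i, meanOracle μ (f i) (agentIterate Wr Wc ε μ α f x0 y0 ζ i k ω) := fun k =>
    Finset.measurable_fun_sum _ fun i _ =>
      (continuous_meanOracle hμ (hf i)).measurable.comp (hx k i)
  have hdir := memLp_sum_gradFreeOracle (P := P) (Wr := Wr) (Wc := Wc) (ε := ε) (α := α)
    (x0 := x0) (y0 := y0) hμ hf hζ hζsq
  constructor
  case continuous =>
    have : ∀ i, Continuous (gaussianSmoothing μ (f i)) := fun i =>
      continuous_of_abs_sub_le (abs_gaussianSmoothing_sub_gaussianSmoothing_le hμ (hf i))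
    fun_prop
  case step_nonneg => exact fun k => div_nonneg (hα0 k) hn0.le
  case step_tendsto =>
    simp only [← Finset.sum_div]
    exact hα1.atTop_div_const hn0
  case step_sq_summable =>
    simp only [div_pow]
    exact hα2.div_const _
  case adapted => exact fun k => (hX k).stronglyMeasurable
  case memLp => exact hXm
  case adapted_mean => exact fun k => (hmean k).stronglyMeasurable
  case memLp_mean =>
    refine fun k => memLp_finsetSum _ fun i _ => MemLp.of_bound
      ((continuous_meanOracle hμ (hf i)).measurable.comp
        ((hx k i).mono ((pastFiltration ζ hζ).le k) le_rfl)).aestronglyMeasurable _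
      (Eventually.of_forall fun ω => norm_meanOracle_le hμ (hf i) _)
  case adapted_dir =>
    intro k
    have hle : pastSigma ζ k ≤ pastSigma ζ (k + 1) := (pastFiltration ζ hζ).mono k.le_succ
    have h : Measurable[pastSigma ζ (k + 1)] fun ω => ∑ i, gradFreeOracle μ (f i)
        (agentIterate Wr Wc ε μ α f x0 y0 ζ i k ω) (ζ i k ω) :=
      Finset.measurable_fun_sum _ fun i _ => measurable_gradFreeOracle (hfc i)
        ((hx k i).mono hle le_rfl) (measurable_pastSigma ζ k.lt_succ_self i)
    exact h.stronglyMeasurable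
  case memLp_dir => exact hdir
  case bound_dir =>
    refine ⟨D ^ 2 * (n * (n * ∫ v, (‖v‖ ^ 2) ^ 2 ∂(stdGaussian (EuclideanSpace ℝ (Fin m))))),
      fun k => ?_⟩
    refine le_trans ?_ (mul_le_mul_of_nonneg_left (integral_sum_norm_sq_sq_le hζ hlaw k)
      (sq_nonneg D))
    rw [← integral_const_mul]
    have h1 : MemLp (fun ω => ∑ j, ‖ζ j k ω‖ ^ 2) 2 P := memLp_finsetSum _ fun j _ => hζsq j k
    exact integral_mono (integrable_norm_sq (hdir k)) (h1.integrable_sq.const_mul _) fun ω =>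
      norm_sum_gradFreeOracle_sq_le hμ hf _ _
  case step =>
    intro k ω
    rw [surplusMean_succ hWc]
    unfold agentIterate
    rfl
  case setIntegral_eq =>
    intro k s hs c
    exact setIntegral_inner_sum_gradFreeOracle hμ hf hζ hlaw hind k hs
      ((hX k).sub measurable_const) ((hXm k).sub (memLp_const c))
  case err_nonneg =>
    exact fun k ω => mul_nonneg (mul_nonneg hn0.le (mul_nonneg (by positivity)
      (integral_nonneg fun v => norm_nonneg v))) (he0 k ω)
  case memLp_err => exact fun k => (he k).const_mul _
  case summable_err =>
    simp only [mul_pow (_ * _) (e _ _), integral_const_mul]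
    exact hes.mul_left _
  case subgradient =>
    exact fun k ω c => sum_gaussianSmoothing_sub_le hμ hD hf hconv (hxe k ω) c

end Descent

/-! ### Convergence of the agents -/

section Convergence

variable {Ω : Type*} {mΩ : MeasurableSpace Ω} {P : Measure Ω}

/-- Random variables with summable second moments tend to zero, almost surely and in mean. -/
theorem tendsto_zero_of_summable_integral_sq [IsProbabilityMeasure P] {e : ℕ → Ω → ℝ}
    (he : ∀ k, MemLp (e k) 2 P)
    (hes : Summable fun k => ∫ ω, e k ω ^ 2 ∂P) :
    (∀ᵐ ω ∂P, Tendsto (fun k => e k ω) atTop (𝓝 0)) ∧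
      Tendsto (fun k => ∫ ω, e k ω ∂P) atTop (𝓝 0) := by
  constructor
  · filter_upwards [ae_summable_of_summable_integral (fun k ω => sq_nonneg (e k ω))
      (fun k => (he k).integrable_sq) hes] with ω hω
    have h := hω.tendsto_atTop_zero
    rw [tendsto_zero_iff_abs_tendsto_zero]
    simpa [Real.sqrt_sq_eq_abs, Function.comp_def] using h.sqrt
  · have h : Tendsto (fun k => (∫ ω, e k ω ∂P) ^ 2) atTop (𝓝 0) := by
      refine squeeze_zero (fun k => sq_nonneg _) (fun k => ?_) hes.tendsto_atTop_zero
      have h1 := variance_nonneg (e k) P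
      rw [variance_eq_sub (he k)] at h1
      simpa using h1
    rw [tendsto_zero_iff_abs_tendsto_zero]
    simpa [Real.sqrt_sq_eq_abs, Function.comp_def] using h.sqrt

theorem tendsto_integral_comp_of_abs_sub_le {E : Type*} [NormedAddCommGroup E] {F : E → ℝ} {K : ℝ}
    (hF : ∀ x y, |F x - F y| ≤ K * ‖x - y‖) {x : ℕ → Ω → E} {Y : Ω → E}
    (hx : ∀ k, Integrable (fun ω => F (x k ω)) P) (hY : Integrable (fun ω => F (Y ω)) P)
    (hxY : ∀ k, Integrable (fun ω => x k ω - Y ω) P)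
    (h : Tendsto (fun k => ∫ ω, ‖x k ω - Y ω‖ ∂P) atTop (𝓝 0)) :
    Tendsto (fun k => ∫ ω, F (x k ω) ∂P) atTop (𝓝 (∫ ω, F (Y ω) ∂P)) := by
  rw [tendsto_iff_norm_sub_tendsto_zero]
  refine squeeze_zero (fun k => norm_nonneg _) (fun k => ?_) (by simpa using h.const_mul K)
  rw [← integral_sub (hx k) hY, ← integral_const_mul]
  exact norm_integral_le_of_norm_le ((hxY k).norm.const_mul K)
    (Eventually.of_forall fun ω => hF _ _)

theorem integrable_comp_of_abs_sub_le [IsProbabilityMeasure P] {m : ℕ}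
    {F : EuclideanSpace ℝ (Fin m) → ℝ} {K : ℝ} (hF : ∀ x y, |F x - F y| ≤ K * ‖x - y‖)
    {x : Ω → EuclideanSpace ℝ (Fin m)}
    (hx : Integrable x P) : Integrable (fun ω => F (x ω)) P := by
  refine Integrable.mono' (g := fun ω => |F 0| + K * ‖x ω‖)
    ((integrable_const _).add (hx.norm.const_mul K))
    ((continuous_of_abs_sub_le hF).comp_aestronglyMeasurable hx.1)
    (Eventually.of_forall fun ω => ?_)
  have h1 := hF (x ω) 0
  rw [sub_zero] at h1
  have h2 := abs_sub_abs_le_abs_sub (F (x ω)) (F 0)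
  rw [Real.norm_eq_abs]
  linarith

/-- A minimizer of the smoothed cost almost minimizes the cost itself. -/
theorem sum_le_of_mem_argminSet_smoothing {n m : ℕ} {f : Fin n → EuclideanSpace ℝ (Fin m) → ℝ}
    {μ D : ℝ} (hμ : 0 < μ) (hD : 0 ≤ D) (hf : ∀ i x y, |f i x - f i y| ≤ D * ‖x - y‖)
    {x : EuclideanSpace ℝ (Fin m)}
    (hx : x ∈ argminSet fun x => ∑ i, gaussianSmoothing μ (f i) x)
    (c : EuclideanSpace ℝ (Fin m)) :
    ∑ i, f i x ≤ ∑ i, f i c + 2 * n * √m * μ * D := by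
  have h : ∀ c, |∑ i, gaussianSmoothing μ (f i) c - ∑ i, f i c| ≤ n * (D * μ * √m) := by
    intro c
    rw [← Finset.sum_sub_distrib]
    refine (Finset.abs_sum_le_sum_abs _ _).trans ((Finset.sum_le_sum fun i _ =>
      abs_gaussianSmoothing_sub_le hμ hD (hf i) c).trans ?_)
    simp
  have h1 := abs_le.1 (h x)
  have h2 := abs_le.1 (h c)
  have h3 : ∑ i, gaussianSmoothing μ (f i) x ≤ ∑ i, gaussianSmoothing μ (f i) c := hx c
  linarith [h1.1, h2.2]

variable {n m : ℕ} {Wr Wc : Matrix (Fin n) (Fin n) ℝ} {ε μ D : ℝ} {α : ℕ → ℝ}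
  {f : Fin n → EuclideanSpace ℝ (Fin m) → ℝ} {x0 y0 : Fin n → EuclideanSpace ℝ (Fin m)}
  {ζ : Fin n → ℕ → Ω → EuclideanSpace ℝ (Fin m)}

/-- The disagreement of the agents is dominated by a process with summable second moments. -/
theorem exists_consensus_bound [IsProbabilityMeasure P] (hn : 1 ≤ n)
    (hWr : Wr ∈ Matrix.rowStochastic ℝ (Fin n)) (hcr : Wr.PosConnected)
    (hWc : Wc ∈ Matrix.colStochastic ℝ (Fin n)) (hcc : Wc.transpose.PosConnected)
    (hε0 : 0 < ε) (hε : ε ≤ epsBar Wr Wc) (hD : 0 ≤ D)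
    (hf : ∀ i x y, |f i x - f i y| ≤ D * ‖x - y‖) (hμ : 0 < μ) (hα0 : ∀ k, 0 ≤ α k)
    (hα2 : Summable fun k => α k ^ 2) (hζ : ∀ i k, Measurable (ζ i k))
    (hlaw : ∀ i k, P.map (ζ i k) = stdGaussian (EuclideanSpace ℝ (Fin m))) :
    ∃ e : ℕ → Ω → ℝ, (∀ k ω, 0 ≤ e k ω) ∧ (∀ k, MemLp (e k) 2 P) ∧
      (Summable fun k => ∫ ω, e k ω ^ 2 ∂P) ∧
      ∀ k ω i, ‖agentIterate Wr Wc ε μ α f x0 y0 ζ i k ω -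
        surplusMean Wr Wc ε μ α f x0 y0 (fun j r => ζ j r ω) k‖ ≤ e k ω := by
  obtain ⟨C, r, hC, hr0, hr1, hB⟩ :=
    exists_pow_sub_averagingMatrix_le hn hWr hcr hWc hcc ε hε0 hε
  have hC0 : 0 ≤ C := zero_le_one.trans hC
  obtain ⟨e0, he0, hle⟩ := norm_sub_surplusMean_le (x0 := x0) (y0 := y0) hn hWr hWc hα0 hμ hf hC0
    hr0.le hB
  set β : ℕ → Ω → ℝ := fun k ω => 2 * α k * (D * ∑ j, ‖ζ j k ω‖ ^ 2) with hβ
  have hs2 : ∀ k, MemLp (fun ω => ∑ j, ‖ζ j k ω‖ ^ 2) 2 P := fun k =>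
    memLp_finsetSum _ fun j _ => memLp_norm_sq_of_map_eq (hζ j k) (hlaw j k)
  have hβ2 : ∀ k, MemLp (β k) 2 P := fun k => ((hs2 k).const_mul D).const_mul (2 * α k)
  have hβs : Summable fun k => ∫ ω, β k ω ^ 2 ∂P := by
    refine Summable.of_nonneg_of_le (fun k => integral_nonneg fun ω => sq_nonneg _) (fun k => ?_)
      (hα2.mul_right (4 * D ^ 2 *
        (n * (n * ∫ v, (‖v‖ ^ 2) ^ 2 ∂(stdGaussian (EuclideanSpace ℝ (Fin m)))))))
    have h1 : ∀ ω, β k ω ^ 2 = α k ^ 2 * (4 * D ^ 2) * (∑ j, ‖ζ j k ω‖ ^ 2) ^ 2 := fun ω => by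
      simp only [hβ]; ring
    simp only [h1]
    rw [integral_const_mul, mul_assoc (α k ^ 2)]
    exact mul_le_mul_of_nonneg_left (mul_le_mul_of_nonneg_left
      (integral_sum_norm_sq_sq_le hζ hlaw k) (by positivity)) (sq_nonneg _)
  refine ⟨fun k ω => errorRecursion C r e0 (fun k => β k ω) k, fun k ω => ?_,
    memLp_errorRecursion hβ2, summable_integral_errorRecursion_sq hr0.le hr1 hβ2 hβs,
    fun k ω i => hle (fun j r => ζ j r ω) k i⟩
  refine errorRecursion_nonneg hC0 hr0.le he0 (fun k => ?_) k
  exact mul_nonneg (mul_nonneg zero_le_two (hα0 k))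
    (mul_nonneg hD (Finset.sum_nonneg fun j _ => sq_nonneg _))

end Convergence

theorem Digraph.IsWeightMatrix.posConnected {n : ℕ} {G : Digraph (Fin n)}
    {A : Matrix (Fin n) (Fin n) ℝ} (hA : G.IsWeightMatrix A) (hG : G.IsStronglyConnected) :
    A.PosConnected := fun i j =>
  Relation.reflTransGen_swap.1 (Relation.ReflTransGen.mono (fun a b h => (hA b a).1 h) _ _ (hG j i))

theorem Digraph.IsWeightMatrix.posConnected_transpose {n : ℕ} {G : Digraph (Fin n)}
    {A : Matrix (Fin n) (Fin n) ℝ} (hA : G.IsWeightMatrix A) (hG : G.IsStronglyConnected) :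
    A.transpose.PosConnected := fun i j =>
  Relation.ReflTransGen.mono (fun a b h => (hA b a).1 h) _ _ (hG i j)

theorem theorem2 {Ω : Type*} [MeasurableSpace Ω] (P : Measure Ω) [IsProbabilityMeasure P]
    (n m : ℕ)
    -- the communication graph
    (G : Digraph (Fin n)) (hG : G.IsStronglyConnected) (hloop : ∀ i, G.Adj i i)
    -- the row-stochastic and the column-stochastic weights
    (Wr Wc : Matrix (Fin n) (Fin n) ℝ)
    (hWr : G.IsWeightMatrix Wr) (hWr1 : Wr ∈ Matrix.rowStochastic ℝ (Fin n))
    (hWc : G.IsWeightMatrix Wc) (hWc1 : Wc ∈ Matrix.colStochastic ℝ (Fin n))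
    -- the costs
    (f : Fin n → EuclideanSpace ℝ (Fin m) → ℝ)
    (hconv : ConvexOn ℝ Set.univ (fun x => ∑ i, f i x))
    (D : ℝ) (hD : 0 < D) (hLip : ∀ i x y, |f i x - f i y| ≤ D * ‖x - y‖)
    (hopt : (argminSet (fun x => ∑ i, f i x)).Nonempty)
    -- the smoothing parameter
    (μ : ℝ) (hμ : 0 < μ)
    (hoptμ : (argminSet (fun x => ∑ i, gaussianSmoothing μ (f i) x)).Nonempty)
    -- the parameter of the weight matrix and the step sizes
    (ε : ℝ) (hε0 : 0 < ε) (hε : ε ≤ epsBar Wr Wc)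
    (α : ℕ → ℝ) (hα0 : ∀ k, 0 ≤ α k)
    (hα1 : Tendsto (fun N => ∑ k ∈ Finset.range N, α k) atTop atTop)
    (hα2 : Summable (fun k => α k ^ 2))
    -- the initial states and the random directions
    (x0 y0 : Fin n → EuclideanSpace ℝ (Fin m))
    (ζ : Fin n → ℕ → Ω → EuclideanSpace ℝ (Fin m))
    (hζm : ∀ i k, Measurable (ζ i k))
    (hζlaw : ∀ i k, P.map (ζ i k) = stdGaussian (EuclideanSpace ℝ (Fin m)))
    (hζind : ∀ i k, Indep (MeasurableSpace.comap (ζ i k) inferInstance) (pastSigma ζ k) P) :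
    (∃ X : Ω → EuclideanSpace ℝ (Fin m), Measurable X ∧
      (∀ᵐ ω ∂P, X ω ∈ argminSet (fun x => ∑ i, gaussianSmoothing μ (f i) x)) ∧
      ∀ i,
        (∀ᵐ ω ∂P, Tendsto (fun k => agentIterate Wr Wc ε μ α f x0 y0 ζ i k ω) atTop
          (𝓝 (X ω))) ∧
        (∀ k, Integrable (fun ω => agentIterate Wr Wc ε μ α f x0 y0 ζ i k ω - X ω) P) ∧
        Tendsto (fun k => ∫ ω, ‖agentIterate Wr Wc ε μ α f x0 y0 ζ i k ω - X ω‖ ∂P) atTop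
          (𝓝 0)) ∧
    ∀ i,
      (∀ k, Integrable (fun ω => ∑ j, f j (agentIterate Wr Wc ε μ α f x0 y0 ζ i k ω)) P) ∧
      ∃ l : ℝ,
        Tendsto (fun k => ∫ ω, ∑ j, f j (agentIterate Wr Wc ε μ α f x0 y0 ζ i k ω) ∂P) atTop
          (𝓝 l) ∧
        ∀ xs ∈ argminSet (fun x => ∑ j, f j x),
          l - ∑ j, f j xs ≤ 2 * n * √m * μ * D := by
  rcases Nat.eq_zero_or_pos n with rfl | hn
  · exact ⟨⟨fun _ => 0, measurable_const, Eventually.of_forall fun ω y => by simp,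
      fun i => i.elim0⟩, fun i => i.elim0⟩
  have hLipF := abs_sum_sub_sum_le hLip
  obtain ⟨e, he0, he, hes, hxe⟩ := exists_consensus_bound (P := P) (x0 := x0) (y0 := y0) hn hWr1
    (hWr.posConnected hG) hWc1 (hWc.posConnected_transpose hG) hε0 hε hD.le hLip hμ hα0 hα2 hζm
    hζlaw
  obtain ⟨Y, hYm, hYmin, hY, hY2, hYL⟩ := (isStochasticDescent_surplusMean hn hWc1 hconv hD.le hLip
    hμ hα0 hα1 hα2 hζm hζlaw hζind he0 he hes hxe).exists_tendsto hoptμ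
  obtain ⟨hea, heL⟩ := tendsto_zero_of_summable_integral_sq he hes
  have hζsq := fun i k => memLp_norm_sq_of_map_eq (hζm i k) (hζlaw i k)
  have hx2 := fun k i => (memLp_agent (Wr := Wr) (Wc := Wc) (ε := ε) (α := α) (x0 := x0) (y0 := y0)
    hμ hLip hζm hζsq k).1 i
  have hX2 := fun k => memLp_surplusMean (Wr := Wr) (Wc := Wc) (ε := ε) (α := α) (x0 := x0)
    (y0 := y0) hμ hLip hζm hζsq k
  have hYint : Integrable Y P := hY2.integrable (by simp)
  have hxint := fun k i => (hx2 k i).integrable (by simp)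
  have hxY := fun k i => (hxint k i).sub hYint
  have htri : ∀ k ω i, ‖agentIterate Wr Wc ε μ α f x0 y0 ζ i k ω - Y ω‖ ≤
      e k ω + ‖surplusMean Wr Wc ε μ α f x0 y0 (fun j r => ζ j r ω) k - Y ω‖ := fun k ω i =>
    (norm_sub_le_norm_sub_add_norm_sub _ _ _).trans (add_le_add_left (hxe k ω i) _)
  have hxL : ∀ i, Tendsto (fun k => ∫ ω, ‖agentIterate Wr Wc ε μ α f x0 y0 ζ i k ω - Y ω‖ ∂P)
      atTop (𝓝 0) := by
    intro i
    refine squeeze_zero (fun k => integral_nonneg fun ω => norm_nonneg _) (fun k => ?_)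
      (by simpa using heL.add hYL)
    have h1 := (he k).integrable (by simp)
    have h2 : Integrable (fun ω =>
        ‖surplusMean Wr Wc ε μ α f x0 y0 (fun j r => ζ j r ω) k - Y ω‖) P :=
      ((hX2 k).sub hY2).norm.integrable (by simp)
    rw [← integral_add h1 h2]
    exact integral_mono (hxY k i).norm (h1.add h2) fun ω => htri k ω i
  refine ⟨⟨Y, hYm, hYmin, fun i => ⟨?_, fun k => hxY k i, hxL i⟩⟩, fun i =>
    ⟨fun k => integrable_comp_of_abs_sub_le hLipF (hxint k i), ∫ ω, ∑ j, f j (Y ω) ∂P,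
      tendsto_integral_comp_of_abs_sub_le hLipF
        (fun k => integrable_comp_of_abs_sub_le hLipF (hxint k i))
        (integrable_comp_of_abs_sub_le hLipF hYint) (fun k => hxY k i) (hxL i), fun xs _ => ?_⟩⟩
  · filter_upwards [hea, hY] with ω h1 h2
    rw [tendsto_iff_norm_sub_tendsto_zero]
    exact squeeze_zero (fun k => norm_nonneg _) (fun k => htri k ω i)
      (by simpa using h1.add (tendsto_iff_norm_sub_tendsto_zero.1 h2))
  · rw [sub_le_iff_le_add']
    calc ∫ ω, ∑ j, f j (Y ω) ∂P ≤ ∫ _ω, (∑ j, f j xs + 2 * n * √m * μ * D) ∂P := by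
          refine integral_mono_ae (integrable_comp_of_abs_sub_le hLipF hYint) (integrable_const _) ?_
          filter_upwards [hYmin] with ω hω
          exact sum_le_of_mem_argminSet_smoothing hμ hD.le hLip hω xs
      _ = _ := by simp
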